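/- **Setting.** Let $\mathcal M$ be a smooth 4-manifold (possibly with boundary) and $\mathcal U\subseteq\mathcal M$ an open set carrying a smooth null tetrad $(\ell,k,m,m^*)$, with $\ell,k$ real and $g(\ell,k)=-1$, $g(m,m^*)=1$, all other products zero (signature $(-,+,+,+)$). A solution of the conformal Einstein field equations (CEFEs) consists of a metric $g$ with Levi-Civita connection $\nabla$, smooth functions $\Xi,s$, a symmetric tensor $L_{ab}$ and a tensor $d_{abcd}$ with the algebraic symmetries of a Weyl tensor (including trace-freeness), such that $L_{ab}=\tfrac12R_{ab}-\tfrac1{12}Rg_{ab}$ is the Schouten tensor of $g$, $C_{abcd}=\Xi\, d_{abcd}$ is its Weyl tensor, and $$\nabla_a\nabla_b\Xi+\Xi L_{ab}-s g_{ab}=0,\quad \nabla_a s+L_{ac}\nabla^c\Xi=0,\quad \nabla_aL_{bc}-\nabla_bL_{ac}-d^{d}{}_{cab}\nabla_d\Xi=0,\quad \nabla_e d^{e}{}_{abc}=0 .$$ Here $R(X,Y)Z=\nabla_X\nabla_YZ-\nabla_Y\nabla_XZ-\nabla_{[X,Y]}Z$, $R_{abcd}=g(e_a,R(e_c,e_d)e_b)$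 and $R_{bd}=R^a{}_{bad}$. The linearised CEFEs are regarded as equations for the perturbations $\check Q$ of all unknowns (metric, tetrad, connection coefficients, and the tetrad components of $L$ and $d$, as well as $\Xi$ and $s$): each equation, including the normalisation of the tetrad and the metric and torsion-free conditions on the connection, holds for $\mathring Q+t\check Q$ to first order in $t$ at $t=0$. Write $\phi_0=d(\ell,m,\ell,m)$, $\phi_2=d(\ell,m,m^*,k)$, $\phi_4=d(k,m^*,k,m^*)$, and $\Psi_n$ for the same components of the Weyl tensor of $g$; let $D,\Delta,\delta,\delta^*$ be the derivatives along $\ell,k,m,m^*$, and $$\rho=-g(\nabla_{m^*}\ell,m),\quad \tau=-g(\nabla_k\ell,m),\quad \pi=g(\nabla_\ell k,m^*),\quad \mu=g(\nabla_mk,m^*),$$ $$\epsilon,\gamma,\beta,\alpha=-\tfrac12\big(g(\nabla_v\ell,k)-g(\nabla_vm,m^*)\big)\quad\text{for } v=\ell,\,k,\,m,\,m^*\text{ respectively.}$$ **Proposition.** Let $(\mathring g,\mathring\Xi,\mathring s,\mathring L,\mathring d)$ be a smooth solution of the CEFEs on $\mathcal U$ which is of Petrov type D with tetrad aligned to the principal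 null directions: at every point of $\mathcal U$, $\mathring d\neq0$ and both $\mathring\ell$ and $\mathring k$ are repeated principal null directions of $\mathring d$ (a null vector $v$ is one if $v^bv^c\,\mathring d_{abc[d}v_{f]}=0$). Then every smooth solution of the linearised CEFEs on $\mathcal U$ satisfies on $\mathcal U$ the CEFE-Teukolsky equations $$\big[(\mathring D-3\mathring\epsilon+\mathring\epsilon^*-4\mathring\rho-\mathring\rho^*)(\mathring\Delta-4\mathring\gamma+\mathring\mu)-(\mathring\delta+\mathring\pi^*-\mathring\alpha^*-3\mathring\beta-4\mathring\tau)(\mathring\delta^*+\mathring\pi-4\mathring\alpha)-3\mathring\Xi\mathring\phi_2\big]\check\phi_0=0,$$ $$\big[(\mathring\Delta+3\mathring\gamma-\mathring\gamma^*+4\mathring\mu+\mathring\mu^*)(\mathring D+4\mathring\epsilon-\mathring\rho)-(\mathring\delta^*-\mathring\tau^*+\mathring\beta^*+3\mathring\alpha+4\mathring\pi)(\mathring\delta-\mathring\tau+4\mathring\beta)-3\mathring\Xi\mathring\phi_2\big]\check\phi_4=0,$$ in which neither the perturbation $\check\Xi$ of the conformal factor nor any other perturbed field appears. Moreover, wherever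 $\mathring\Xi\ne0$, $$\mathring\phi_2=\mathring\Xi^{-1}\mathring\Psi_2,\qquad \check\phi_0=\mathring\Xi^{-1}\check\Psi_0,\qquad \check\phi_4=\mathring\Xi^{-1}\check\Psi_4 .$$ Finally, on any open subset of $\mathcal U$ where $\mathring\Xi>0$, let $\tilde g=\Xi^{-2}g$ be the physical metric and let $(\tilde\ell,\tilde k,\tilde m,\tilde m^*)$ be a smooth $\tilde g$-null tetrad with $$\ell=\Xi^{-2-2\omega}b\,\tilde\ell,\qquad k=\Xi^{2\omega}b^{-1}\tilde k,\qquad m=\Xi^{-1}e^{i\vartheta}\tilde m$$ for the background and, to first order, for the perturbation, where $\omega\in\mathbb R$ is constant and $b\neq0$, $\vartheta$ are smooth real functions (which may themselves be perturbed; below they denote their background values). Let $\tilde\Psi_n$ be the components of the Weyl tensor of $\tilde g$ in this tetrad. Then $$\mathring\phi_2=\mathring\Xi^{-3}\mathring{\tilde\Psi}_2,\qquad \check\phi_0=\mathring\Xi^{-5-4\omega}b^{2}e^{2i\vartheta}\check{\tilde\Psi}_0,\qquad \check\phi_4=\mathring\Xi^{-1+4\omega}b^{-2}e^{-2i\vartheta}\check{\tilde\Psi}_4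 .$$ -/

import Mathlib

open scoped Manifold ContDiff ComplexConjugate

noncomputable section

namespace CEFE

/-- The model vector space of a four-dimensional manifold. -/
abbrev E4 : Type := EuclideanSpace ℝ (Fin 4)

/-- The constant components `g(e_a, e_b)` of the metric in a real null frame
`e = (ℓ, k, X, Y)` with `m = (X + i Y) / √2`, signature `(-,+,+,+)`:
`g(ℓ,k) = -1`, `g(X,X) = g(Y,Y) = 1` (so `g(m,m*) = 1`), all others `0`.
This matrix is its own inverse, so it also raises indices. -/
def eta : Fin 4 → Fin 4 → ℝ :=
  ![![0, -1, 0, 0], ![-1, 0, 0, 0], ![0, 0, 1, 0], ![0, 0, 0, 1]]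

section Data

variable {H : Type*} [TopologicalSpace H] (I : ModelWithCorners ℝ E4 H)
  (M : Type*) [TopologicalSpace M] [ChartedSpace H M]

/-- A metric, a real frame `e = (ℓ, k, X, Y)` (that is, the null tetrad `ℓ, k, m, m*` with
`m = (X + i Y) / √2`) and connection coefficients `Γ a b c = g(∇_{e_a} e_b, e_c)`. -/
structure TetradData where
  g : ∀ x : M, LinearMap.BilinForm ℝ (TangentSpace I x)
  e : Fin 4 → ∀ x : M, TangentSpace I x
  Γ : Fin 4 → Fin 4 → Fin 4 → M → ℝ

/-- The unknowns of the conformal Einstein field equations in frame form: metric, frame and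
connection coefficients, the conformal factor `Ξ`, the Friedrich scalar `s`, and the frame
components `L_{ab}` of the Schouten tensor and `d_{abcd}` of the rescaled Weyl tensor. -/
structure ConformalData extends TetradData I M where
  Ξ : M → ℝ
  s : M → ℝ
  L : Fin 4 → Fin 4 → M → ℝ
  d : Fin 4 → Fin 4 → Fin 4 → Fin 4 → M → ℝ

end Data

variable {H : Type*} [TopologicalSpace H] {I : ModelWithCorners ℝ E4 H}
  {M : Type*} [TopologicalSpace M] [ChartedSpace H M]

/-- The straight line `u + t v` of tetrad data. -/
def TetradData.line (u v : TetradData I M) (t : ℝ) : TetradData I M where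
  g x := u.g x + t • v.g x
  e a x := u.e a x + t • v.e a x
  Γ a b c x := u.Γ a b c x + t * v.Γ a b c x

/-- The straight line `u + t v`: background `u`, perturbation `v`. -/
def ConformalData.line (u v : ConformalData I M) (t : ℝ) : ConformalData I M where
  toTetradData := u.toTetradData.line v.toTetradData t
  Ξ x := u.Ξ x + t * v.Ξ x
  s x := u.s x + t * v.s x
  L a b x := u.L a b x + t * v.L a b x
  d a b c f x := u.d a b c f x + t * v.d a b c f x

/-- The derivative `X(f)` of a function along a vector field. -/
def dir {F : Type*} [NormedAddCommGroup F] [NormedSpace ℝ F]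
    (X : ∀ x : M, TangentSpace I x) (f : M → F) (x : M) : F :=
  mfderiv I 𝓘(ℝ, F) f x (X x)

/-- Smoothness of a vector field on a set. -/
def SmoothVectorFieldOn [IsManifold I ∞ M] (U : Set M) (X : ∀ x : M, TangentSpace I x) : Prop :=
  ContMDiffOn I I.tangent ∞ (fun x => (⟨x, X x⟩ : TangentBundle I M)) U

/-! ### Connection and curvature in the frame -/

namespace TetradData

variable (u : TetradData I M)

/-- `Γ_a{}^c{}_b`, the `e_c`-component of `∇_{e_a} e_b`. -/
def Γup (a b c : Fin 4) (x : M) : ℝ := ∑ f, u.Γ a b f x * eta f c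

/-- The defect of the normalisation `g(e_a, e_b) = η_{ab}`. -/
def normDefect (a b : Fin 4) (x : M) : ℝ := u.g x (u.e a x) (u.e b x) - eta a b

/-- The defect of metric compatibility. -/
def metricDefect (a b c : Fin 4) (x : M) : ℝ := u.Γ a b c x + u.Γ a c b x

/-- The torsion, up to sign: `[e_a, e_b] - (∇_{e_a} e_b - ∇_{e_b} e_a)`. -/
def torsionDefect (a b : Fin 4) (x : M) : TangentSpace I x :=
  VectorField.mlieBracket I (u.e a) (u.e b) x - ∑ c, (u.Γup a b c x - u.Γup b a c x) • u.e c x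

/-- `R_{abcd} = g(e_a, R(e_c, e_d) e_b)` with
`R(X,Y)Z = ∇_X ∇_Y Z - ∇_Y ∇_X Z - ∇_{[X,Y]} Z`. -/
def riemann (a b c d : Fin 4) (x : M) : ℝ :=
  dir (u.e c) (u.Γ d b a) x - dir (u.e d) (u.Γ c b a) x
    + ∑ f, (u.Γup d b f x * u.Γ c f a x - u.Γup c b f x * u.Γ d f a x)
    - ∑ f, (u.Γup c d f x - u.Γup d c f x) * u.Γ f b a x

/-- `R_{bd} = R^a{}_{bad}`. -/
def ricci (b d : Fin 4) (x : M) : ℝ := ∑ a, ∑ c, eta a c * u.riemann a b c d x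

def scalar (x : M) : ℝ := ∑ b, ∑ d, eta b d * u.ricci b d x

/-- The Schouten tensor `R_{ab} / 2 - R g_{ab} / 12`. -/
def schouten (a b : Fin 4) (x : M) : ℝ := u.ricci a b x / 2 - u.scalar x * eta a b / 12

/-- The Weyl tensor `C_{abcd}`. -/
def weyl (a b c d : Fin 4) (x : M) : ℝ :=
  u.riemann a b c d x
    - (eta a c * u.schouten b d x - eta a d * u.schouten b c x
      + eta b d * u.schouten a c x - eta b c * u.schouten a d x)

/-- `∇_a T_{bc}`. -/
def cov2 (T : Fin 4 → Fin 4 → M → ℝ) (a b c : Fin 4) (x : M) : ℝ :=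
  dir (u.e a) (T b c) x - ∑ f, (u.Γup a b f x * T f c x + u.Γup a c f x * T b f x)

/-- `∇_a T_{bcdh}`. -/
def cov4 (T : Fin 4 → Fin 4 → Fin 4 → Fin 4 → M → ℝ) (a b c d h : Fin 4) (x : M) : ℝ :=
  dir (u.e a) (T b c d h) x
    - ∑ f, (u.Γup a b f x * T f c d h x + u.Γup a c f x * T b f d h x
        + u.Γup a d f x * T b c f h x + u.Γup a h f x * T b c d f x)

/-- `∇_a ∇_b f`. -/
def hess (f : M → ℝ) (a b : Fin 4) (x : M) : ℝ :=
  dir (u.e a) (dir (u.e b) f) x - ∑ c, u.Γup a b c x * dir (u.e c) f x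

end TetradData

/-- On `U`: `e` is a smooth null tetrad for the metric `g` and `Γ` are the coefficients of the
Levi-Civita connection. (Smoothness, symmetry and Lorentzian signature of `g` follow.) -/
structure IsLeviCivitaOn [IsManifold I ∞ M] (U : Set M) (u : TetradData I M) : Prop where
  smooth_e : ∀ a, SmoothVectorFieldOn U (u.e a)
  smooth_Γ : ∀ a b c, ContMDiffOn I 𝓘(ℝ, ℝ) ∞ (u.Γ a b c) U
  norm : ∀ x ∈ U, ∀ a b, u.normDefect a b x = 0
  metric : ∀ x ∈ U, ∀ a b c, u.metricDefect a b c x = 0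
  torsion : ∀ x ∈ U, ∀ a b, u.torsionDefect a b x = 0

/-- The linearisation of `IsLeviCivitaOn` at `u`, for the perturbation `v`. -/
structure IsLinearisedLeviCivitaOn [IsManifold I ∞ M] (U : Set M) (u v : TetradData I M) : Prop where
  smooth_e : ∀ a, SmoothVectorFieldOn U (v.e a)
  smooth_Γ : ∀ a b c, ContMDiffOn I 𝓘(ℝ, ℝ) ∞ (v.Γ a b c) U
  norm : ∀ x ∈ U, ∀ a b, HasDerivAt (fun t : ℝ => (u.line v t).normDefect a b x) 0 0
  metric : ∀ x ∈ U, ∀ a b c, HasDerivAt (fun t : ℝ => (u.line v t).metricDefect a b c x) 0 0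
  torsion : ∀ x ∈ U, ∀ a b, HasDerivAt (fun t : ℝ => (u.line v t).torsionDefect a b x) 0 0

/-! ### The conformal Einstein field equations -/

/-- The algebraic symmetries of a Weyl tensor (frame components at a point). -/
structure WeylSymmetries (T : Fin 4 → Fin 4 → Fin 4 → Fin 4 → ℝ) : Prop where
  antisymm_left : ∀ a b c d, T a b c d = -T b a c d
  antisymm_right : ∀ a b c d, T a b c d = -T a b d c
  pair_symm : ∀ a b c d, T a b c d = T c d a b
  cyclic : ∀ a b c d, T a b c d + T a c d b + T a d b c = 0
  trace_free : ∀ b d, ∑ a, ∑ c, eta a c * T a b c d = 0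

namespace ConformalData

variable (u : ConformalData I M)

/-- `∇_a ∇_b Ξ + Ξ L_{ab} - s g_{ab}`. -/
def zeroXi (a b : Fin 4) (x : M) : ℝ :=
  u.hess u.Ξ a b x + u.Ξ x * u.L a b x - u.s x * eta a b

/-- `∇_a s + L_{ac} ∇^c Ξ`. -/
def zeroS (a : Fin 4) (x : M) : ℝ :=
  dir (u.e a) u.s x + ∑ c, ∑ f, u.L a c x * eta c f * dir (u.e f) u.Ξ x

/-- `∇_a L_{bc} - ∇_b L_{ac} - d^f{}_{cab} ∇_f Ξ`. -/
def zeroL (a b c : Fin 4) (x : M) : ℝ :=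
  u.cov2 u.L a b c x - u.cov2 u.L b a c x
    - ∑ f, ∑ h, eta f h * u.d h c a b x * dir (u.e f) u.Ξ x

/-- `∇_f d^f{}_{abc}`. -/
def zeroD (a b c : Fin 4) (x : M) : ℝ :=
  ∑ f, ∑ h, eta f h * u.cov4 u.d f h a b c x

/-- `L_{ab}` minus the Schouten tensor of the metric. -/
def zeroSchouten (a b : Fin 4) (x : M) : ℝ := u.L a b x - u.schouten a b x

/-- `Ξ d_{abcd}` minus the Weyl tensor of the metric. -/
def zeroWeyl (a b c f : Fin 4) (x : M) : ℝ := u.Ξ x * u.d a b c f x - u.weyl a b c f x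

end ConformalData

/-- `u` is a smooth solution of the conformal Einstein field equations on `U`. -/
structure IsSolutionOn [IsManifold I ∞ M] (U : Set M) (u : ConformalData I M) : Prop where
  leviCivita : IsLeviCivitaOn U u.toTetradData
  smooth_Ξ : ContMDiffOn I 𝓘(ℝ, ℝ) ∞ u.Ξ U
  smooth_s : ContMDiffOn I 𝓘(ℝ, ℝ) ∞ u.s U
  smooth_L : ∀ a b, ContMDiffOn I 𝓘(ℝ, ℝ) ∞ (u.L a b) U
  smooth_d : ∀ a b c f, ContMDiffOn I 𝓘(ℝ, ℝ) ∞ (u.d a b c f) U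
  weylSymm : ∀ x ∈ U, WeylSymmetries (fun a b c f => u.d a b c f x)
  eqXi : ∀ x ∈ U, ∀ a b, u.zeroXi a b x = 0
  eqS : ∀ x ∈ U, ∀ a, u.zeroS a x = 0
  eqL : ∀ x ∈ U, ∀ a b c, u.zeroL a b c x = 0
  eqD : ∀ x ∈ U, ∀ a b c, u.zeroD a b c x = 0
  eqSchouten : ∀ x ∈ U, ∀ a b, u.zeroSchouten a b x = 0
  eqWeyl : ∀ x ∈ U, ∀ a b c f, u.zeroWeyl a b c f x = 0

/-- `v` is a smooth solution on `U` of the conformal Einstein field equations linearised at `u`: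
every equation holds for `u + t v` to first order in `t`. -/
structure IsLinearisedSolutionOn [IsManifold I ∞ M] (U : Set M) (u v : ConformalData I M) : Prop where
  leviCivita : IsLinearisedLeviCivitaOn U u.toTetradData v.toTetradData
  smooth_Ξ : ContMDiffOn I 𝓘(ℝ, ℝ) ∞ v.Ξ U
  smooth_s : ContMDiffOn I 𝓘(ℝ, ℝ) ∞ v.s U
  smooth_L : ∀ a b, ContMDiffOn I 𝓘(ℝ, ℝ) ∞ (v.L a b) U
  smooth_d : ∀ a b c f, ContMDiffOn I 𝓘(ℝ, ℝ) ∞ (v.d a b c f) U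
  weylSymm : ∀ x ∈ U, WeylSymmetries (fun a b c f => v.d a b c f x)
  eqXi : ∀ x ∈ U, ∀ a b, HasDerivAt (fun t : ℝ => (u.line v t).zeroXi a b x) 0 0
  eqS : ∀ x ∈ U, ∀ a, HasDerivAt (fun t : ℝ => (u.line v t).zeroS a x) 0 0
  eqL : ∀ x ∈ U, ∀ a b c, HasDerivAt (fun t : ℝ => (u.line v t).zeroL a b c x) 0 0
  eqD : ∀ x ∈ U, ∀ a b c, HasDerivAt (fun t : ℝ => (u.line v t).zeroD a b c x) 0 0
  eqSchouten : ∀ x ∈ U, ∀ a b, HasDerivAt (fun t : ℝ => (u.line v t).zeroSchouten a b x) 0 0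
  eqWeyl : ∀ x ∈ U, ∀ a b c f, HasDerivAt (fun t : ℝ => (u.line v t).zeroWeyl a b c f x) 0 0

/-! ### Petrov type D -/

/-- The null vector with frame components `v^a` is a repeated principal null direction of the
Weyl-like tensor `T`: `v^b v^c T_{abc[d} v_{f]} = 0`. -/
def IsRepeatedPND (T : Fin 4 → Fin 4 → Fin 4 → Fin 4 → ℝ) (v : Fin 4 → ℝ) : Prop :=
  ∀ a d f, ∑ b, ∑ c, v b * v c *
    (T a b c d * (∑ h, eta f h * v h) - T a b c f * (∑ h, eta d h * v h)) = 0

/-- The rescaled Weyl tensor is of Petrov type D on `U` and the tetrad is aligned with its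
principal null directions: `d ≠ 0`, and `ℓ` and `k` are repeated principal null directions. -/
def IsAlignedTypeDOn (U : Set M) (u : ConformalData I M) : Prop :=
  ∀ x ∈ U, (∃ a b c f, u.d a b c f x ≠ 0) ∧
    IsRepeatedPND (fun a b c f => u.d a b c f x) ![1, 0, 0, 0] ∧
    IsRepeatedPND (fun a b c f => u.d a b c f x) ![0, 1, 0, 0]

/-! ### Newman-Penrose quantities -/

/-- Components of `ℓ` in the real frame `(ℓ, k, X, Y)`. -/
def vl : Fin 4 → ℂ := ![1, 0, 0, 0]

/-- Components of `k`. -/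
def vk : Fin 4 → ℂ := ![0, 1, 0, 0]

/-- Components of `m = (X + i Y) / √2`. -/
def vm : Fin 4 → ℂ := ![0, 0, 1 / (Real.sqrt 2 : ℂ), Complex.I / (Real.sqrt 2 : ℂ)]

/-- Components of `m*`. -/
def vmb : Fin 4 → ℂ := ![0, 0, 1 / (Real.sqrt 2 : ℂ), -Complex.I / (Real.sqrt 2 : ℂ)]

/-- `T_{abcd} p^a q^b r^c w^d`. -/
def contract4 (T : Fin 4 → Fin 4 → Fin 4 → Fin 4 → M → ℝ) (p q r w : Fin 4 → ℂ) (x : M) : ℂ :=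
  ∑ a, ∑ b, ∑ c, ∑ f, (T a b c f x : ℂ) * p a * q b * r c * w f

/-- The component `T(ℓ, m, ℓ, m)`. -/
def np0 (T : Fin 4 → Fin 4 → Fin 4 → Fin 4 → M → ℝ) : M → ℂ := contract4 T vl vm vl vm

/-- The component `T(ℓ, m, m*, k)`. -/
def np2 (T : Fin 4 → Fin 4 → Fin 4 → Fin 4 → M → ℝ) : M → ℂ := contract4 T vl vm vmb vk

/-- The component `T(k, m*, k, m*)`. -/
def np4 (T : Fin 4 → Fin 4 → Fin 4 → Fin 4 → M → ℝ) : M → ℂ := contract4 T vk vmb vk vmb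

namespace TetradData

variable (u : TetradData I M)

/-- The derivative of a complex function along the complex vector with constant frame
components `p`. -/
def along (p : Fin 4 → ℂ) (f : M → ℂ) (x : M) : ℂ := ∑ a, p a * dir (u.e a) f x

/-- `D = ℓ^a ∇_a`. -/
def npD (f : M → ℂ) : M → ℂ := u.along vl f

/-- `Δ = k^a ∇_a`. -/
def npΔ (f : M → ℂ) : M → ℂ := u.along vk f

/-- `δ = m^a ∇_a`. -/
def npδ (f : M → ℂ) : M → ℂ := u.along vm f

/-- `δ* = m*^a ∇_a`. -/
def npδb (f : M → ℂ) : M → ℂ := u.along vmb f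

/-- `g(∇_p q, r)` for complex vectors with constant frame components. -/
def conn (p q r : Fin 4 → ℂ) (x : M) : ℂ :=
  ∑ a, ∑ b, ∑ c, (u.Γ a b c x : ℂ) * p a * q b * r c

/-! The spin coefficients (signature `(-,+,+,+)`); for instance
`κ = -m^a ℓ^b ∇_b ℓ_a` and `ρ = -m^a m*^b ∇_b ℓ_a`. -/

def κ (x : M) : ℂ := -u.conn vl vl vm x
def τ (x : M) : ℂ := -u.conn vk vl vm x
def σ (x : M) : ℂ := -u.conn vm vl vm x
def ρ (x : M) : ℂ := -u.conn vmb vl vm x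
def ε (x : M) : ℂ := -(u.conn vl vl vk x - u.conn vl vm vmb x) / 2
def γ (x : M) : ℂ := -(u.conn vk vl vk x - u.conn vk vm vmb x) / 2
def β (x : M) : ℂ := -(u.conn vm vl vk x - u.conn vm vm vmb x) / 2
def α (x : M) : ℂ := -(u.conn vmb vl vk x - u.conn vmb vm vmb x) / 2
def π (x : M) : ℂ := u.conn vl vk vmb x
def ν (x : M) : ℂ := u.conn vk vk vmb x
def μ (x : M) : ℂ := u.conn vm vk vmb x
def lam (x : M) : ℂ := u.conn vmb vk vmb x

end TetradData

/-- The Weyl scalars of the metric in the tetrad. -/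
def TetradData.Ψ0 (u : TetradData I M) : M → ℂ := np0 u.weyl
def TetradData.Ψ2 (u : TetradData I M) : M → ℂ := np2 u.weyl
def TetradData.Ψ4 (u : TetradData I M) : M → ℂ := np4 u.weyl

/-- The components of the rescaled Weyl tensor in the tetrad. -/
def ConformalData.φ0 (u : ConformalData I M) : M → ℂ := np0 u.d
def ConformalData.φ2 (u : ConformalData I M) : M → ℂ := np2 u.d
def ConformalData.φ4 (u : ConformalData I M) : M → ℂ := np4 u.d

/-- First-order perturbation of the quantity `Q` at the point `x`. -/
def pert {A : Type*} (line : ℝ → A) (Q : A → M → ℂ) (x : M) : ℂ :=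
  deriv (fun t : ℝ => Q (line t) x) 0

/-! ### The two second-order operators -/

/-- `[(D - 3ε + ε* - 4ρ - ρ*)(Δ - 4γ + μ) - (δ + π* - α* - 3β - 4τ)(δ* + π - 4α) - 3 Ξ φ₂] f`. -/
def teukolsky0 (u : ConformalData I M) (f : M → ℂ) (x : M) : ℂ :=
  let A : M → ℂ := fun y => u.npΔ f y + (-4 * u.γ y + u.μ y) * f y
  let B : M → ℂ := fun y => u.npδb f y + (u.π y - 4 * u.α y) * f y
  (u.npD A x + (-3 * u.ε x + conj (u.ε x) - 4 * u.ρ x - conj (u.ρ x)) * A x)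
    - (u.npδ B x + (conj (u.π x) - conj (u.α x) - 3 * u.β x - 4 * u.τ x) * B x)
    - 3 * (u.Ξ x : ℂ) * u.φ2 x * f x

/-- `[(Δ + 3γ - γ* + 4μ + μ*)(D + 4ε - ρ) - (δ* - τ* + β* + 3α + 4π)(δ - τ + 4β) - 3 Ξ φ₂] f`. -/
def teukolsky4 (u : ConformalData I M) (f : M → ℂ) (x : M) : ℂ :=
  let A : M → ℂ := fun y => u.npD f y + (4 * u.ε y - u.ρ y) * f y
  let B : M → ℂ := fun y => u.npδ f y + (-u.τ y + 4 * u.β y) * f y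
  (u.npΔ A x + (3 * u.γ x - conj (u.γ x) + 4 * u.μ x + conj (u.μ x)) * A x)
    - (u.npδb B x + (-conj (u.τ x) + conj (u.β x) + 3 * u.α x + 4 * u.π x) * B x)
    - 3 * (u.Ξ x : ℂ) * u.φ2 x * f x

/-! ### The physical metric and tetrad -/

/-- `g - Ξ² g̃`, evaluated on `(X, Y)`. -/
def conformalDefect (u : ConformalData I M) (p : TetradData I M) (x : M)
    (X Y : TangentSpace I x) : ℝ :=
  u.g x X Y - u.Ξ x ^ 2 * p.g x X Y

/-- The defects of `ℓ = Ξ^{-2-2w} b ℓ̃`, `k = Ξ^{2w} b⁻¹ k̃`, `m = Ξ⁻¹ e^{iϑ} m̃`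
(the last one split into real and imaginary parts). -/
def alignDefect (w : ℝ) (b θ : M → ℝ) (u : ConformalData I M) (p : TetradData I M)
    (a : Fin 4) (x : M) : TangentSpace I x :=
  ![u.e 0 x - (u.Ξ x ^ (-2 - 2 * w) * b x) • p.e 0 x,
    u.e 1 x - (u.Ξ x ^ (2 * w) * (b x)⁻¹) • p.e 1 x,
    u.e 2 x - (u.Ξ x)⁻¹ • (Real.cos (θ x) • p.e 2 x - Real.sin (θ x) • p.e 3 x),
    u.e 3 x - (u.Ξ x)⁻¹ • (Real.sin (θ x) • p.e 2 x + Real.cos (θ x) • p.e 3 x)] a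

/-- On `V`, `p` consists of the physical metric `g̃ = Ξ⁻² g`, a physical null tetrad related to the
unphysical one by the conformal weight `w` and the spin-boost `(b, θ)`, and its Levi-Civita
connection coefficients. -/
structure IsPhysicalOn [IsManifold I ∞ M] (V : Set M) (w : ℝ) (b θ : M → ℝ)
    (u : ConformalData I M) (p : TetradData I M) : Prop where
  leviCivita : IsLeviCivitaOn V p
  smooth_b : ContMDiffOn I 𝓘(ℝ, ℝ) ∞ b V
  smooth_θ : ContMDiffOn I 𝓘(ℝ, ℝ) ∞ θ V
  b_ne : ∀ x ∈ V, b x ≠ 0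
  conformal : ∀ x ∈ V, ∀ X Y, conformalDefect u p x X Y = 0
  align : ∀ x ∈ V, ∀ a, alignDefect w b θ u p a x = 0

/-- The linearisation of `IsPhysicalOn`: `v`, `q`, `b'`, `θ'` are the perturbations of
`u`, `p`, `b`, `θ`. -/
structure IsLinearisedPhysicalOn [IsManifold I ∞ M] (V : Set M) (w : ℝ) (b θ b' θ' : M → ℝ)
    (u v : ConformalData I M) (p q : TetradData I M) : Prop where
  leviCivita : IsLinearisedLeviCivitaOn V p q
  smooth_b : ContMDiffOn I 𝓘(ℝ, ℝ) ∞ b' V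
  smooth_θ : ContMDiffOn I 𝓘(ℝ, ℝ) ∞ θ' V
  conformal : ∀ x ∈ V, ∀ X Y,
    HasDerivAt (fun t : ℝ => conformalDefect (u.line v t) (p.line q t) x X Y) 0 0
  align : ∀ x ∈ V, ∀ a,
    HasDerivAt (fun t : ℝ => alignDefect w (fun y => b y + t * b' y) (fun y => θ y + t * θ' y)
      (u.line v t) (p.line q t) a x) 0 0

end CEFE

end

/-! Write `u` for the background and `v` for the perturbation, marked by a prime below. The
mechanism is Teukolsky's decoupling, run on the rescaled Weyl tensor d instead of the Weyl tensor.
Since d is divergence-free even where Ξ = 0, type D (φ₀ = φ₁ = φ₃ = φ₄ = 0, φ₂ ≠ 0) gives κ = σ = 0,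
Dφ₂ = 3ρφ₂ and δφ₂ = 3τφ₂ on all of U (`IsSolutionOn.bianchi_typeD`).

Two of the linearised Bianchi equations then contain only φ₀', φ₁', κ'φ₂ and σ'φ₂, because every
other perturbation multiplies a vanishing background quantity
(`IsLinearisedSolutionOn.bianchi_typeD`). Applying first-order operators built on D and δ and
subtracting eliminates φ₁': what remains is the commutator [D, δ], together with the background
values of Dβ − δε (a Ricci equation) and of Dτ − δρ (the integrability condition of the two
equations for φ₂). The combination Dσ' − δκ' is governed by the linearised Ricci equation, whose
source is Ψ₀' = Ξφ₀' + Ξ'φ₀ = Ξφ₀'. This yields the potential −3Ξφ₂, and it is the reason why Ξ'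
does not enter. The outcome is `IsLinearisedSolutionOn.decoupled`. The exchange of ℓ with k and m
with m*, encoded by `primeIdx`, gives the second equation, so the argument is carried out for an
index map `P` that is either the identity or `primeIdx`.

For the physical scalars, the unphysical null frame is the physical one with each vector multiplied
by a factor f_A. The structure functions of the frame fix the connection (`IsFrameScaling.G_eq`),
hence the curvature (`IsFrameScaling.riemC_scaled`), and the Weyl part is invariant up to weights;
this settles Ψ₂. For the perturbed extreme scalars no linearised conformal transformation of the
whole curvature is needed: where κ = σ = 0 they are first-order expressions in κ' and σ', and these
two are structure functions that transform homogeneously (`IsLinearisedFrameScaling.pert_weylC`). -/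

noncomputable section

namespace CEFE

open Set Filter Topology VectorField

variable {H : Type*} [TopologicalSpace H] {I : ModelWithCorners ℝ E4 H}
  {M : Type*} [TopologicalSpace M] [ChartedSpace H M]

/-! ### Derivatives along vector fields and the Lie bracket on manifolds with boundary -/

section Derivatives

variable {F : Type*} [NormedAddCommGroup F] [NormedSpace ℝ F]

/-- `X(f)` read in the preferred chart at the base point. -/
theorem dir_eq_fderivWithin {f : M → F} {x : M} (hf : MDifferentiableAt I 𝓘(ℝ, F) f x)
    (X : ∀ x : M, TangentSpace I x) :
    dir X f x = fderivWithin ℝ (f ∘ (extChartAt I x).symm) (range I) (extChartAt I x x) (X x) := by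
  unfold dir
  rw [hf.mfderiv]
  rfl

/-- Chain rule: the pulled-back field is the inverse of the differential of the inverse chart
applied to X, and the chain rule applies that differential again. It transports iterated derivatives
to the model space. -/
theorem fderivWithin_comp_extChartAt_symm [IsManifold I ∞ M] {f : M → F} {x : M} {z : E4}
    (hz : z ∈ (extChartAt I x).target)
    (hf : MDifferentiableAt I 𝓘(ℝ, F) f ((extChartAt I x).symm z))
    (X : ∀ x : M, TangentSpace I x) :
    fderivWithin ℝ (f ∘ (extChartAt I x).symm) (range I) z
      (mpullbackWithin 𝓘(ℝ, E4) I (extChartAt I x).symm X (range I) z) =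
      dir X f ((extChartAt I x).symm z) := by
  have hzr : z ∈ range I := extChartAt_target_subset_range x hz
  have h1 : MDifferentiableWithinAt 𝓘(ℝ, E4) I (extChartAt I x).symm (range I) z :=
    mdifferentiableWithinAt_extChartAt_symm hz
  have h2 := mfderiv_comp_mfderivWithin z hf h1 (I.uniqueDiffOn.uniqueMDiffOn z hzr)
  have h3 := isInvertible_mfderivWithin_extChartAt_symm (I := I) hz
  rw [mfderivWithin_eq_fderivWithin] at h2
  rw [mpullbackWithin_apply]
  have h4 := congrArg (fun L => L ((mfderivWithin 𝓘(ℝ, E4) I (extChartAt I x).symm (range I) z).inverse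
    (X ((extChartAt I x).symm z)))) h2
  refine h4.trans ?_
  have h5 : (mfderivWithin 𝓘(ℝ, E4) I (extChartAt I x).symm (range I) z)
      ((mfderivWithin 𝓘(ℝ, E4) I (extChartAt I x).symm (range I) z).inverse
    (X ((extChartAt I x).symm z))) = X ((extChartAt I x).symm z) := by
    obtain ⟨e, he⟩ := h3
    rw [← he, ContinuousLinearMap.inverse_equiv]
    exact e.apply_symm_apply _
  exact congrArg (mfderiv I 𝓘(ℝ, F) f ((extChartAt I x).symm z)) h5

variable [IsManifold I ∞ M] {U : Set M} {x : M}

theorem SmoothVectorFieldOn.mono {V : Set M} {X : ∀ x : M, TangentSpace I x}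
    (h : SmoothVectorFieldOn U X) (hV : V ⊆ U) : SmoothVectorFieldOn V X :=
  ContMDiffOn.mono h hV

/-- X(f) is the fibre component of the tangent map of f evaluated on the section X, so smoothness
follows by composition. -/
theorem contMDiffOn_dir {X : ∀ x : M, TangentSpace I x} {f : M → F} (hU : IsOpen U)
    (hX : SmoothVectorFieldOn U X) (hf : ContMDiffOn I 𝓘(ℝ, F) ∞ f U) :
    ContMDiffOn I 𝓘(ℝ, F) ∞ (dir X f) U := by
  have h1 := hf.contMDiffOn_tangentMapWithin (m := ∞) (by simp) hU.uniqueMDiffOn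
  have h2 := h1.comp hX (fun y hy => hy)
  have h3 := (contMDiff_snd_tangentBundle_modelSpace F 𝓘(ℝ, F) (n := ∞)).comp_contMDiffOn h2
  refine h3.congr fun y hy => ?_
  simp only [Function.comp, tangentMapWithin, dir]
  rw [mfderivWithin_of_isOpen hU hy]

theorem mdifferentiableAt_of_contMDiffOn {f : M → F} (hU : IsOpen U)
    (hf : ContMDiffOn I 𝓘(ℝ, F) ∞ f U) (hx : x ∈ U) : MDifferentiableAt I 𝓘(ℝ, F) f x :=
  (hf.contMDiffAt (hU.mem_nhds hx)).mdifferentiableAt (by simp)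

/-- The Lie bracket acts on functions as the commutator. -/
theorem mfderiv_mlieBracket {X Y : ∀ x : M, TangentSpace I x} {f : M → F} (hU : IsOpen U)
    (hX : SmoothVectorFieldOn U X) (hY : SmoothVectorFieldOn U Y)
    (hf : ContMDiffOn I 𝓘(ℝ, F) ∞ f U) (hx : x ∈ U) :
    mfderiv I 𝓘(ℝ, F) f x (mlieBracket I X Y x) =
      dir X (dir Y f) x - dir Y (dir X f) x := by
  set φ := extChartAt I x with hφ
  set X' := mpullbackWithin 𝓘(ℝ, E4) I φ.symm X (range I) with hX'
  set Y' := mpullbackWithin 𝓘(ℝ, E4) I φ.symm Y (range I) with hY'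
  set z := φ x with hz
  have hfx := mdifferentiableAt_of_contMDiffOn hU hf hx
  have hzr : z ∈ range I := mem_range_self _
  have hsymm : φ.symm z = x := extChartAt_to_inv x
  have hev : ∀ᶠ y in 𝓝[range I] z, y ∈ φ.target ∧ φ.symm y ∈ U := by
    have a := extChartAt_target_mem_nhdsWithin (I := I) x
    have b := (continuousAt_extChartAt_symm (I := I) x).preimage_mem_nhds
      (t := U) (by rw [extChartAt_to_inv]; exact hU.mem_nhds hx)
    filter_upwards [a, nhdsWithin_le_nhds b] with y h1 h2 using ⟨h1, h2⟩
  have hdiff : ∀ Z : (∀ x : M, TangentSpace I x), SmoothVectorFieldOn U Z →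
      DifferentiableWithinAt ℝ (mpullbackWithin 𝓘(ℝ, E4) I φ.symm Z (range I)) (range I) z := by
    intro Z hZ
    have h1 : MDifferentiableWithinAt I I.tangent (fun y => (⟨y, Z y⟩ : TangentBundle I M)) univ x := by
      rw [mdifferentiableWithinAt_univ]
      exact (ContMDiffOn.contMDiffAt hZ (hU.mem_nhds hx)).mdifferentiableAt (by simp)
    have h2 := h1.differentiableWithinAt_mpullbackWithin_vectorField
    rw [preimage_univ, univ_inter] at h2
    exact h2
  have hg : ∀ Z W : (∀ x : M, TangentSpace I x), SmoothVectorFieldOn U Z →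
      dir W (dir Z f) x = fderivWithin ℝ (fun y => fderivWithin ℝ (f ∘ φ.symm) (range I) y
        (mpullbackWithin 𝓘(ℝ, E4) I φ.symm Z (range I) y)) (range I) z (W x) := by
    intro Z W hZ
    rw [dir_eq_fderivWithin (mdifferentiableAt_of_contMDiffOn hU (contMDiffOn_dir hU hZ hf) hx)]
    have : (fun y => fderivWithin ℝ (f ∘ φ.symm) (range I) y
        (mpullbackWithin 𝓘(ℝ, E4) I φ.symm Z (range I) y)) =ᶠ[𝓝[range I] z] dir Z f ∘ φ.symm := by
      filter_upwards [hev] with y hy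
      exact fderivWithin_comp_extChartAt_symm hy.1 (mdifferentiableAt_of_contMDiffOn hU hf hy.2) Z
    rw [this.fderivWithin_eq_of_mem hzr]
  -- The preferred chart at x has identity differential at x, so pulling back does not change the
  -- value at the base point.
  have hval : ∀ Z : (∀ x : M, TangentSpace I x),
      (mpullbackWithin 𝓘(ℝ, E4) I φ.symm Z (range I) z : E4) = Z x := by
    intro Z
    rw [mpullbackWithin_apply]
    have h := mfderivWithin_extChartAt_symm_inverse_apply (I := I) (Z x)
    rw [← hφ, ← hz] at h
    have h2 : (Z (φ.symm z) : E4) = Z x := by rw [hsymm]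
    exact (congrArg (fun w : E4 => ((mfderivWithin 𝓘(ℝ, E4) I φ.symm (range I) z).inverse w : E4)) h2).trans h
  have hcf : ContDiffWithinAt ℝ ∞ (f ∘ φ.symm) (range I) z := by
    have h := (contMDiffAt_iff.1 (hf.contMDiffAt (hU.mem_nhds hx))).2
    exact h
  -- The commutator formula in the model space rests on symmetry of the second derivative within
  -- `range I`. Unique differentiability and the fact that `range I` lies in the closure of its
  -- interior make it valid at boundary points too.
  have key := fderivWithin_apply_lieBracket (V := X') (W := Y') hcf (by simpa using! WithTop.coe_le_coe.2 (le_top : (2 : ℕ∞) ≤ ⊤)) I.uniqueDiffOn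
    (I.range_subset_closure_interior hzr) hzr (hdiff Y hY) (hdiff X hX)
  have e1 : mfderiv I 𝓘(ℝ, F) f x (mlieBracket I X Y x) =
      fderivWithin ℝ (f ∘ φ.symm) (range I) z (lieBracketWithin ℝ X' Y' (range I) z) := by
    have h := dir_eq_fderivWithin hfx (mlieBracket I X Y)
    refine h.trans ?_
    congr 1
    rw [← mlieBracketWithin_univ, mlieBracketWithin_apply, mfderiv_extChartAt_self, preimage_univ,
      univ_inter]
    exact congrArg (fun L : E4 →L[ℝ] E4 => L (lieBracketWithin ℝ X' Y' (range I) z))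
      (ContinuousLinearMap.inverse_id (R := ℝ) (M := E4))
  rw [e1, key, hg Y X hY, hg X Y hX]
  congr 2
  · exact hval X
  · exact hval Y

end Derivatives

/-! ### Calculus of derivatives along vector fields -/

/-- Smoothness of a complex function on a set. -/
abbrev SmoothOn (I : ModelWithCorners ℝ E4 H) (U : Set M) (f : M → ℂ) : Prop :=
  ContMDiffOn I 𝓘(ℝ, ℂ) ∞ f U

section Smooth

variable {U : Set M} {f g : M → ℂ}

theorem SmoothOn.add (hf : SmoothOn I U f) (hg : SmoothOn I U g) :
    SmoothOn I U (fun y => f y + g y) :=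
  contDiff_add.contMDiff.comp_contMDiffOn (hf.prodMk_space hg)

theorem SmoothOn.mul (hf : SmoothOn I U f) (hg : SmoothOn I U g) :
    SmoothOn I U (fun y => f y * g y) :=
  contDiff_mul.contMDiff.comp_contMDiffOn (hf.prodMk_space hg)

theorem SmoothOn.const (c : ℂ) : SmoothOn I U (fun _ => c) := contMDiffOn_const

theorem SmoothOn.const_mul (c : ℂ) (hf : SmoothOn I U f) : SmoothOn I U (fun y => c * f y) :=
  (SmoothOn.const c).mul hf

theorem SmoothOn.neg (hf : SmoothOn I U f) : SmoothOn I U (fun y => -f y) :=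
  contDiff_neg.contMDiff.comp_contMDiffOn hf

theorem SmoothOn.sub (hf : SmoothOn I U f) (hg : SmoothOn I U g) :
    SmoothOn I U (fun y => f y - g y) := by
  simpa only [sub_eq_add_neg] using hf.add hg.neg

theorem SmoothOn.sum {ι : Type*} (s : Finset ι) {f : ι → M → ℂ} (hf : ∀ i ∈ s, SmoothOn I U (f i)) :
    SmoothOn I U (fun y => ∑ i ∈ s, f i y) := by
  classical
  induction s using Finset.induction_on with
  | empty => simpa using SmoothOn.const 0
  | insert i s hi ih =>
    simp only [Finset.sum_insert hi]
    exact (hf i (by simp)).add (ih fun j hj => hf j (by simp [hj]))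

theorem SmoothOn.ofReal {f : M → ℝ} (hf : ContMDiffOn I 𝓘(ℝ, ℝ) ∞ f U) :
    SmoothOn I U (fun y => (f y : ℂ)) :=
  Complex.ofRealCLM.contDiff.contMDiff.comp_contMDiffOn hf

end Smooth

section Dir

variable {X Y : ∀ x : M, TangentSpace I x} {x : M} {f g : M → ℂ}

theorem dir_add (hf : MDifferentiableAt I 𝓘(ℝ, ℂ) f x) (hg : MDifferentiableAt I 𝓘(ℝ, ℂ) g x) :
    dir X (fun y => f y + g y) x = dir X f x + dir X g x := by
  have h := (hf.hasMFDerivAt.add hg.hasMFDerivAt).mfderiv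
  exact congrArg (fun L => L (X x)) h

theorem dir_mul (hf : MDifferentiableAt I 𝓘(ℝ, ℂ) f x) (hg : MDifferentiableAt I 𝓘(ℝ, ℂ) g x) :
    dir X (fun y => f y * g y) x = dir X f x * g x + f x * dir X g x := by
  have h := (hf.hasMFDerivAt.mul hg.hasMFDerivAt).mfderiv
  refine (congrArg (fun L => L (X x)) h).trans ?_
  change f x * dir X g x + g x * dir X f x = _
  ring

theorem dir_const (c : ℂ) : dir X (fun _ : M => c) x = 0 := by
  have h := (hasMFDerivAt_const (I := I) (I' := 𝓘(ℝ, ℂ)) c x).mfderiv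
  exact congrArg (fun L => L (X x)) h

theorem dir_comp {F G : Type*} [NormedAddCommGroup F] [NormedSpace ℝ F] [NormedAddCommGroup G]
    [NormedSpace ℝ G] {h : F → G} {h' : F →L[ℝ] G} {k : M → F} (hh : HasFDerivAt h h' (k x))
    (hk : MDifferentiableAt I 𝓘(ℝ, F) k x) :
    dir X (fun y => h (k y)) x = h' (dir X k x) := by
  have e := (hh.hasMFDerivAt.comp x hk.hasMFDerivAt).mfderiv
  exact congrArg (fun L => L (X x)) e

theorem dir_ofReal {f : M → ℝ} (hf : MDifferentiableAt I 𝓘(ℝ, ℝ) f x) :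
    dir X (fun y => (f y : ℂ)) x = ((dir X f x : ℝ) : ℂ) :=
  dir_comp Complex.ofRealCLM.hasFDerivAt hf

theorem dir_congr {F : Type*} [NormedAddCommGroup F] [NormedSpace ℝ F] {U : Set M} (hU : IsOpen U)
    (hx : x ∈ U) {f g : M → F} (h : ∀ y ∈ U, f y = g y) : dir X f x = dir X g x := by
  have : f =ᶠ[𝓝 x] g := by filter_upwards [hU.mem_nhds hx] with y hy using h y hy
  unfold dir
  rw [this.mfderiv_eq]
  rfl

theorem dir_add_smul {F : Type*} [NormedAddCommGroup F] [NormedSpace ℝ F] (t : ℝ) (f : M → F) :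
    dir (fun y => X y + t • Y y) f x = dir X f x + t • dir Y f x := by
  unfold dir
  rw [map_add, map_smul]
  rfl

end Dir

/-! ### The complex null frame -/

/-- The null frame `(ℓ, k, m, m*)` in terms of the real frame. -/
def nullFrame : Fin 4 → Fin 4 → ℂ := ![vl, vk, vm, vmb]

/-- Components of the metric in the null frame. -/
def etaC : Fin 4 → Fin 4 → ℂ := ![![0, -1, 0, 0], ![-1, 0, 0, 0], ![0, 0, 0, 1], ![0, 0, 1, 0]]

/-- Contraction of two covectors, given in the null frame. -/
def contr (X Y : Fin 4 → ℂ) : ℂ := -(X 0 * Y 1) - X 1 * Y 0 + X 2 * Y 3 + X 3 * Y 2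

theorem contr_eq_sum (X Y : Fin 4 → ℂ) : contr X Y = ∑ a, ∑ b, etaC a b * X a * Y b := by
  simp [contr, Fin.sum_univ_four, etaC]
  ring

theorem sqrtTwo_inv_sq : (1 / (Real.sqrt 2 : ℂ)) * (1 / (Real.sqrt 2 : ℂ)) = 1 / 2 := by
  rw [div_mul_div_comm, ← Complex.ofReal_mul, Real.mul_self_sqrt (by norm_num)]
  norm_num

theorem nullFrame_eq : nullFrame = ![![1, 0, 0, 0], ![0, 1, 0, 0],
    ![0, 0, 1 / (Real.sqrt 2 : ℂ), Complex.I * (1 / (Real.sqrt 2 : ℂ))],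
    ![0, 0, 1 / (Real.sqrt 2 : ℂ), -Complex.I * (1 / (Real.sqrt 2 : ℂ))]] := by
  simp only [nullFrame, vl, vk, vm, vmb]
  simp only [mul_one_div]

/-- Contractions may be computed in the null frame. -/
theorem sum_eta_eq_contr (X Y : Fin 4 → ℂ) :
    ∑ a, ∑ b, (eta a b : ℂ) * X a * Y b =
      contr (fun A => ∑ a, nullFrame A a * X a) (fun B => ∑ b, nullFrame B b * Y b) := by
  have hs := sqrtTwo_inv_sq
  have hI := Complex.I_mul_I
  rw [nullFrame_eq]
  -- Only s² = 1/2 and i² = −1 matter, so both constants become variables and the claim is a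
  -- combination of these two relations.
  generalize (1 / (Real.sqrt 2 : ℂ)) = s at *
  simp [contr, Fin.sum_univ_four, eta]
  generalize Complex.I = i at *
  linear_combination (2 * (i * i) * X 3 * Y 3 - 2 * X 2 * Y 2) * hs + (X 3 * Y 3) * hI

/-- The underlying frame is real, so conjugation only exchanges m and m*. This turns conjugated spin
coefficients back into connection coefficients. -/
theorem nullFrame_conj (A a : Fin 4) :
    conj (nullFrame A a) = nullFrame (![0, 1, 3, 2] A) a := by
  fin_cases A <;> fin_cases a <;> simp [nullFrame, vl, vk, vm, vmb]

namespace TetradData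

variable (u v : TetradData I M)

/-- Derivative along the null frame vector with index `A`. -/
def nd (A : Fin 4) (f : M → ℂ) (x : M) : ℂ := u.along (nullFrame A) f x

/-- Connection coefficients in the null frame. -/
def G (A B C : Fin 4) (x : M) : ℂ := u.conn (nullFrame A) (nullFrame B) (nullFrame C) x

/-- The antisymmetric part of the connection coefficients: structure functions of a null frame. -/
def S (A B C : Fin 4) (x : M) : ℂ := u.G A B C x - u.G B A C x

/-- Null frame components of the Riemann tensor. -/
def riemC (A B C D : Fin 4) (x : M) : ℂ :=
  contract4 u.riemann (nullFrame A) (nullFrame B) (nullFrame C) (nullFrame D) x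

variable {u v}

section Pointwise

variable {x : M} {f g : M → ℂ}

theorem nd_add (A : Fin 4) (hf : MDifferentiableAt I 𝓘(ℝ, ℂ) f x)
    (hg : MDifferentiableAt I 𝓘(ℝ, ℂ) g x) :
    u.nd A (fun y => f y + g y) x = u.nd A f x + u.nd A g x := by
  simp only [nd, along, dir_add hf hg, mul_add, Finset.sum_add_distrib]

theorem nd_mul (A : Fin 4) (hf : MDifferentiableAt I 𝓘(ℝ, ℂ) f x)
    (hg : MDifferentiableAt I 𝓘(ℝ, ℂ) g x) :
    u.nd A (fun y => f y * g y) x = u.nd A f x * g x + f x * u.nd A g x := by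
  simp only [nd, along, dir_mul hf hg, Finset.sum_mul, Finset.mul_sum, ← Finset.sum_add_distrib]
  exact Finset.sum_congr rfl fun a _ => by ring

theorem nd_const (A : Fin 4) (c : ℂ) : u.nd A (fun _ => c) x = 0 := by
  simp [nd, along, dir_const]

theorem nd_const_mul (A : Fin 4) (c : ℂ) (hf : MDifferentiableAt I 𝓘(ℝ, ℂ) f x) :
    u.nd A (fun y => c * f y) x = c * u.nd A f x := by
  rw [nd_mul A mdifferentiableAt_const hf, nd_const]
  ring

theorem nd_neg (A : Fin 4) (hf : MDifferentiableAt I 𝓘(ℝ, ℂ) f x) :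
    u.nd A (fun y => -f y) x = -u.nd A f x := by
  simpa using nd_const_mul (u := u) A (-1) hf

theorem nd_sub (A : Fin 4) (hf : MDifferentiableAt I 𝓘(ℝ, ℂ) f x)
    (hg : MDifferentiableAt I 𝓘(ℝ, ℂ) g x) :
    u.nd A (fun y => f y - g y) x = u.nd A f x - u.nd A g x := by
  have hg' : MDifferentiableAt I 𝓘(ℝ, ℂ) (fun y => (-1 : ℂ) * g y) x :=
    mdifferentiableAt_const.mul hg
  have h := nd_add (u := u) A hf hg'
  rw [nd_const_mul A _ hg] at h
  simpa only [neg_one_mul, ← sub_eq_add_neg] using h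

theorem nd_congr (A : Fin 4) {U : Set M} (hU : IsOpen U) (hx : x ∈ U) (h : ∀ y ∈ U, f y = g y) :
    u.nd A f x = u.nd A g x := by
  simp only [nd, along, dir_congr hU hx h]

theorem nd_zero_of_eqOn (A : Fin 4) {U : Set M} (hU : IsOpen U) (hx : x ∈ U)
    (h : ∀ y ∈ U, f y = 0) : u.nd A f x = 0 := by
  rw [nd_congr A hU hx h, nd_const]

theorem nd_sum (A : Fin 4) {ι : Type*} (s : Finset ι) {f : ι → M → ℂ}
    (hf : ∀ i ∈ s, MDifferentiableAt I 𝓘(ℝ, ℂ) (f i) x) :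
    u.nd A (fun y => ∑ i ∈ s, f i y) x = ∑ i ∈ s, u.nd A (f i) x := by
  classical
  induction s using Finset.induction_on with
  | empty => simpa using nd_const A 0
  | insert i s hi ih =>
    have h1 : ∀ j ∈ s, MDifferentiableAt I 𝓘(ℝ, ℂ) (f j) x := fun j hj => hf j (by simp [hj])
    have h2 : MDifferentiableAt I 𝓘(ℝ, ℂ) (fun y => ∑ i ∈ s, f i y) x := by
      clear ih hf hi
      induction s using Finset.induction_on with
      | empty => simpa using mdifferentiableAt_const
      | insert k s hk ih2 =>
        simp only [Finset.sum_insert hk]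
        exact (h1 k (by simp)).add (ih2 fun j hj => h1 j (by simp [hj]))
    simp only [Finset.sum_insert hi]
    rw [nd_add A (hf i (by simp)) h2, ih h1]

theorem nd_line (t : ℝ) (A : Fin 4) (f : M → ℂ) :
    (u.line v t).nd A f x = u.nd A f x + t * v.nd A f x := by
  simp only [nd, along, line, dir_add_smul, Finset.mul_sum, ← Finset.sum_add_distrib,
    Complex.real_smul]
  exact Finset.sum_congr rfl fun a _ => by ring

/-- Direction and function both move with t, so the value is exactly quadratic; the coefficient of t
collects the two ways of perturbing. -/
theorem nd_line_line (t : ℝ) (A : Fin 4) (hf : MDifferentiableAt I 𝓘(ℝ, ℂ) f x)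
    (hg : MDifferentiableAt I 𝓘(ℝ, ℂ) g x) :
    (u.line v t).nd A (fun y => f y + t * g y) x =
      u.nd A f x + t * (u.nd A g x + v.nd A f x) + t ^ 2 * v.nd A g x := by
  have hg' : MDifferentiableAt I 𝓘(ℝ, ℂ) (fun y => (t : ℂ) * g y) x :=
    mdifferentiableAt_const.mul hg
  rw [nd_line, nd_add A hf hg', nd_add A hf hg', nd_const_mul A _ hg, nd_const_mul A _ hg]
  ring

theorem G_line (t : ℝ) (A B C : Fin 4) :
    (u.line v t).G A B C x = u.G A B C x + t * v.G A B C x := by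
  simp only [G, conn, line, Finset.mul_sum, ← Finset.sum_add_distrib]
  refine Finset.sum_congr rfl fun a _ => Finset.sum_congr rfl fun b _ =>
    Finset.sum_congr rfl fun c _ => ?_
  push_cast
  ring

theorem G_antisymm (h : ∀ a b c, u.metricDefect a b c x = 0) (A B C : Fin 4) :
    u.G A B C x = -u.G A C B x := by
  simp only [G, conn, ← Finset.sum_neg_distrib]
  refine Finset.sum_congr rfl fun a _ => ?_
  rw [Finset.sum_comm]
  refine Finset.sum_congr rfl fun b _ => Finset.sum_congr rfl fun c _ => ?_
  have : u.Γ a c b x = -u.Γ a b c x := by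
    have := h a b c
    unfold metricDefect at this
    linarith
  rw [this]
  push_cast
  ring

theorem G_conj (A B C : Fin 4) :
    conj (u.G A B C x) = u.G (![0, 1, 3, 2] A) (![0, 1, 3, 2] B) (![0, 1, 3, 2] C) x := by
  simp only [G, conn, map_sum, map_mul, nullFrame_conj, Complex.conj_ofReal]

end Pointwise

/-- Derivatives of the null frame connection coefficients. -/
theorem nd_G {x : M} (hΓ : ∀ a b c, MDifferentiableAt I 𝓘(ℝ, ℝ) (v.Γ a b c) x) (A B C D : Fin 4) :
    u.nd A (v.G B C D) x = ∑ a, ∑ b, ∑ c, ∑ d, ((dir (u.e a) (v.Γ b c d) x : ℝ) : ℂ)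
      * nullFrame A a * nullFrame B b * nullFrame C c * nullFrame D d := by
  have h1 : ∀ b c d, MDifferentiableAt I 𝓘(ℝ, ℂ) (fun y => (v.Γ b c d y : ℂ)) x := fun b c d =>
    (Complex.ofRealCLM.differentiableAt).comp_mdifferentiableAt (hΓ b c d)
  have h2 : ∀ b c d, MDifferentiableAt I 𝓘(ℝ, ℂ) (fun y => nullFrame B b * nullFrame C c *
      nullFrame D d * (v.Γ b c d y : ℂ)) x := fun b c d => mdifferentiableAt_const.mul (h1 b c d)
  have h3 : v.G B C D = fun y => ∑ z : Fin 4 × Fin 4 × Fin 4, nullFrame B z.1 * nullFrame C z.2.1 *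
      nullFrame D z.2.2 * (v.Γ z.1 z.2.1 z.2.2 y : ℂ) := by
    funext y
    simp only [G, conn, Fintype.sum_prod_type]
    refine Finset.sum_congr rfl fun b _ => Finset.sum_congr rfl fun c _ =>
      Finset.sum_congr rfl fun d _ => ?_
    ring
  have h4 : ∀ z : Fin 4 × Fin 4 × Fin 4, u.nd A (fun y => nullFrame B z.1 * nullFrame C z.2.1 *
      nullFrame D z.2.2 * (v.Γ z.1 z.2.1 z.2.2 y : ℂ)) x =
      ∑ a, ((dir (u.e a) (v.Γ z.1 z.2.1 z.2.2) x : ℝ) : ℂ)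
        * nullFrame A a * nullFrame B z.1 * nullFrame C z.2.1 * nullFrame D z.2.2 := by
    intro z
    rw [nd_const_mul A _ (h1 _ _ _)]
    simp only [nd, along, dir_ofReal (hΓ _ _ _), Finset.mul_sum]
    exact Finset.sum_congr rfl fun a _ => by ring
  rw [h3, nd_sum A _ fun z _ => h2 z.1 z.2.1 z.2.2, Finset.sum_congr rfl fun z _ => h4 z,
    Finset.sum_comm]
  simp only [Fintype.sum_prod_type]

/-- Stated for arbitrary arrays, so that rearranging the quadratic curvature terms is a polynomial
identity checked once. -/
theorem sum_contraction_middle (p q r s : Fin 4 → ℂ) (X Y : Fin 4 → Fin 4 → Fin 4 → ℂ) :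
    ∑ a, ∑ b, ∑ c, ∑ d, (∑ f, X d b f * Y c f a) * p a * q b * r c * s d =
      ∑ f, (∑ d, ∑ b, X d b f * s d * q b) * (∑ c, ∑ a, Y c f a * r c * p a) := by
  simp only [Fin.sum_univ_four]
  ring

theorem sum_contraction_left (p q r s : Fin 4 → ℂ) (X Y : Fin 4 → Fin 4 → Fin 4 → ℂ) :
    ∑ a, ∑ b, ∑ c, ∑ d, (∑ f, X c d f * Y f b a) * p a * q b * r c * s d =
      ∑ f, (∑ c, ∑ d, X c d f * r c * s d) * (∑ b, ∑ a, Y f b a * q b * p a) := by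
  simp only [Fin.sum_univ_four]
  ring

theorem sum_perm (X : Fin 4 → Fin 4 → Fin 4 → Fin 4 → ℂ) (p q r s : Fin 4 → ℂ) :
    ∑ a, ∑ b, ∑ c, ∑ d, X c d b a * p a * q b * r c * s d =
      ∑ c, ∑ d, ∑ b, ∑ a, X c d b a * r c * s d * q b * p a := by
  simp only [Fin.sum_univ_four]
  ring

/-- The Riemann tensor in terms of null frame connection coefficients. -/
theorem riemC_eq {x : M} (hΓ : ∀ a b c, MDifferentiableAt I 𝓘(ℝ, ℝ) (u.Γ a b c) x)
    (A B C D : Fin 4) :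
    u.riemC A B C D x = u.nd C (u.G D B A) x - u.nd D (u.G C B A) x
      + contr (fun F => u.G D B F x) (fun F => u.G C F A x)
      - contr (fun F => u.G C B F x) (fun F => u.G D F A x)
      - contr (fun F => u.S C D F x) (fun F => u.G F B A x) := by
  have hG : ∀ X Y Z, u.G X Y Z x = ∑ z, nullFrame Z z *
      ∑ a, ∑ b, (u.Γ a b z x : ℂ) * nullFrame X a * nullFrame Y b := by
    intro X Y Z
    simp only [G, conn, Finset.mul_sum]
    rw [Finset.sum_congr rfl fun a _ => Finset.sum_comm, Finset.sum_comm]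
    exact Finset.sum_congr rfl fun a _ => Finset.sum_congr rfl fun b _ =>
      Finset.sum_congr rfl fun c _ => by ring
  have hG2 : ∀ X Y Z, u.G X Y Z x = ∑ y, nullFrame Y y *
      ∑ a, ∑ c, (u.Γ a y c x : ℂ) * nullFrame X a * nullFrame Z c := by
    intro X Y Z
    simp only [G, conn, Finset.mul_sum]
    rw [Finset.sum_comm]
    exact Finset.sum_congr rfl fun a _ => Finset.sum_congr rfl fun b _ =>
      Finset.sum_congr rfl fun c _ => by ring
  have hG3 : ∀ X Y Z, u.G X Y Z x = ∑ w, nullFrame X w *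
      ∑ b, ∑ c, (u.Γ w b c x : ℂ) * nullFrame Y b * nullFrame Z c := by
    intro X Y Z
    simp only [G, conn, Finset.mul_sum]
    exact Finset.sum_congr rfl fun a _ => Finset.sum_congr rfl fun b _ =>
      Finset.sum_congr rfl fun c _ => by ring
  have hS : ∀ Z, u.S C D Z x = ∑ z, nullFrame Z z *
      ∑ c, ∑ d, ((u.Γ c d z x - u.Γ d c z x : ℝ) : ℂ) * nullFrame C c * nullFrame D d := by
    intro Z
    rw [S, hG, hG, ← Finset.sum_sub_distrib]
    refine Finset.sum_congr rfl fun z _ => ?_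
    rw [← mul_sub, Finset.sum_comm (f := fun a b => (u.Γ a b z x : ℂ) * nullFrame D a *
      nullFrame C b)]
    simp only [← Finset.sum_sub_distrib]
    congr 1
    refine Finset.sum_congr rfl fun c _ => Finset.sum_congr rfl fun d _ => ?_
    push_cast
    ring
  -- All four slots are free so that one identity serves both quadratic products, the second with
  -- its last two slots exchanged.
  have middle : ∀ (q' p' r' s' : Fin 4), contr (fun F => u.G s' q' F x) (fun F => u.G r' F p' x) =
      ∑ a, ∑ b, ∑ c, ∑ d, ((∑ f, u.Γup d b f x * u.Γ c f a x : ℝ) : ℂ) * nullFrame p' a *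
        nullFrame q' b * nullFrame r' c * nullFrame s' d := by
    intro q' p' r' s'
    simp only [hG s' q', hG2 r' _ p']
    rw [← sum_eta_eq_contr, Finset.sum_comm]
    push_cast
    rw [sum_contraction_middle]
    refine Finset.sum_congr rfl fun f _ => ?_
    rw [← Finset.sum_mul]
    congr 1
    simp only [Γup, Complex.ofReal_sum, Complex.ofReal_mul, Finset.sum_mul, Finset.mul_sum]
    rw [Finset.sum_comm]
    refine Finset.sum_congr rfl fun d _ => ?_
    rw [Finset.sum_comm]
    refine Finset.sum_congr rfl fun b _ => Finset.sum_congr rfl fun k _ => ?_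
    ring
  have left : contr (fun F => u.S C D F x) (fun F => u.G F B A x) =
      ∑ a, ∑ b, ∑ c, ∑ d, ((∑ f, (u.Γup c d f x - u.Γup d c f x) * u.Γ f b a x : ℝ) : ℂ) *
        nullFrame A a * nullFrame B b * nullFrame C c * nullFrame D d := by
    simp only [hS, hG3 _ B A]
    rw [← sum_eta_eq_contr, Finset.sum_comm]
    push_cast
    rw [sum_contraction_left]
    refine Finset.sum_congr rfl fun f _ => ?_
    rw [← Finset.sum_mul]
    congr 1
    simp only [Γup, Complex.ofReal_sum, Complex.ofReal_mul, ← Finset.sum_sub_distrib,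
      Finset.sum_mul, Finset.mul_sum]
    rw [Finset.sum_comm]
    refine Finset.sum_congr rfl fun d _ => ?_
    rw [Finset.sum_comm]
    refine Finset.sum_congr rfl fun b _ => Finset.sum_congr rfl fun k _ => ?_
    ring
  have mid2 := middle B A D C
  rw [Finset.sum_congr rfl fun a _ => Finset.sum_congr rfl fun b _ => Finset.sum_comm] at mid2
  have der2 := (nd_G (u := u) hΓ D C B A).trans
    (sum_perm (fun d c b a => ((dir (u.e d) (u.Γ c b a) x : ℝ) : ℂ)) _ _ _ _).symm
  rw [Finset.sum_congr rfl fun a _ => Finset.sum_congr rfl fun b _ => Finset.sum_comm] at der2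
  rw [middle B A C D, mid2, left, der2, nd_G hΓ C D B A,
    ← sum_perm (fun c d b a => ((dir (u.e c) (u.Γ d b a) x : ℝ) : ℂ))]
  simp only [riemC, contract4, ← Finset.sum_sub_distrib, ← Finset.sum_add_distrib]
  refine Finset.sum_congr rfl fun a _ => Finset.sum_congr rfl fun b _ =>
    Finset.sum_congr rfl fun c _ => Finset.sum_congr rfl fun d _ => ?_
  simp only [riemann, Finset.sum_sub_distrib]
  push_cast
  ring

end TetradData

/-! ### Commutators -/

/-- Curvature, divergence and the torsion tested on a function are polynomials of degree at most two
along `u + t v`. Linearising them therefore means reading off the coefficient of t, which is what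
`coeff_eq_of_hasDerivAt` does. -/
theorem hasDerivAt_quadratic {f : ℝ → ℂ} {c₀ c₁ c₂ : ℂ}
    (hf : ∀ t : ℝ, f t = c₀ + t * c₁ + t ^ 2 * c₂) : HasDerivAt f c₁ 0 := by
  have e : f = fun t : ℝ => c₀ + (t : ℂ) * c₁ + (t : ℂ) ^ 2 * c₂ := funext hf
  rw [e]
  have ht : HasDerivAt (fun t : ℝ => (t : ℂ)) 1 0 := Complex.ofRealCLM.hasDerivAt
  have h2 : HasDerivAt (fun t : ℝ => c₀ + (t : ℂ) * c₁ + (t : ℂ) ^ 2 * c₂) _ 0 :=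
    ((hasDerivAt_const (0 : ℝ) c₀).add (ht.mul_const c₁)).add ((ht.pow 2).mul_const c₂)
  simpa using h2

theorem coeff_eq_of_hasDerivAt {f : ℝ → ℂ} {c₀ c₁ c₂ d : ℂ} (h : HasDerivAt f d 0)
    (hf : ∀ t : ℝ, f t = c₀ + t * c₁ + t ^ 2 * c₂) : c₁ = d :=
  (hasDerivAt_quadratic hf).unique h

section

variable [IsManifold I ∞ M] {U : Set M}

theorem IsLeviCivitaOn.mono {V : Set M} {u : TetradData I M} (h : IsLeviCivitaOn U u)
    (hV : V ⊆ U) : IsLeviCivitaOn V u where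
  smooth_e a := (h.smooth_e a).mono hV
  smooth_Γ a b c := (h.smooth_Γ a b c).mono hV
  norm x hx := h.norm x (hV hx)
  metric x hx := h.metric x (hV hx)
  torsion x hx := h.torsion x (hV hx)

theorem IsLinearisedLeviCivitaOn.mono {V : Set M} {u v : TetradData I M}
    (h : IsLinearisedLeviCivitaOn U u v) (hV : V ⊆ U) : IsLinearisedLeviCivitaOn V u v where
  smooth_e a := (h.smooth_e a).mono hV
  smooth_Γ a b c := (h.smooth_Γ a b c).mono hV
  norm x hx := h.norm x (hV hx)
  metric x hx := h.metric x (hV hx)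
  torsion x hx := h.torsion x (hV hx)

theorem SmoothVectorFieldOn.add_smul {X Y : ∀ x : M, TangentSpace I x}
    (hX : SmoothVectorFieldOn U X) (hY : SmoothVectorFieldOn U Y) (t : ℝ) :
    SmoothVectorFieldOn U (fun y => X y + t • Y y) :=
  ContMDiffOn.add_section hX (ContMDiffOn.const_smul_section (a := t) hY)

/-- The linearised metric condition is the metric condition for the perturbation. -/
theorem IsLinearisedLeviCivitaOn.metricDefect_eq_zero {u v : TetradData I M}
    (h : IsLinearisedLeviCivitaOn U u v) {x : M} (hx : x ∈ U) (a b c : Fin 4) :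
    v.metricDefect a b c x = 0 := by
  have h1 := (h.metric x hx a b c).ofReal_comp
  have := coeff_eq_of_hasDerivAt (c₀ := u.metricDefect a b c x) (c₁ := v.metricDefect a b c x)
    (c₂ := 0) h1 (fun t => by
      simp only [TetradData.metricDefect, TetradData.line]
      push_cast
      ring)
  exact_mod_cast this

end

namespace TetradData

variable {u v w : TetradData I M} {x : M} {f : M → ℂ}

theorem nd_nd (A B : Fin 4)
    (hf : ∀ b, MDifferentiableAt I 𝓘(ℝ, ℂ) (dir (v.e b) f) x) :
    u.nd A (v.nd B f) x = ∑ a, ∑ b, nullFrame A a * nullFrame B b *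
      dir (u.e a) (dir (v.e b) f) x := by
  have e : v.nd B f = fun y => ∑ b, nullFrame B b * dir (v.e b) f y := rfl
  have hm : ∀ b, MDifferentiableAt I 𝓘(ℝ, ℂ) (fun y => nullFrame B b * dir (v.e b) f y) x :=
    fun b => mdifferentiableAt_const.mul (hf b)
  rw [e, nd_sum A _ fun b _ => hm b]
  rw [Finset.sum_congr rfl fun b _ => nd_const_mul A _ (hf b)]
  simp only [nd, along, Finset.mul_sum]
  rw [Finset.sum_comm]
  exact Finset.sum_congr rfl fun a _ => Finset.sum_congr rfl fun b _ => by ring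

/-- Vanishing torsion expresses brackets of real frame fields through `Γup`; this rewrites that
expression by null frame structure functions. The frame `w` that differentiates is kept apart from
`u` because the linearised commutator mixes background and perturbation. -/
theorem contr_S_nd (A B : Fin 4) :
    contr (fun F => u.S A B F x) (fun F => w.nd F f x) = ∑ a, ∑ b, nullFrame A a * nullFrame B b *
      ∑ c, ((u.Γup a b c x - u.Γup b a c x : ℝ) : ℂ) * dir (w.e c) f x := by
  have hS : ∀ Z, u.S A B Z x = ∑ z, nullFrame Z z *
      ∑ c, ∑ d, ((u.Γ c d z x - u.Γ d c z x : ℝ) : ℂ) * nullFrame A c * nullFrame B d := by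
    intro Z
    simp only [S, G, conn]
    rw [Finset.sum_comm (f := fun a b => ∑ c, (u.Γ a b c x : ℂ) * nullFrame B a * nullFrame A b *
      nullFrame Z c)]
    simp only [← Finset.sum_sub_distrib, Finset.mul_sum]
    rw [Finset.sum_congr rfl fun a _ => Finset.sum_comm, Finset.sum_comm]
    refine Finset.sum_congr rfl fun z _ => Finset.sum_congr rfl fun a _ =>
      Finset.sum_congr rfl fun b _ => ?_
    push_cast
    ring
  simp only [hS, nd, along]
  rw [← sum_eta_eq_contr, Finset.sum_comm]
  simp only [Γup, ← Finset.sum_sub_distrib, Complex.ofReal_sum, Finset.mul_sum, Finset.sum_mul]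
  rw [Finset.sum_congr rfl fun c _ => Finset.sum_comm]
  rw [Finset.sum_congr rfl fun c _ => Finset.sum_congr rfl fun a _ => Finset.sum_comm]
  rw [Finset.sum_comm]
  rw [Finset.sum_congr rfl fun c _ => Finset.sum_comm]
  refine Finset.sum_congr rfl fun a _ => Finset.sum_congr rfl fun b _ =>
      Finset.sum_congr rfl fun c _ => Finset.sum_congr rfl fun d _ => ?_
  push_cast
  ring

variable [IsManifold I ∞ M] {U : Set M}

theorem smoothOn_nd (hU : IsOpen U) (he : ∀ a, SmoothVectorFieldOn U (u.e a)) (A : Fin 4)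
    (hf : SmoothOn I U f) : SmoothOn I U (u.nd A f) := by
  change SmoothOn I U (fun y => ∑ a, nullFrame A a * dir (u.e a) f y)
  exact SmoothOn.sum _ fun a _ => SmoothOn.const_mul _ (contMDiffOn_dir hU (he a) hf)

theorem smoothOn_G (hΓ : ∀ a b c, ContMDiffOn I 𝓘(ℝ, ℝ) ∞ (u.Γ a b c) U) (A B C : Fin 4) :
    SmoothOn I U (u.G A B C) := by
  change SmoothOn I U (fun y => ∑ a, ∑ b, ∑ c, (u.Γ a b c y : ℂ) * nullFrame A a * nullFrame B b *
    nullFrame C c)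
  exact SmoothOn.sum _ fun a _ => SmoothOn.sum _ fun b _ => SmoothOn.sum _ fun c _ =>
    (((SmoothOn.ofReal (hΓ a b c)).mul (.const _)).mul (.const _)).mul (.const _)

/-- The commutator of null frame derivatives. -/
theorem nd_comm (hU : IsOpen U) (hu : IsLeviCivitaOn U u) (hx : x ∈ U) (hf : SmoothOn I U f)
    (A B : Fin 4) :
    u.nd A (u.nd B f) x - u.nd B (u.nd A f) x =
      contr (fun F => u.S A B F x) (fun F => u.nd F f x) := by
  have hd : ∀ b, MDifferentiableAt I 𝓘(ℝ, ℂ) (dir (u.e b) f) x := fun b =>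
    mdifferentiableAt_of_contMDiffOn hU (contMDiffOn_dir hU (hu.smooth_e b) hf) hx
  rw [nd_nd A B hd, nd_nd B A hd, contr_S_nd, Finset.sum_comm (γ := Fin 4) (f := fun b a =>
    nullFrame B b * nullFrame A a * dir (u.e b) (dir (u.e a) f) x)]
  simp only [← Finset.sum_sub_distrib]
  refine Finset.sum_congr rfl fun a _ => Finset.sum_congr rfl fun b _ => ?_
  rw [mul_comm (nullFrame B b), ← mul_sub]
  congr 1
  have h1 := mfderiv_mlieBracket hU (hu.smooth_e a) (hu.smooth_e b) hf hx
  rw [← h1]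
  have h2 := hu.torsion x hx a b
  rw [torsionDefect, sub_eq_zero] at h2
  rw [h2, map_sum]
  refine Finset.sum_congr rfl fun c _ => ?_
  rw [map_smul]
  rfl

/-- The linearised commutator of null frame derivatives. -/
theorem nd_comm_linearised (hU : IsOpen U) (hu : IsLeviCivitaOn U u)
    (hv : IsLinearisedLeviCivitaOn U u v) (hx : x ∈ U) (hf : SmoothOn I U f) (A B : Fin 4) :
    u.nd A (v.nd B f) x + v.nd A (u.nd B f) x - u.nd B (v.nd A f) x - v.nd B (u.nd A f) x =
      contr (fun F => v.S A B F x) (fun F => u.nd F f x) +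
        contr (fun F => u.S A B F x) (fun F => v.nd F f x) := by
  have su : ∀ b, ContMDiffOn I 𝓘(ℝ, ℂ) ∞ (dir (u.e b) f) U := fun b =>
    contMDiffOn_dir hU (hu.smooth_e b) hf
  have sv : ∀ b, ContMDiffOn I 𝓘(ℝ, ℂ) ∞ (dir (v.e b) f) U := fun b =>
    contMDiffOn_dir hU (hv.smooth_e b) hf
  have du : ∀ b, MDifferentiableAt I 𝓘(ℝ, ℂ) (dir (u.e b) f) x := fun b =>
    mdifferentiableAt_of_contMDiffOn hU (su b) hx
  have dv : ∀ b, MDifferentiableAt I 𝓘(ℝ, ℂ) (dir (v.e b) f) x := fun b =>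
    mdifferentiableAt_of_contMDiffOn hU (sv b) hx
  have key : ∀ a b, dir (u.e a) (dir (v.e b) f) x + dir (v.e a) (dir (u.e b) f) x
      - dir (u.e b) (dir (v.e a) f) x - dir (v.e b) (dir (u.e a) f) x =
      ∑ c, ((v.Γup a b c x - v.Γup b a c x : ℝ) : ℂ) * dir (u.e c) f x
      + ∑ c, ((u.Γup a b c x - u.Γup b a c x : ℝ) : ℂ) * dir (v.e c) f x := by
    intro a b
    -- A fixed continuous linear map, the differential of f at x, is applied to the torsion defect,
    -- which makes the statement complex-valued.
    have h1 : HasDerivAt (fun t : ℝ => mfderiv I 𝓘(ℝ, ℂ) f x ((u.line v t).torsionDefect a b x))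
        (mfderiv I 𝓘(ℝ, ℂ) f x 0) 0 := by
      let L : E4 →L[ℝ] ℂ := mfderiv I 𝓘(ℝ, ℂ) f x
      let T : ℝ → E4 := fun t => (u.line v t).torsionDefect a b x
      have hT : HasDerivAt T 0 0 := hv.torsion x hx a b
      exact (L.hasFDerivAt (x := T 0)).comp_hasDerivAt 0 hT
    rw [map_zero] at h1
    have hdd : ∀ (t : ℝ) a b, dir ((u.line v t).e a) (dir ((u.line v t).e b) f) x =
        dir (u.e a) (dir (u.e b) f) x + t * (dir (u.e a) (dir (v.e b) f) x +
          dir (v.e a) (dir (u.e b) f) x) + t ^ 2 * dir (v.e a) (dir (v.e b) f) x := by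
      intro t a b
      have e : dir ((u.line v t).e b) f = fun y => dir (u.e b) f y + t * dir (v.e b) f y := by
        funext y
        exact (dir_add_smul t f).trans (by rw [Complex.real_smul])
      have dt : MDifferentiableAt I 𝓘(ℝ, ℂ) (fun y => (t : ℂ) * dir (v.e b) f y) x :=
        mdifferentiableAt_const.mul (dv b)
      have e2 : ∀ Z : (∀ x : M, TangentSpace I x), dir Z (fun y => dir (u.e b) f y +
          t * dir (v.e b) f y) x = dir Z (dir (u.e b) f) x + t * dir Z (dir (v.e b) f) x := by
        intro Z
        rw [dir_add (du b) dt, dir_mul mdifferentiableAt_const (dv b), dir_const]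
        ring
      rw [e]
      refine (dir_add_smul t _).trans ?_
      rw [Complex.real_smul, e2, e2]
      ring
    have h2 := coeff_eq_of_hasDerivAt (c₀ := dir (u.e a) (dir (u.e b) f) x
        - dir (u.e b) (dir (u.e a) f) x
        - ∑ c, ((u.Γup a b c x - u.Γup b a c x : ℝ) : ℂ) * dir (u.e c) f x)
      (c₁ := dir (u.e a) (dir (v.e b) f) x + dir (v.e a) (dir (u.e b) f) x
        - dir (u.e b) (dir (v.e a) f) x - dir (v.e b) (dir (u.e a) f) x
        - (∑ c, ((v.Γup a b c x - v.Γup b a c x : ℝ) : ℂ) * dir (u.e c) f x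
          + ∑ c, ((u.Γup a b c x - u.Γup b a c x : ℝ) : ℂ) * dir (v.e c) f x))
      (c₂ := dir (v.e a) (dir (v.e b) f) x - dir (v.e b) (dir (v.e a) f) x
        - ∑ c, ((v.Γup a b c x - v.Γup b a c x : ℝ) : ℂ) * dir (v.e c) f x) h1 ?_
    · exact sub_eq_zero.1 h2
    · intro t
      -- The bracket formula is available for every t, since it needs only smoothness of e + t e';
      -- the torsion itself vanishes merely to first order.
      have hb := mfderiv_mlieBracket hU ((hu.smooth_e a).add_smul (hv.smooth_e a) t)
        ((hu.smooth_e b).add_smul (hv.smooth_e b) t) hf hx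
      have hb' : mfderiv I 𝓘(ℝ, ℂ) f x (mlieBracket I ((u.line v t).e a) ((u.line v t).e b) x) =
        dir ((u.line v t).e a) (dir ((u.line v t).e b) f) x
          - dir ((u.line v t).e b) (dir ((u.line v t).e a) f) x := hb
      have hc : ∀ c, mfderiv I 𝓘(ℝ, ℂ) f x (((u.line v t).Γup a b c x - (u.line v t).Γup b a c x) •
          (u.line v t).e c x) =
          ((u.Γup a b c x - u.Γup b a c x : ℝ) : ℂ) * dir (u.e c) f x
          + (t : ℂ) * (((v.Γup a b c x - v.Γup b a c x : ℝ) : ℂ) * dir (u.e c) f x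
          + ((u.Γup a b c x - u.Γup b a c x : ℝ) : ℂ) * dir (v.e c) f x)
          + (t : ℂ) ^ 2 * (((v.Γup a b c x - v.Γup b a c x : ℝ) : ℂ) * dir (v.e c) f x) := by
        intro c
        have e3 : mfderiv I 𝓘(ℝ, ℂ) f x ((u.line v t).e c x) = dir (u.e c) f x
          + (t : ℂ) * dir (v.e c) f x := (dir_add_smul t f).trans (by rw [Complex.real_smul])
        have e4 : ∀ a b c, (u.line v t).Γup a b c x = u.Γup a b c x + t * v.Γup a b c x := by
          intro a b c
          simp only [Γup, line, Finset.mul_sum, ← Finset.sum_add_distrib]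
          exact Finset.sum_congr rfl fun _ _ => by ring
        rw [map_smul, e3, e4, e4]
        refine (Complex.real_smul).trans ?_
        push_cast
        ring
      have hval : @Eq ℂ (mfderiv I 𝓘(ℝ, ℂ) f x ((u.line v t).torsionDefect a b x))
          ((dir ((u.line v t).e a) (dir ((u.line v t).e b) f) x
          - dir ((u.line v t).e b) (dir ((u.line v t).e a) f) x : ℂ)
          - ∑ c, (((u.Γup a b c x - u.Γup b a c x : ℝ) : ℂ) * dir (u.e c) f x
          + (t : ℂ) * (((v.Γup a b c x - v.Γup b a c x : ℝ) : ℂ) * dir (u.e c) f x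
          + ((u.Γup a b c x - u.Γup b a c x : ℝ) : ℂ) * dir (v.e c) f x)
          + (t : ℂ) ^ 2 * (((v.Γup a b c x - v.Γup b a c x : ℝ) : ℂ) * dir (v.e c) f x))) := by
        rw [torsionDefect, map_sub, hb', map_sum, Finset.sum_congr rfl fun c _ => hc c]
        rfl
      refine hval.trans ?_
      rw [hdd, hdd]
      simp only [Finset.sum_add_distrib, ← Finset.mul_sum]
      ring
  rw [nd_nd A B dv, nd_nd A B du, nd_nd B A dv, nd_nd B A du, contr_S_nd, contr_S_nd,
    Finset.sum_comm (γ := Fin 4) (f := fun b a =>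
      nullFrame B b * nullFrame A a * dir (u.e b) (dir (v.e a) f) x),
    Finset.sum_comm (γ := Fin 4) (f := fun b a =>
      nullFrame B b * nullFrame A a * dir (v.e b) (dir (u.e a) f) x)]
  simp only [← Finset.sum_sub_distrib, ← Finset.sum_add_distrib]
  refine Finset.sum_congr rfl fun a _ => Finset.sum_congr rfl fun b _ => ?_
  linear_combination (nullFrame A a * nullFrame B b) * key a b

/-- A covector annihilated by the differentials of all smooth functions vanishes. -/
theorem eq_zero_of_contr_nd (hu : ∀ a b, u.normDefect a b x = 0) {X : Fin 4 → ℂ}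
    (h : ∀ f : M → ℂ, SmoothOn I (chartAt H x).source f →
      contr X (fun F => u.nd F f x) = 0) (A : Fin 4) : X A = 0 := by
  have hn : ∀ a b, u.g x (u.e a x) (u.e b x) = eta a b := fun a b => by
    have := hu a b
    unfold normDefect at this
    linarith
  -- The test function is the chart paired with e_b by the metric frozen at x. The chart has
  -- identity differential at x, so its derivative along e_a is η_{ab}, and the four values of b
  -- give a nondegenerate linear system for X.
  have key : ∀ b, contr X (fun F => ∑ a, nullFrame F a * (eta a b : ℂ)) = 0 := by
    intro b
    let L0 : TangentSpace I x →ₗ[ℝ] ℝ := (u.g x).flip (u.e b x)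
    let L1 : E4 →ₗ[ℝ] ℝ := L0
    let L : E4 →L[ℝ] ℝ := LinearMap.toContinuousLinearMap L1
    have hsm : ContMDiffOn I 𝓘(ℝ, E4) ∞ (extChartAt I x) (chartAt H x).source :=
      contMDiffOn_extChartAt
    have hL : ContMDiffOn I 𝓘(ℝ, ℝ) ∞ (fun y => L (extChartAt I x y)) (chartAt H x).source :=
      L.contDiff.contMDiff.comp_contMDiffOn hsm
    have h1 := h (fun y => (L (extChartAt I x y) : ℂ)) (SmoothOn.ofReal hL)
    have hxs : x ∈ (chartAt H x).source := mem_chart_source H x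
    have hdl := mdifferentiableAt_of_contMDiffOn (chartAt H x).open_source hL hxs
    have hde := mdifferentiableAt_of_contMDiffOn (chartAt H x).open_source hsm hxs
    have h2 : ∀ a, dir (u.e a) (fun y => (L (extChartAt I x y) : ℂ)) x = (eta a b : ℂ) := by
      intro a
      rw [dir_ofReal hdl, dir_comp L.hasFDerivAt hde, ← hn a b]
      have h3 : dir (u.e a) (extChartAt I x) x = u.e a x := by
        unfold dir
        rw [mfderiv_extChartAt_self]
        rfl
      rw [h3]
      rfl
    simpa only [nd, along, h2] using h1
  have k0 := key 0
  have k1 := key 1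
  have k2 := key 2
  have k3 := key 3
  have hs : (1 / (Real.sqrt 2 : ℂ)) ≠ 0 := fun h0 => by
    have := sqrtTwo_inv_sq
    rw [h0] at this
    norm_num at this
  rw [nullFrame_eq] at k0 k1 k2 k3
  generalize (1 / (Real.sqrt 2 : ℂ)) = s at *
  simp [contr, Fin.sum_univ_four, eta] at k0 k1 k2 k3
  have k4 : X 2 + X 3 = 0 := by
    have : s * (X 2 + X 3) = 0 := by linear_combination k2
    exact (mul_eq_zero.1 this).resolve_left hs
  have k5 : -X 2 + X 3 = 0 := by
    have : (Complex.I * s) * (-X 2 + X 3) = 0 := by linear_combination k3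
    exact (mul_eq_zero.1 this).resolve_left (mul_ne_zero Complex.I_ne_zero hs)
  fin_cases A
  · exact k0
  · exact k1
  · change X 2 = 0
    linear_combination (1 / 2) * (k4 - k5)
  · change X 3 = 0
    linear_combination (1 / 2) * (k4 + k5)

end TetradData

/-! ### Null frame components of curvature -/

/-- `T_{ab} p^a q^b`. -/
def contract2 (T : Fin 4 → Fin 4 → ℝ) (p q : Fin 4 → ℂ) : ℂ := ∑ a, ∑ b, (T a b : ℂ) * p a * q b

theorem contract2_eta (A B : Fin 4) : contract2 eta (nullFrame A) (nullFrame B) = etaC A B := by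
  have hs := sqrtTwo_inv_sq
  have hI := Complex.I_mul_I
  rw [contract2, nullFrame_eq]
  generalize (1 / (Real.sqrt 2 : ℂ)) = s at *
  generalize Complex.I = i at *
  fin_cases A <;> fin_cases B <;> simp [Fin.sum_univ_four, eta, etaC] <;>
    first | linear_combination (1 + i * i) * hs + (1 / 2) * hI
          | linear_combination (1 - i * i) * hs - (1 / 2) * hI

/-- The trace of a two-tensor may be computed in the null frame. -/
theorem sum_eta_mul (X : Fin 4 → Fin 4 → ℂ) :
    ∑ a, ∑ b, (eta a b : ℂ) * X a b = ∑ A, ∑ B, etaC A B *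
      ∑ a, ∑ b, X a b * nullFrame A a * nullFrame B b := by
  have hs := sqrtTwo_inv_sq
  have hI := Complex.I_mul_I
  rw [nullFrame_eq]
  generalize (1 / (Real.sqrt 2 : ℂ)) = s at *
  simp [Fin.sum_univ_four, eta, etaC]
  generalize Complex.I = i at *
  linear_combination (2 * (i * i) * X 3 3 - 2 * X 2 2) * hs + (X 3 3) * hI

theorem contract_mul_ac_bd (S T : Fin 4 → Fin 4 → ℝ) (p q r w : Fin 4 → ℂ) :
    ∑ a, ∑ b, ∑ c, ∑ f, ((S a c : ℂ) * T b f) * p a * q b * r c * w f =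
      contract2 S p r * contract2 T q w := by
  simp only [contract2, Fin.sum_univ_four]
  ring

theorem contract_mul_ad_bc (S T : Fin 4 → Fin 4 → ℝ) (p q r w : Fin 4 → ℂ) :
    ∑ a, ∑ b, ∑ c, ∑ f, ((S a f : ℂ) * T b c) * p a * q b * r c * w f =
      contract2 S p w * contract2 T q r := by
  simp only [contract2, Fin.sum_univ_four]
  ring

namespace TetradData

variable (u : TetradData I M)

/-- Null frame components of the Ricci tensor. -/
def ricC (B D : Fin 4) (x : M) : ℂ := ∑ A, ∑ C, etaC A C * u.riemC A B C D x

/-- Null frame components of the Schouten tensor. -/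
def schC (B D : Fin 4) (x : M) : ℂ :=
  u.ricC B D x / 2 - (∑ A, ∑ C, etaC A C * u.ricC A C x) * etaC B D / 12

/-- Null frame components of the Weyl tensor. -/
def weylC (A B C D : Fin 4) (x : M) : ℂ :=
  contract4 u.weyl (nullFrame A) (nullFrame B) (nullFrame C) (nullFrame D) x

variable {u} {x : M}

theorem contract2_ricci (B D : Fin 4) :
    contract2 (fun b d => u.ricci b d x) (nullFrame B) (nullFrame D) = u.ricC B D x := by
  have e := sum_eta_mul (fun a c => ∑ b, ∑ d, (u.riemann a b c d x : ℂ) * nullFrame B b *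
    nullFrame D d)
  have e1 : contract2 (fun b d => u.ricci b d x) (nullFrame B) (nullFrame D) =
      ∑ a, ∑ c, (eta a c : ℂ) * ∑ b, ∑ d, (u.riemann a b c d x : ℂ) * nullFrame B b *
        nullFrame D d := by
    simp only [contract2, ricci, Complex.ofReal_sum, Complex.ofReal_mul, Finset.sum_mul,
      Finset.mul_sum]
    rw [Finset.sum_congr rfl fun b _ => Finset.sum_comm, Finset.sum_comm]
    refine Finset.sum_congr rfl fun a _ => ?_
    rw [Finset.sum_congr rfl fun b _ => Finset.sum_comm, Finset.sum_comm]
    refine Finset.sum_congr rfl fun c _ => Finset.sum_congr rfl fun b _ =>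
      Finset.sum_congr rfl fun d _ => ?_
    ring
  rw [e1, e, ricC]
  refine Finset.sum_congr rfl fun A _ => Finset.sum_congr rfl fun C _ => ?_
  congr 1
  simp only [riemC, contract4, Finset.sum_mul]
  refine Finset.sum_congr rfl fun a _ => ?_
  rw [Finset.sum_comm]
  refine Finset.sum_congr rfl fun b _ => Finset.sum_congr rfl fun c _ =>
      Finset.sum_congr rfl fun d _ => ?_
  ring

theorem scalar_eq : (u.scalar x : ℂ) = ∑ A, ∑ C, etaC A C * u.ricC A C x := by
  have e := sum_eta_mul (fun a c => (u.ricci a c x : ℂ))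
  simp only [scalar, Complex.ofReal_sum, Complex.ofReal_mul]
  rw [e]
  simp only [← contract2_ricci, contract2]

theorem contract2_schouten (B D : Fin 4) :
    contract2 (fun b d => u.schouten b d x) (nullFrame B) (nullFrame D) = u.schC B D x := by
  rw [schC, ← contract2_ricci, ← contract2_eta, ← scalar_eq]
  simp only [contract2, schouten, Finset.sum_div, Finset.mul_sum, ← Finset.sum_sub_distrib]
  refine Finset.sum_congr rfl fun b _ => Finset.sum_congr rfl fun c _ => ?_
  push_cast
  ring

theorem weylC_eq (A B C D : Fin 4) :
    u.weylC A B C D x = u.riemC A B C D x - (etaC A C * u.schC B D x - etaC A D * u.schC B C x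
      + etaC B D * u.schC A C x - etaC B C * u.schC A D x) := by
  simp only [← contract2_eta, ← contract2_schouten]
  rw [mul_comm (contract2 eta (nullFrame B) (nullFrame D)),
    mul_comm (contract2 eta (nullFrame B) (nullFrame C)),
    ← contract_mul_ac_bd _ _ _ (nullFrame B) (nullFrame C),
    ← contract_mul_ac_bd _ _ _ (nullFrame B) (nullFrame C),
    ← contract_mul_ad_bc _ _ _ (nullFrame B) (nullFrame C),
    ← contract_mul_ad_bc _ _ _ (nullFrame B) (nullFrame C)]
  simp only [weylC, riemC, contract4, ← Finset.sum_sub_distrib, ← Finset.sum_add_distrib]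
  refine Finset.sum_congr rfl fun a _ => Finset.sum_congr rfl fun b _ =>
    Finset.sum_congr rfl fun c _ => Finset.sum_congr rfl fun d _ => ?_
  simp only [weyl]
  push_cast
  ring

theorem nd_contr {X Y : Fin 4 → M → ℂ} (hX : ∀ F, MDifferentiableAt I 𝓘(ℝ, ℂ) (X F) x)
    (hY : ∀ F, MDifferentiableAt I 𝓘(ℝ, ℂ) (Y F) x) (C : Fin 4) :
    u.nd C (fun y => contr (fun F => X F y) (fun F => Y F y)) x =
      contr (fun F => u.nd C (X F) x) (fun F => Y F x)
        + contr (fun F => X F x) (fun F => u.nd C (Y F) x) := by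
  have hXY : ∀ F K, MDifferentiableAt I 𝓘(ℝ, ℂ) (fun y => X F y * Y K y) x :=
    fun F K => (hX F).mul (hY K)
  have e : (fun y => contr (fun F => X F y) (fun F => Y F y)) =
      fun y => ∑ a, ∑ b, etaC a b * (X a y * Y b y) := by
    funext y
    rw [contr_eq_sum]
    simp only [mul_assoc]
  have h1 : ∀ a b, MDifferentiableAt I 𝓘(ℝ, ℂ) (fun y => etaC a b * (X a y * Y b y)) x :=
    fun a b => mdifferentiableAt_const.mul (hXY a b)
  have e2 : u.nd C (fun y => ∑ z : Fin 4 × Fin 4, etaC z.1 z.2 * (X z.1 y * Y z.2 y)) x =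
      ∑ z : Fin 4 × Fin 4, etaC z.1 z.2 * (u.nd C (X z.1) x * Y z.2 x + X z.1 x * u.nd C (Y z.2) x) := by
    rw [nd_sum C _ fun z _ => h1 z.1 z.2]
    refine Finset.sum_congr rfl fun z _ => ?_
    rw [nd_const_mul C _ (hXY _ _), nd_mul C (hX _) (hY _)]
  simp only [Fintype.sum_prod_type] at e2
  rw [e, e2, contr_eq_sum, contr_eq_sum]
  simp only [← Finset.sum_add_distrib]
  exact Finset.sum_congr rfl fun a _ => Finset.sum_congr rfl fun b _ => by ring

variable [IsManifold I ∞ M] {U : Set M}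

theorem smoothOn_S (hΓ : ∀ a b c, ContMDiffOn I 𝓘(ℝ, ℝ) ∞ (u.Γ a b c) U) (A B C : Fin 4) :
    SmoothOn I U (u.S A B C) :=
  (smoothOn_G hΓ A B C).sub (smoothOn_G hΓ B A C)

/-- The Jacobi identity for the structure functions. -/
theorem jacobi (hU : IsOpen U) (hu : IsLeviCivitaOn U u) (hx : x ∈ U) (A B C K : Fin 4) :
    contr (fun F => u.S A B F x) (fun F => u.S F C K x) - u.nd C (u.S A B K) x
      + (contr (fun F => u.S B C F x) (fun F => u.S F A K x) - u.nd A (u.S B C K) x)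
      + (contr (fun F => u.S C A F x) (fun F => u.S F B K x) - u.nd B (u.S C A K) x) = 0 := by
  refine eq_zero_of_contr_nd (X := fun K =>
    contr (fun F => u.S A B F x) (fun F => u.S F C K x) - u.nd C (u.S A B K) x
      + (contr (fun F => u.S B C F x) (fun F => u.S F A K x) - u.nd A (u.S B C K) x)
      + (contr (fun F => u.S C A F x) (fun F => u.S F B K x) - u.nd B (u.S C A K) x))
    (hu.norm x hx) (fun f hf => ?_) K
  set V := U ∩ (chartAt H x).source with hV
  have hVo : IsOpen V := hU.inter (chartAt H x).open_source
  have hxV : x ∈ V := ⟨hx, mem_chart_source H x⟩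
  have hL : IsLeviCivitaOn V u := hu.mono inter_subset_left
  have hfV : SmoothOn I V f := hf.mono inter_subset_right
  have hnd : ∀ F, SmoothOn I V (u.nd F f) := fun F => smoothOn_nd hVo hL.smooth_e F hfV
  have hndd : ∀ F K, MDifferentiableAt I 𝓘(ℝ, ℂ) (u.nd F (u.nd K f)) x := fun F K =>
    mdifferentiableAt_of_contMDiffOn hVo (smoothOn_nd hVo hL.smooth_e F (hnd K)) hxV
  -- Third derivatives of f are compared in two ways: commuting the outer pair, or differentiating
  -- the commutator of the inner pair. The cyclic sums of both left-hand sides agree, and the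
  -- right-hand sides then leave a covector contracted with df.
  have outer : ∀ A B C, u.nd A (u.nd B (u.nd C f)) x - u.nd B (u.nd A (u.nd C f)) x =
      contr (fun F => u.S A B F x) (fun F => u.nd F (u.nd C f) x) := fun A B C =>
    nd_comm hVo hL hxV (hnd C) A B
  have inner : ∀ A B C, u.nd C (u.nd A (u.nd B f)) x - u.nd C (u.nd B (u.nd A f)) x =
      contr (fun F => u.nd C (u.S A B F) x) (fun F => u.nd F f x)
        + contr (fun F => u.S A B F x) (fun F => u.nd C (u.nd F f) x) := by
    intro A B C
    rw [← nd_sub C (hndd A B) (hndd B A), nd_congr C hVo hxV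
      (fun y hy => nd_comm hVo hL hy hfV A B)]
    exact nd_contr (fun F => mdifferentiableAt_of_contMDiffOn hVo (smoothOn_S hL.smooth_Γ A B F) hxV)
      (fun F => mdifferentiableAt_of_contMDiffOn hVo (hnd F) hxV) C
  have comm : ∀ F C, u.nd F (u.nd C f) x - u.nd C (u.nd F f) x =
      contr (fun K => u.S F C K x) (fun K => u.nd K f x) := fun F C =>
    nd_comm hVo hL hxV hfV F C
  have o1 := outer A B C
  have o2 := outer B C A
  have o3 := outer C A B
  have i1 := inner A B C
  have i2 := inner B C A
  have i3 := inner C A B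
  have c0 := comm 0
  have c1 := comm 1
  have c2 := comm 2
  have c3 := comm 3
  simp only [contr] at *
  linear_combination i1 + i2 + i3 - o1 - o2 - o3
    + u.S A B 0 x * c1 C + u.S A B 1 x * c0 C - u.S A B 2 x * c3 C - u.S A B 3 x * c2 C
    + u.S B C 0 x * c1 A + u.S B C 1 x * c0 A - u.S B C 2 x * c3 A - u.S B C 3 x * c2 A
    + u.S C A 0 x * c1 B + u.S C A 1 x * c0 B - u.S C A 2 x * c3 B - u.S C A 3 x * c2 B

/-- The first Bianchi identity. -/
theorem riemC_cyclic (hU : IsOpen U) (hu : IsLeviCivitaOn U u) (hx : x ∈ U) (K B C D : Fin 4) :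
    u.riemC K B C D x + u.riemC K C D B x + u.riemC K D B C x = 0 := by
  have hΓ : ∀ a b c, MDifferentiableAt I 𝓘(ℝ, ℝ) (u.Γ a b c) x := fun a b c =>
    mdifferentiableAt_of_contMDiffOn hU (hu.smooth_Γ a b c) hx
  have hS : ∀ A B C D, u.nd A (u.S B C D) x = u.nd A (u.G B C D) x - u.nd A (u.G C B D) x :=
    fun A B C D => nd_sub A
      (mdifferentiableAt_of_contMDiffOn hU (smoothOn_G hu.smooth_Γ B C D) hx)
      (mdifferentiableAt_of_contMDiffOn hU (smoothOn_G hu.smooth_Γ C B D) hx)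
  -- In the cyclic sum the derivatives of the connection combine into derivatives of structure
  -- functions, so the first Bianchi identity is the Jacobi identity in another form.
  have h := jacobi hU hu hx D B C K
  rw [hS, hS, hS] at h
  rw [riemC_eq hΓ, riemC_eq hΓ, riemC_eq hΓ]
  simp only [contr, S] at *
  linear_combination -h

theorem riemC_antisymm_left (hU : IsOpen U) (hu : IsLeviCivitaOn U u) (hx : x ∈ U)
    (A B C D : Fin 4) : u.riemC A B C D x = -u.riemC B A C D x := by
  have hΓ : ∀ a b c, MDifferentiableAt I 𝓘(ℝ, ℝ) (u.Γ a b c) x := fun a b c =>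
    mdifferentiableAt_of_contMDiffOn hU (hu.smooth_Γ a b c) hx
  have hd : ∀ C D B A, u.nd C (u.G D B A) x = -u.nd C (u.G D A B) x := by
    intro C D B A
    rw [← nd_neg C (mdifferentiableAt_of_contMDiffOn hU (smoothOn_G hu.smooth_Γ D A B) hx)]
    exact nd_congr C hU hx fun y hy => G_antisymm (hu.metric y hy) D B A
  have hG := G_antisymm (hu.metric x hx)
  rw [riemC_eq hΓ, riemC_eq hΓ, hd C D B A, hd D C B A]
  simp only [contr]
  simp only [hG C _ B, hG D _ B, hG C _ A, hG D _ A, hG _ A B]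
  ring

theorem riemC_antisymm_right (hU : IsOpen U) (hu : IsLeviCivitaOn U u) (hx : x ∈ U)
    (A B C D : Fin 4) : u.riemC A B C D x = -u.riemC A B D C x := by
  have hΓ : ∀ a b c, MDifferentiableAt I 𝓘(ℝ, ℝ) (u.Γ a b c) x := fun a b c =>
    mdifferentiableAt_of_contMDiffOn hU (hu.smooth_Γ a b c) hx
  rw [riemC_eq hΓ, riemC_eq hΓ]
  simp only [contr, S]
  ring

/-- The trace of the cyclic identity is the antisymmetric part of the Ricci tensor plus a trace over
an antisymmetric pair, which is zero. This symmetry cancels the Ricci terms in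
`IsSolutionOn.nd_sub_nd_typeD`. -/
theorem ricC_symm (hU : IsOpen U) (hu : IsLeviCivitaOn U u) (hx : x ∈ U) (B D : Fin 4) :
    u.ricC B D x = u.ricC D B x := by
  have c := fun A C => riemC_cyclic hU hu hx A B C D
  have l := riemC_antisymm_left hU hu hx
  have r := riemC_antisymm_right hU hu hx
  simp only [ricC, Fin.sum_univ_four, etaC]
  simp
  linear_combination -(c 0 1) - c 1 0 + c 2 3 + c 3 2 + l 0 1 D B - l 2 3 D B + r 0 D B 1
    + r 1 D B 0 - r 2 D B 3 - r 3 D B 2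

end TetradData

/-! ### Weyl tensors and their divergence -/

/-- All frame components of a Weyl tensor in terms of ten of them. -/
theorem WeylSymmetries.components {T : Fin 4 → Fin 4 → Fin 4 → Fin 4 → ℝ} (h : WeylSymmetries T) :
    (∀ a c d, T a a c d = 0) ∧ (∀ a b c, T a b c c = 0) ∧
    (∀ c d, T 1 0 c d = -T 0 1 c d) ∧ (∀ c d, T 2 0 c d = -T 0 2 c d) ∧
    (∀ c d, T 3 0 c d = -T 0 3 c d) ∧ (∀ c d, T 2 1 c d = -T 1 2 c d) ∧
    (∀ c d, T 3 1 c d = -T 1 3 c d) ∧ (∀ c d, T 3 2 c d = -T 2 3 c d) ∧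
    (∀ c d, T c d 1 0 = -T c d 0 1) ∧ (∀ c d, T c d 2 0 = -T c d 0 2) ∧
    (∀ c d, T c d 3 0 = -T c d 0 3) ∧ (∀ c d, T c d 2 1 = -T c d 1 2) ∧
    (∀ c d, T c d 3 1 = -T c d 1 3) ∧ (∀ c d, T c d 3 2 = -T c d 2 3) ∧
    T 0 1 0 1 = -2 * T 0 2 1 2 ∧ T 0 1 2 3 = 2 * T 0 2 1 3 ∧ T 0 2 2 3 = T 0 1 0 3 ∧
    T 0 3 0 3 = -T 0 2 0 2 ∧ T 0 3 1 2 = -T 0 2 1 3 ∧ T 0 3 1 3 = T 0 2 1 2 ∧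
    T 0 3 2 3 = -T 0 1 0 2 ∧ T 1 2 2 3 = -T 0 1 1 3 ∧ T 1 3 2 3 = T 0 1 1 2 ∧
    T 1 3 1 3 = -T 1 2 1 2 ∧ T 2 3 2 3 = 2 * T 0 2 1 2 ∧
    T 0 2 0 1 = T 0 1 0 2 ∧ T 0 3 0 1 = T 0 1 0 3 ∧ T 1 2 0 1 = T 0 1 1 2 ∧
    T 1 3 0 1 = T 0 1 1 3 ∧ T 2 3 0 1 = 2 * T 0 2 1 3 ∧ T 0 3 0 2 = T 0 2 0 3 ∧
    T 1 2 0 2 = T 0 2 1 2 ∧ T 1 3 0 2 = T 0 2 1 3 ∧ T 2 3 0 2 = T 0 1 0 3 ∧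
    T 1 2 0 3 = -T 0 2 1 3 ∧ T 1 3 0 3 = T 0 2 1 2 ∧ T 2 3 0 3 = -T 0 1 0 2 ∧
    T 1 3 1 2 = T 1 2 1 3 ∧ T 2 3 1 2 = -T 0 1 1 3 ∧ T 2 3 1 3 = T 0 1 1 2 := by
  have l0 : ∀ a c d, T a a c d = 0 := fun a c d => by linarith [h.antisymm_left a a c d]
  have r0 : ∀ a b c, T a b c c = 0 := fun a b c => by linarith [h.antisymm_right a b c c]
  have l := h.antisymm_left
  have r := h.antisymm_right
  have p := h.pair_symm
  have t := h.trace_free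
  simp [Fin.sum_univ_four, eta] at t
  have t00 := t 0 0
  have t01 := t 0 1
  have t02 := t 0 2
  have t03 := t 0 3
  have t11 := t 1 1
  have t12 := t 1 2
  have t13 := t 1 3
  have t22 := t 2 2
  have t23 := t 2 3
  have t33 := t 3 3
  have cy := h.cyclic 0 1 2 3
  have l10 := fun c d => l 1 0 c d
  have l20 := fun c d => l 2 0 c d
  have l30 := fun c d => l 3 0 c d
  have l21 := fun c d => l 2 1 c d
  have l31 := fun c d => l 3 1 c d
  have l32 := fun c d => l 3 2 c d
  have r10 := fun c d => r c d 1 0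
  have r20 := fun c d => r c d 2 0
  have r30 := fun c d => r c d 3 0
  have r21 := fun c d => r c d 2 1
  have r31 := fun c d => r c d 3 1
  have r32 := fun c d => r c d 3 2
  have p1 := p 0 2 0 1
  have p2 := p 0 3 0 1
  have p3 := p 1 2 0 1
  have p4 := p 1 3 0 1
  have p5 := p 2 3 0 1
  have p6 := p 0 3 0 2
  have p7 := p 1 2 0 2
  have p8 := p 1 3 0 2
  have p9 := p 2 3 0 2
  have p10 := p 1 2 0 3
  have p11 := p 1 3 0 3
  have p12 := p 2 3 0 3
  have p13 := p 1 3 1 2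
  have p14 := p 2 3 1 2
  have p15 := p 2 3 1 3
  simp only [l0, r0, l10, l20, l30, l21, l31, l32, r20, r30, r21, r31, r32,
    p7, p10, p11] at t00 t01 t02 t03 t11 t12 t13 t22 t23 t33 cy
  refine ⟨l0, r0, l10, l20, l30, l21, l31, l32, r10, r20, r30, r21, r31, r32, ?_⟩
  refine ⟨?_, ?_, ?_, ?_, ?_, ?_, ?_, ?_, ?_, ?_, ?_, ?_, ?_, ?_, ?_, ?_, ?_, ?_, ?_, ?_, ?_, ?_,
    ?_, ?_, ?_, ?_⟩ <;> linarith

/-- `T_{abcd}` for an array of numbers, in the null frame. -/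
def arrayT (T : Fin 4 → Fin 4 → Fin 4 → Fin 4 → ℝ) (A B C D : Fin 4) : ℂ :=
  ∑ a, ∑ b, ∑ c, ∑ f, (T a b c f : ℂ) * nullFrame A a * nullFrame B b * nullFrame C c *
    nullFrame D f

/-- `g_{abc}` for an array of numbers, in the null frame. -/
def arrayG (g : Fin 4 → Fin 4 → Fin 4 → ℝ) (A B C : Fin 4) : ℂ :=
  ∑ a, ∑ b, ∑ c, (g a b c : ℂ) * nullFrame A a * nullFrame B b * nullFrame C c

/-- The divergence `∇^f T_{fabc}`, where `T' f` is the derivative of `T` along `e_f` and `g` are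
the connection coefficients. -/
def arrayDiv (g : Fin 4 → Fin 4 → Fin 4 → ℝ) (T' : Fin 4 → Fin 4 → Fin 4 → Fin 4 → Fin 4 → ℝ)
    (T : Fin 4 → Fin 4 → Fin 4 → Fin 4 → ℝ) (a b c : Fin 4) : ℝ :=
  ∑ f, ∑ h, eta f h * (T' f h a b c - ∑ k, ((∑ j, g f h j * eta j k) * T k a b c +
    (∑ j, g f a j * eta j k) * T h k b c + (∑ j, g f b j * eta j k) * T h a k c +
    (∑ j, g f c j * eta j k) * T h a b k))

/-- The exchange `ℓ ↔ k`, `m ↔ m*` on indices of the null frame. -/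
def primeIdx : Fin 4 → Fin 4 := ![1, 0, 3, 2]

section

variable {g : Fin 4 → Fin 4 → Fin 4 → ℝ} {T' : Fin 4 → Fin 4 → Fin 4 → Fin 4 → Fin 4 → ℝ}
  {T : Fin 4 → Fin 4 → Fin 4 → Fin 4 → ℝ}

theorem antisymm_rules (hg : ∀ a b c, g a b c + g a c b = 0) :
    (∀ a b, g a b b = 0) ∧ (∀ a, g a 1 0 = -g a 0 1) ∧ (∀ a, g a 2 0 = -g a 0 2) ∧
    (∀ a, g a 3 0 = -g a 0 3) ∧ (∀ a, g a 2 1 = -g a 1 2) ∧ (∀ a, g a 3 1 = -g a 1 3) ∧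
    (∀ a, g a 3 2 = -g a 2 3) := by
  refine ⟨fun a b => by linarith [hg a b b], ?_, ?_, ?_, ?_, ?_, ?_⟩ <;> intro a
  · linarith [hg a 0 1]
  · linarith [hg a 0 2]
  · linarith [hg a 0 3]
  · linarith [hg a 1 2]
  · linarith [hg a 1 3]
  · linarith [hg a 2 3]

set_option maxHeartbeats 4000000 in
set_option linter.unusedSimpArgs false in
/-- The divergence of a Weyl tensor in the Newman-Penrose formalism. -/
theorem arrayDiv_components (hg : ∀ a b c, g a b c + g a c b = 0) (hT : WeylSymmetries T)
    (hT' : ∀ a, WeylSymmetries (T' a)) (P : Fin 4 → Fin 4) (hP : P = id ∨ P = primeIdx) :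
    -arrayG (arrayDiv g T' T) (P 0) (P 0) (P 2) =
      ∑ a, nullFrame (P 3) a * arrayT (T' a) (P 0) (P 2) (P 0) (P 2)
      - ∑ a, nullFrame (P 0) a * arrayT (T' a) (P 0) (P 1) (P 0) (P 2)
      + (arrayG g (P 0) (P 1) (P 3) + 2 * (arrayG g (P 3) (P 0) (P 1) - arrayG g (P 3) (P 2) (P 3)))
        * arrayT T (P 0) (P 2) (P 0) (P 2)
      + (-4 * arrayG g (P 3) (P 0) (P 2) - (arrayG g (P 0) (P 0) (P 1)
        - arrayG g (P 0) (P 2) (P 3))) * arrayT T (P 0) (P 1) (P 0) (P 2)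
      + 3 * arrayG g (P 0) (P 0) (P 2) * arrayT T (P 0) (P 2) (P 3) (P 1) ∧
    -arrayG (arrayDiv g T' T) (P 2) (P 0) (P 2) =
      ∑ a, nullFrame (P 1) a * arrayT (T' a) (P 0) (P 2) (P 0) (P 2)
      - ∑ a, nullFrame (P 2) a * arrayT (T' a) (P 0) (P 1) (P 0) (P 2)
      + (arrayG g (P 2) (P 1) (P 3) + 2 * (arrayG g (P 1) (P 0) (P 1) - arrayG g (P 1) (P 2) (P 3)))
        * arrayT T (P 0) (P 2) (P 0) (P 2)
      + (-4 * arrayG g (P 1) (P 0) (P 2) - (arrayG g (P 2) (P 0) (P 1)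
        - arrayG g (P 2) (P 2) (P 3))) * arrayT T (P 0) (P 1) (P 0) (P 2)
      + 3 * arrayG g (P 2) (P 0) (P 2) * arrayT T (P 0) (P 2) (P 3) (P 1) ∧
    -arrayG (arrayDiv g T' T) (P 3) (P 2) (P 0) =
      ∑ a, nullFrame (P 0) a * arrayT (T' a) (P 0) (P 2) (P 3) (P 1)
      - ∑ a, nullFrame (P 3) a * arrayT (T' a) (P 0) (P 1) (P 0) (P 2)
      + arrayG g (P 3) (P 1) (P 3) * arrayT T (P 0) (P 2) (P 0) (P 2)
      - (2 * arrayG g (P 0) (P 1) (P 3) + (arrayG g (P 3) (P 0) (P 1) - arrayG g (P 3) (P 2) (P 3)))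
        * arrayT T (P 0) (P 1) (P 0) (P 2)
      + 3 * arrayG g (P 3) (P 0) (P 2) * arrayT T (P 0) (P 2) (P 3) (P 1)
      - 2 * arrayG g (P 0) (P 0) (P 2) * arrayT T (P 1) (P 0) (P 1) (P 3) ∧
    -arrayG (arrayDiv g T' T) (P 1) (P 0) (P 2) =
      ∑ a, nullFrame (P 1) a * arrayT (T' a) (P 0) (P 1) (P 0) (P 2)
      - ∑ a, nullFrame (P 2) a * arrayT (T' a) (P 0) (P 2) (P 3) (P 1)
      - arrayG g (P 1) (P 1) (P 3) * arrayT T (P 0) (P 2) (P 0) (P 2)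
      + (2 * arrayG g (P 2) (P 1) (P 3) + (arrayG g (P 1) (P 0) (P 1) - arrayG g (P 1) (P 2) (P 3)))
        * arrayT T (P 0) (P 1) (P 0) (P 2)
      - 3 * arrayG g (P 1) (P 0) (P 2) * arrayT T (P 0) (P 2) (P 3) (P 1)
      + 2 * arrayG g (P 2) (P 0) (P 2) * arrayT T (P 1) (P 0) (P 1) (P 3) := by
  have r := hT.components
  have r' := fun a => (hT' a).components
  have rg := antisymm_rules hg
  have hs2 : (1 / (Real.sqrt 2 : ℂ)) ^ 2 = 1 / 2 := by rw [sq, sqrtTwo_inv_sq]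
  have hi2 := Complex.I_sq
  simp only [arrayT, arrayG, arrayDiv, nullFrame_eq]
  -- Each product contains at most five factors from m or m*, so powers of 1/√2 and of i up to the
  -- fifth occur and are reduced explicitly.
  generalize (1 / (Real.sqrt 2 : ℂ)) = s at *
  generalize Complex.I = i at *
  have hs3 : s ^ 3 = s / 2 := by linear_combination s * hs2
  have hs4 : s ^ 4 = 1 / 4 := by linear_combination (s ^ 2 + 1 / 2) * hs2
  have hs5 : s ^ 5 = s / 4 := by linear_combination s * hs4
  have hi3 : i ^ 3 = -i := by linear_combination i * hi2
  have hi4 : i ^ 4 = 1 := by linear_combination (i ^ 2 - 1) * hi2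
  have hi5 : i ^ 5 = i := by linear_combination i * hi4
  rcases hP with rfl | rfl <;> refine ⟨?_, ?_, ?_, ?_⟩ <;>
  · simp [primeIdx, Fin.sum_univ_four, eta]
    simp only [r, r', rg]
    push_cast
    ring_nf
    simp only [hs2, hs3, hs4, hs5, hi2, hi3, hi4, hi5]
    ring

end

section

variable {X : ∀ x : M, TangentSpace I x} {x : M} {U : Set M}
  {T : Fin 4 → Fin 4 → Fin 4 → Fin 4 → M → ℝ}

/-- Each Weyl symmetry is the vanishing of a linear functional of the component array, and a linear
functional commutes with the derivative along X. -/
theorem linearMap_dir_eq_zero [IsManifold I ∞ M] (hU : IsOpen U) (hx : x ∈ U)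
    (hT : ∀ a b c d, ContMDiffOn I 𝓘(ℝ, ℝ) ∞ (T a b c d) U)
    (L : (Fin 4 → Fin 4 → Fin 4 → Fin 4 → ℝ) →ₗ[ℝ] ℝ)
    (hL : ∀ y ∈ U, L (fun a b c d => T a b c d y) = 0) :
    L (fun a b c d => dir X (T a b c d) x) = 0 := by
  have hk : MDifferentiableAt I 𝓘(ℝ, Fin 4 → Fin 4 → Fin 4 → Fin 4 → ℝ)
      (fun y => fun a b c d => T a b c d y) x :=
    mdifferentiableAt_of_contMDiffOn hU (contMDiffOn_pi_space.2 fun a =>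
      contMDiffOn_pi_space.2 fun b => contMDiffOn_pi_space.2 fun c =>
        contMDiffOn_pi_space.2 fun d => hT a b c d) hx
  have h1 := dir_comp (X := X) (LinearMap.toContinuousLinearMap L).hasFDerivAt hk
  have h2 : dir X (fun y => LinearMap.toContinuousLinearMap L (fun a b c d => T a b c d y)) x
      = 0 := by
    refine (dir_congr hU hx (g := fun _ => (0 : ℝ)) hL).trans ?_
    exact congrArg (fun L => L (X x))
      (hasMFDerivAt_const (I := I) (I' := 𝓘(ℝ, ℝ)) (0 : ℝ) x).mfderiv
  have h3 : dir X (fun y => fun a b c d => T a b c d y) x = fun a b c d => dir X (T a b c d) x := by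
    funext a b c d
    let p : (Fin 4 → Fin 4 → Fin 4 → Fin 4 → ℝ) →ₗ[ℝ] ℝ :=
      { toFun := fun z => z a b c d, map_add' := fun _ _ => rfl, map_smul' := fun _ _ => rfl }
    exact (dir_comp (X := X) (LinearMap.toContinuousLinearMap p).hasFDerivAt hk).symm
  rw [h2, h3] at h1
  exact h1.symm

/-- The derivative of a field of Weyl tensors along a vector field is a Weyl tensor. -/
theorem WeylSymmetries.dir [IsManifold I ∞ M] (hU : IsOpen U) (hx : x ∈ U)
    (hd : ∀ a b c d, ContMDiffOn I 𝓘(ℝ, ℝ) ∞ (T a b c d) U)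
    (hT : ∀ y ∈ U, WeylSymmetries (fun a b c d => T a b c d y)) :
    WeylSymmetries (fun a b c d => CEFE.dir X (T a b c d) x) where
  antisymm_left a b c d := by
    have := linearMap_dir_eq_zero (X := X) hU hx hd
      { toFun := fun z => z a b c d + z b a c d
        map_add' := fun _ _ => by simp only [Pi.add_apply]; ring
        map_smul' := fun _ _ => by simp only [Pi.smul_apply, smul_eq_mul, RingHom.id_apply]; ring }
      fun y hy => by
        have := (hT y hy).antisymm_left a b c d
        simpa using eq_neg_iff_add_eq_zero.1 this
    exact eq_neg_iff_add_eq_zero.2 this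
  antisymm_right a b c d := by
    have := linearMap_dir_eq_zero (X := X) hU hx hd
      { toFun := fun z => z a b c d + z a b d c
        map_add' := fun _ _ => by simp only [Pi.add_apply]; ring
        map_smul' := fun _ _ => by simp only [Pi.smul_apply, smul_eq_mul, RingHom.id_apply]; ring }
      fun y hy => by
        have := (hT y hy).antisymm_right a b c d
        simpa using eq_neg_iff_add_eq_zero.1 this
    exact eq_neg_iff_add_eq_zero.2 this
  pair_symm a b c d := by
    have := linearMap_dir_eq_zero (X := X) hU hx hd
      { toFun := fun z => z a b c d - z c d a b
        map_add' := fun _ _ => by simp only [Pi.add_apply]; ring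
        map_smul' := fun _ _ => by simp only [Pi.smul_apply, smul_eq_mul, RingHom.id_apply]; ring }
      fun y hy => by
        have := (hT y hy).pair_symm a b c d
        simpa using sub_eq_zero.2 this
    exact sub_eq_zero.1 this
  cyclic a b c d :=
    linearMap_dir_eq_zero (X := X) hU hx hd
      { toFun := fun z => z a b c d + z a c d b + z a d b c
        map_add' := fun _ _ => by simp only [Pi.add_apply]; ring
        map_smul' := fun _ _ => by simp only [Pi.smul_apply, smul_eq_mul, RingHom.id_apply]; ring }
      fun y hy => (hT y hy).cyclic a b c d
  trace_free b d :=
    linearMap_dir_eq_zero (X := X) hU hx hd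
      { toFun := fun z => ∑ a, ∑ c, eta a c * z a b c d
        map_add' := fun _ _ => by
          simp only [Pi.add_apply, mul_add, Finset.sum_add_distrib]
        map_smul' := fun r z => by
          simp only [Pi.smul_apply, smul_eq_mul, RingHom.id_apply, Finset.mul_sum]
          exact Finset.sum_congr rfl fun _ _ => Finset.sum_congr rfl fun _ _ => by ring }
      fun y hy => (hT y hy).trace_free b d

theorem WeylSymmetries.add_mul {S T : Fin 4 → Fin 4 → Fin 4 → Fin 4 → ℝ} (hS : WeylSymmetries S)
    (hT : WeylSymmetries T) (t : ℝ) : WeylSymmetries (fun a b c d => S a b c d + t * T a b c d) where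
  antisymm_left a b c d := by
    rw [hS.antisymm_left a b c d, hT.antisymm_left a b c d]
    ring
  antisymm_right a b c d := by
    rw [hS.antisymm_right a b c d, hT.antisymm_right a b c d]
    ring
  pair_symm a b c d := by
    rw [hS.pair_symm a b c d, hT.pair_symm a b c d]
  cyclic a b c d := by linear_combination hS.cyclic a b c d + t * hT.cyclic a b c d
  trace_free b d := by
    have h : ∀ a c, eta a c * (S a b c d + t * T a b c d) =
      eta a c * S a b c d + t * (eta a c * T a b c d) := fun a c => by ring
    simp only [h, Finset.sum_add_distrib, ← Finset.mul_sum, hS.trace_free, hT.trace_free]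
    ring

end

namespace ConformalData

/-- Null frame components of the rescaled Weyl tensor. -/
def dn (u : ConformalData I M) (A B C D : Fin 4) : M → ℂ :=
  contract4 u.d (nullFrame A) (nullFrame B) (nullFrame C) (nullFrame D)

variable {u v : ConformalData I M} {x : M} {U : Set M}

theorem dn_line (t : ℝ) (A B C D : Fin 4) (x : M) :
    (u.line v t).dn A B C D x = u.dn A B C D x + t * v.dn A B C D x := by
  simp only [dn, contract4, line, Finset.mul_sum, ← Finset.sum_add_distrib]
  refine Finset.sum_congr rfl fun a _ => Finset.sum_congr rfl fun b _ =>
    Finset.sum_congr rfl fun c _ => Finset.sum_congr rfl fun d _ => ?_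
  push_cast
  ring

theorem smoothOn_dn (hd : ∀ a b c f, ContMDiffOn I 𝓘(ℝ, ℝ) ∞ (u.d a b c f) U) (A B C D : Fin 4) :
    SmoothOn I U (u.dn A B C D) := by
  change SmoothOn I U (fun y => ∑ a, ∑ b, ∑ c, ∑ f, (u.d a b c f y : ℂ) * nullFrame A a *
    nullFrame B b * nullFrame C c * nullFrame D f)
  exact SmoothOn.sum _ fun a _ => SmoothOn.sum _ fun b _ => SmoothOn.sum _ fun c _ =>
    SmoothOn.sum _ fun f _ =>
    ((((SmoothOn.ofReal (hd a b c f)).mul (.const _)).mul (.const _)).mul (.const _)).mul (.const _)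

/-- Presents the derivative of a null component as a contraction of real frame derivatives, the form
in which `arrayDiv_components` expects it. -/
theorem nd_dn (hd : ∀ a b c f, MDifferentiableAt I 𝓘(ℝ, ℝ) (u.d a b c f) x) (A B C D E : Fin 4) :
    u.nd A (u.dn B C D E) x =
      ∑ a, nullFrame A a * arrayT (fun b c d f => dir (u.e a) (u.d b c d f) x) B C D E := by
  have h1 : ∀ b c d f, MDifferentiableAt I 𝓘(ℝ, ℂ) (fun y => (u.d b c d f y : ℂ)) x :=
    fun b c d f => (Complex.ofRealCLM.differentiableAt).comp_mdifferentiableAt (hd b c d f)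
  have h2 : ∀ z : Fin 4 × Fin 4 × Fin 4 × Fin 4, MDifferentiableAt I 𝓘(ℝ, ℂ) (fun y =>
      nullFrame B z.1 * nullFrame C z.2.1 * nullFrame D z.2.2.1 * nullFrame E z.2.2.2 *
      (u.d z.1 z.2.1 z.2.2.1 z.2.2.2 y : ℂ)) x := fun z => mdifferentiableAt_const.mul (h1 _ _ _ _)
  have h3 : u.dn B C D E = fun y => ∑ z : Fin 4 × Fin 4 × Fin 4 × Fin 4,
      nullFrame B z.1 * nullFrame C z.2.1 * nullFrame D z.2.2.1 * nullFrame E z.2.2.2 *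
      (u.d z.1 z.2.1 z.2.2.1 z.2.2.2 y : ℂ) := by
    funext y
    simp only [dn, contract4, Fintype.sum_prod_type]
    refine Finset.sum_congr rfl fun b _ => Finset.sum_congr rfl fun c _ =>
      Finset.sum_congr rfl fun d _ => Finset.sum_congr rfl fun f _ => ?_
    ring
  rw [h3, TetradData.nd_sum A _ fun z _ => h2 z,
    Finset.sum_congr rfl fun z _ => TetradData.nd_const_mul A _ (h1 _ _ _ _)]
  simp only [TetradData.nd, TetradData.along, dir_ofReal (hd _ _ _ _), Finset.mul_sum, arrayT]
  rw [Finset.sum_comm]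
  simp only [Fintype.sum_prod_type]
  refine Finset.sum_congr rfl fun a _ => Finset.sum_congr rfl fun b _ =>
    Finset.sum_congr rfl fun c _ => Finset.sum_congr rfl fun d _ => Finset.sum_congr rfl fun f _ => ?_
  ring

/-- The Bianchi equation `∇^f d_{fabc} = 0` in the Newman-Penrose formalism. -/
theorem zeroD_components [IsManifold I ∞ M] (hU : IsOpen U) (hx : x ∈ U)
    (hm : ∀ a b c, u.metricDefect a b c x = 0)
    (hd : ∀ a b c f, ContMDiffOn I 𝓘(ℝ, ℝ) ∞ (u.d a b c f) U)
    (hW : ∀ y ∈ U, WeylSymmetries (fun a b c f => u.d a b c f y))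
    (P : Fin 4 → Fin 4) (hP : P = id ∨ P = primeIdx) :
    -arrayG (fun a b c => u.zeroD a b c x) (P 0) (P 0) (P 2) =
      u.nd (P 3) (u.dn (P 0) (P 2) (P 0) (P 2)) x - u.nd (P 0) (u.dn (P 0) (P 1) (P 0) (P 2)) x
      + (u.G (P 0) (P 1) (P 3) x + 2 * (u.G (P 3) (P 0) (P 1) x - u.G (P 3) (P 2) (P 3) x))
        * u.dn (P 0) (P 2) (P 0) (P 2) x
      + (-4 * u.G (P 3) (P 0) (P 2) x - (u.G (P 0) (P 0) (P 1) x - u.G (P 0) (P 2) (P 3) x))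
        * u.dn (P 0) (P 1) (P 0) (P 2) x
      + 3 * u.G (P 0) (P 0) (P 2) x * u.dn (P 0) (P 2) (P 3) (P 1) x ∧
    -arrayG (fun a b c => u.zeroD a b c x) (P 2) (P 0) (P 2) =
      u.nd (P 1) (u.dn (P 0) (P 2) (P 0) (P 2)) x - u.nd (P 2) (u.dn (P 0) (P 1) (P 0) (P 2)) x
      + (u.G (P 2) (P 1) (P 3) x + 2 * (u.G (P 1) (P 0) (P 1) x - u.G (P 1) (P 2) (P 3) x))
        * u.dn (P 0) (P 2) (P 0) (P 2) x
      + (-4 * u.G (P 1) (P 0) (P 2) x - (u.G (P 2) (P 0) (P 1) x - u.G (P 2) (P 2) (P 3) x))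
        * u.dn (P 0) (P 1) (P 0) (P 2) x
      + 3 * u.G (P 2) (P 0) (P 2) x * u.dn (P 0) (P 2) (P 3) (P 1) x ∧
    -arrayG (fun a b c => u.zeroD a b c x) (P 3) (P 2) (P 0) =
      u.nd (P 0) (u.dn (P 0) (P 2) (P 3) (P 1)) x - u.nd (P 3) (u.dn (P 0) (P 1) (P 0) (P 2)) x
      + u.G (P 3) (P 1) (P 3) x * u.dn (P 0) (P 2) (P 0) (P 2) x
      - (2 * u.G (P 0) (P 1) (P 3) x + (u.G (P 3) (P 0) (P 1) x - u.G (P 3) (P 2) (P 3) x))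
        * u.dn (P 0) (P 1) (P 0) (P 2) x
      + 3 * u.G (P 3) (P 0) (P 2) x * u.dn (P 0) (P 2) (P 3) (P 1) x
      - 2 * u.G (P 0) (P 0) (P 2) x * u.dn (P 1) (P 0) (P 1) (P 3) x ∧
    -arrayG (fun a b c => u.zeroD a b c x) (P 1) (P 0) (P 2) =
      u.nd (P 1) (u.dn (P 0) (P 1) (P 0) (P 2)) x - u.nd (P 2) (u.dn (P 0) (P 2) (P 3) (P 1)) x
      - u.G (P 1) (P 1) (P 3) x * u.dn (P 0) (P 2) (P 0) (P 2) x
      + (2 * u.G (P 2) (P 1) (P 3) x + (u.G (P 1) (P 0) (P 1) x - u.G (P 1) (P 2) (P 3) x))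
        * u.dn (P 0) (P 1) (P 0) (P 2) x
      - 3 * u.G (P 1) (P 0) (P 2) x * u.dn (P 0) (P 2) (P 3) (P 1) x
      + 2 * u.G (P 2) (P 0) (P 2) x * u.dn (P 1) (P 0) (P 1) (P 3) x := by
  -- At a point only numbers are involved, and the arrays of derivatives are of Weyl type
  -- themselves, so the algebraic identity applies.
  have h := arrayDiv_components (g := fun a b c => u.Γ a b c x)
    (T' := fun a b c d f => dir (u.e a) (u.d b c d f) x) (T := fun a b c f => u.d a b c f x)
    hm (hW x hx) (fun a => WeylSymmetries.dir hU hx hd hW) P hP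
  simp only [nd_dn fun a b c f => mdifferentiableAt_of_contMDiffOn hU (hd a b c f) hx]
  exact h

end ConformalData

/-! ### Petrov type D -/

set_option linter.unusedSimpArgs false in
/-- Null frame components of a Weyl tensor of type D whose principal null directions are `ℓ`
and `k`. -/
theorem arrayT_of_typeD {T : Fin 4 → Fin 4 → Fin 4 → Fin 4 → ℝ} (hT : WeylSymmetries T)
    (hl : IsRepeatedPND T ![1, 0, 0, 0]) (hk : IsRepeatedPND T ![0, 1, 0, 0])
    (hne : ∃ a b c f, T a b c f ≠ 0) (P : Fin 4 → Fin 4) (hP : P = id ∨ P = primeIdx) :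
    arrayT T (P 0) (P 2) (P 0) (P 2) = 0 ∧ arrayT T (P 0) (P 1) (P 0) (P 2) = 0 ∧
    arrayT T (P 1) (P 0) (P 1) (P 3) = 0 ∧ arrayT T (P 0) (P 2) (P 3) (P 1) ≠ 0 ∧
    arrayT T (P 1) (P 0) (P 0) (P 2) = 0 ∧ arrayT T (P 3) (P 2) (P 0) (P 2) = 0 := by
  have r := hT.components
  -- Lowering ℓ leaves only the component of index 1, so f = 1 with d = 2 or 3 isolates T_{a00d} =
  -- 0. For k the roles of 0 and 1 are exchanged.
  have a1 := hl 2 2 1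
  have a2 := hl 2 3 1
  have a3 := hl 1 2 1
  have a4 := hl 1 3 1
  have b1 := hk 2 2 0
  have b2 := hk 2 3 0
  have b3 := hk 0 2 0
  have b4 := hk 0 3 0
  simp [Fin.sum_univ_four, eta, r] at a1 a2 a3 a4 b1 b2 b3 b4
  have hs := sqrtTwo_inv_sq
  have hi := Complex.I_mul_I
  have h2 : arrayT T (P 0) (P 2) (P 3) (P 1) = -(T 0 2 1 2 : ℂ) + Complex.I * T 0 2 1 3 := by
    rcases hP with rfl | rfl
    all_goals
      simp only [arrayT, nullFrame_eq]
      generalize (1 / (Real.sqrt 2 : ℂ)) = s at *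
      generalize Complex.I = i at *
      simp [primeIdx, Fin.sum_univ_four, r]
    · linear_combination (-T 0 2 1 2 + i * i * T 0 2 1 2 + 2 * i * T 0 2 1 3) * hs + T 0 2 1 2 / 2 * hi
    · linear_combination (-T 0 2 1 2 + i * i * T 0 2 1 2 + 2 * i * T 0 2 1 3) * hs + T 0 2 1 2 / 2 * hi
  refine ⟨?_, ?_, ?_, ?_, ?_, ?_⟩
  · rcases hP with rfl | rfl <;>
    simp [arrayT, nullFrame_eq, primeIdx, Fin.sum_univ_four, r, a1, a2, a3, a4, b1, b2, b3, b4]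
  · rcases hP with rfl | rfl <;>
    simp [arrayT, nullFrame_eq, primeIdx, Fin.sum_univ_four, r, a1, a2, a3, a4, b1, b2, b3, b4]
  · rcases hP with rfl | rfl <;>
    simp [arrayT, nullFrame_eq, primeIdx, Fin.sum_univ_four, r, a1, a2, a3, a4, b1, b2, b3, b4]
  · rw [h2]
    -- The surviving components are all determined by T₀₂₁₂ and T₀₂₁₃, which are minus the real part
    -- and the imaginary part of φ₂. If φ₂ were zero, T would vanish.
    intro h
    have h3 := congrArg Complex.re h
    have h4 := congrArg Complex.im h
    simp at h3 h4
    obtain ⟨a, b, c, f, hn⟩ := hne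
    apply hn
    fin_cases a <;> fin_cases b <;> fin_cases c <;> fin_cases f <;>
      simp [r, a1, a2, a3, a4, b1, b2, b3, b4, h3, h4]
  · rcases hP with rfl | rfl <;>
    simp [arrayT, nullFrame_eq, primeIdx, Fin.sum_univ_four, r, a1, a2, a3, a4, b1, b2, b3, b4]
  · rcases hP with rfl | rfl <;>
    simp [arrayT, nullFrame_eq, primeIdx, Fin.sum_univ_four, r, a1, a2, a3, a4, b1, b2, b3, b4]

section

variable [IsManifold I ∞ M] {U : Set M} {u v : ConformalData I M} {x : M}

/-- Vanishing components of the rescaled Weyl tensor in type D. -/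
theorem IsSolutionOn.dn_typeD (hu : IsSolutionOn U u) (hD : IsAlignedTypeDOn U u) (hx : x ∈ U)
    (P : Fin 4 → Fin 4) (hP : P = id ∨ P = primeIdx) :
    u.dn (P 0) (P 2) (P 0) (P 2) x = 0 ∧ u.dn (P 0) (P 1) (P 0) (P 2) x = 0 ∧
    u.dn (P 1) (P 0) (P 1) (P 3) x = 0 ∧ u.dn (P 0) (P 2) (P 3) (P 1) x ≠ 0 ∧
    u.dn (P 1) (P 0) (P 0) (P 2) x = 0 ∧ u.dn (P 3) (P 2) (P 0) (P 2) x = 0 :=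
  arrayT_of_typeD (hu.weylSymm x hx) (hD x hx).2.1 (hD x hx).2.2 (hD x hx).1 P hP

/-- Consequences of the Bianchi equations in type D: `κ = σ = 0`, `D φ₂ = 3 ρ φ₂`,
`δ φ₂ = 3 τ φ₂`, and the images under the exchange of `ℓ` and `k`. -/
theorem IsSolutionOn.bianchi_typeD (hU : IsOpen U) (hu : IsSolutionOn U u)
    (hD : IsAlignedTypeDOn U u) (hx : x ∈ U) (P : Fin 4 → Fin 4) (hP : P = id ∨ P = primeIdx) :
    u.G (P 0) (P 0) (P 2) x = 0 ∧ u.G (P 2) (P 0) (P 2) x = 0 ∧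
    u.nd (P 0) (u.dn (P 0) (P 2) (P 3) (P 1)) x =
      -3 * u.G (P 3) (P 0) (P 2) x * u.dn (P 0) (P 2) (P 3) (P 1) x ∧
    u.nd (P 2) (u.dn (P 0) (P 2) (P 3) (P 1)) x =
      -3 * u.G (P 1) (P 0) (P 2) x * u.dn (P 0) (P 2) (P 3) (P 1) x := by
  obtain ⟨h1, h2, h3, h4⟩ := ConformalData.zeroD_components hU hx (hu.leviCivita.metric x hx)
    hu.smooth_d hu.weylSymm P hP
  obtain ⟨d0, d1, d3, d2, -, -⟩ := hu.dn_typeD hD hx P hP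
  have n0 := fun A => TetradData.nd_zero_of_eqOn (u := u.toTetradData) A hU hx
    fun y hy => (hu.dn_typeD hD hy P hP).1
  have n1 := fun A => TetradData.nd_zero_of_eqOn (u := u.toTetradData) A hU hx
    fun y hy => (hu.dn_typeD hD hy P hP).2.1
  have z : ∀ A B C, arrayG (fun a b c => u.zeroD a b c x) A B C = 0 := fun A B C => by
    simp [arrayG, hu.eqD x hx]
  simp only [z, d0, d1, n0, n1] at h1 h2 h3 h4
  refine ⟨?_, ?_, ?_, ?_⟩
  -- With φ₀ = φ₁ = 0 in a neighbourhood, this Bianchi equation is a multiple of κφ₂ = 0: the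
  -- Goldberg–Sachs argument, valid also where Ξ = 0.
  · have : u.G (P 0) (P 0) (P 2) x * u.dn (P 0) (P 2) (P 3) (P 1) x = 0 := by
      linear_combination -h1 / 3
    exact (mul_eq_zero.1 this).resolve_right d2
  · have : u.G (P 2) (P 0) (P 2) x * u.dn (P 0) (P 2) (P 3) (P 1) x = 0 := by
      linear_combination -h2 / 3
    exact (mul_eq_zero.1 this).resolve_right d2
  · rw [d3] at h3
    linear_combination -h3
  · rw [d3] at h4
    linear_combination h4

/-- The linearised Bianchi equations in type D. -/
theorem IsLinearisedSolutionOn.bianchi_typeD (hU : IsOpen U) (hu : IsSolutionOn U u)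
    (hD : IsAlignedTypeDOn U u) (hv : IsLinearisedSolutionOn U u v) (hx : x ∈ U)
    (P : Fin 4 → Fin 4) (hP : P = id ∨ P = primeIdx) :
    u.nd (P 3) (v.dn (P 0) (P 2) (P 0) (P 2)) x - u.nd (P 0) (v.dn (P 0) (P 1) (P 0) (P 2)) x
      + (u.G (P 0) (P 1) (P 3) x + 2 * (u.G (P 3) (P 0) (P 1) x - u.G (P 3) (P 2) (P 3) x))
        * v.dn (P 0) (P 2) (P 0) (P 2) x
      + (-4 * u.G (P 3) (P 0) (P 2) x - (u.G (P 0) (P 0) (P 1) x - u.G (P 0) (P 2) (P 3) x))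
        * v.dn (P 0) (P 1) (P 0) (P 2) x
      + 3 * v.G (P 0) (P 0) (P 2) x * u.dn (P 0) (P 2) (P 3) (P 1) x = 0 ∧
    u.nd (P 1) (v.dn (P 0) (P 2) (P 0) (P 2)) x - u.nd (P 2) (v.dn (P 0) (P 1) (P 0) (P 2)) x
      + (u.G (P 2) (P 1) (P 3) x + 2 * (u.G (P 1) (P 0) (P 1) x - u.G (P 1) (P 2) (P 3) x))
        * v.dn (P 0) (P 2) (P 0) (P 2) x
      + (-4 * u.G (P 1) (P 0) (P 2) x - (u.G (P 2) (P 0) (P 1) x - u.G (P 2) (P 2) (P 3) x))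
        * v.dn (P 0) (P 1) (P 0) (P 2) x
      + 3 * v.G (P 2) (P 0) (P 2) x * u.dn (P 0) (P 2) (P 3) (P 1) x = 0 := by
  -- The expansion of the divergence needs only metric compatibility and the Weyl symmetries. Both
  -- are linear, so they hold exactly along `u + t v`, whereas the field equation is only known to
  -- first order.
  have ht : ∀ t : ℝ, _ := fun t => ConformalData.zeroD_components (u := u.line v t) hU hx
    (fun a b c => by
      have h1 := hu.leviCivita.metric x hx a b c
      have h2 := hv.leviCivita.metricDefect_eq_zero hx a b c
      simp only [TetradData.metricDefect, ConformalData.line, TetradData.line] at h1 h2 ⊢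
      linear_combination h1 + t * h2)
    (fun a b c f => (hu.smooth_d a b c f).add (contMDiffOn_const.mul (hv.smooth_d a b c f)))
    (fun y hy => (hu.weylSymm y hy).add_mul (hv.weylSymm y hy) t) P hP
  obtain ⟨d0, d1, d3, d2, -, -⟩ := hu.dn_typeD hD hx P hP
  obtain ⟨k0, s0, -, -⟩ := hu.bianchi_typeD hU hD hx P hP
  have nt : ∀ (t : ℝ) A B C D E, (u.line v t).nd A ((u.line v t).dn B C D E) x =
      u.nd A (u.dn B C D E) x + t * (u.nd A (v.dn B C D E) x + v.nd A (u.dn B C D E) x)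
        + t ^ 2 * v.nd A (v.dn B C D E) x := by
    intro t A B C D E
    rw [show (u.line v t).dn B C D E = fun y => u.dn B C D E y + t * v.dn B C D E y from
      funext fun y => ConformalData.dn_line t B C D E y]
    exact TetradData.nd_line_line t A
      (mdifferentiableAt_of_contMDiffOn hU (ConformalData.smoothOn_dn hu.smooth_d B C D E) hx)
      (mdifferentiableAt_of_contMDiffOn hU (ConformalData.smoothOn_dn hv.smooth_d B C D E) hx)
  have Gt : ∀ (t : ℝ) A B C, (u.line v t).G A B C x = u.G A B C x + t * v.G A B C x :=
    fun t A B C => TetradData.G_line t A B C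
  have m0 := fun A => TetradData.nd_zero_of_eqOn (u := v.toTetradData) A hU hx
    fun y hy => (hu.dn_typeD hD hy P hP).1
  have m1 := fun A => TetradData.nd_zero_of_eqOn (u := v.toTetradData) A hU hx
    fun y hy => (hu.dn_typeD hD hy P hP).2.1
  have hz : ∀ A B C, HasDerivAt (fun t : ℝ =>
      -arrayG (fun a b c => (u.line v t).zeroD a b c x) A B C) 0 0 := by
    intro A B C
    have : HasDerivAt (fun t : ℝ => -arrayG (fun a b c => (u.line v t).zeroD a b c x) A B C)
        (-∑ a, ∑ b, ∑ c, ((0 : ℝ) : ℂ) * nullFrame A a * nullFrame B b * nullFrame C c) 0 := by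
      refine HasDerivAt.neg (HasDerivAt.fun_sum fun a _ => HasDerivAt.fun_sum fun b _ =>
        HasDerivAt.fun_sum fun c _ => ?_)
      exact (((hv.eqD x hx a b c).ofReal_comp.mul_const _).mul_const _).mul_const _
    simpa using this
  have n0 := fun A => TetradData.nd_zero_of_eqOn (u := u.toTetradData) A hU hx
    fun y hy => (hu.dn_typeD hD hy P hP).1
  have n1 := fun A => TetradData.nd_zero_of_eqOn (u := u.toTetradData) A hU hx
    fun y hy => (hu.dn_typeD hD hy P hP).2.1
  -- As φ₀, φ₁, κ and σ vanish on the background, no constant term remains, and the only perturbed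
  -- connection coefficient left in the coefficient of t is κ' in the first equation and σ' in the
  -- second.
  simp only [nt, Gt, ConformalData.dn_line, d0, d1, k0, s0, m0, m1, n0, n1] at ht
  constructor
  · refine coeff_eq_of_hasDerivAt (hz (P 0) (P 0) (P 2)) (c₀ := 0) (c₂ :=
      v.nd (P 3) (v.dn (P 0) (P 2) (P 0) (P 2)) x - v.nd (P 0) (v.dn (P 0) (P 1) (P 0) (P 2)) x
      + (v.G (P 0) (P 1) (P 3) x + 2 * (v.G (P 3) (P 0) (P 1) x - v.G (P 3) (P 2) (P 3) x))
        * v.dn (P 0) (P 2) (P 0) (P 2) x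
      + (-4 * v.G (P 3) (P 0) (P 2) x - (v.G (P 0) (P 0) (P 1) x - v.G (P 0) (P 2) (P 3) x))
        * v.dn (P 0) (P 1) (P 0) (P 2) x
      + 3 * v.G (P 0) (P 0) (P 2) x * v.dn (P 0) (P 2) (P 3) (P 1) x) fun t => ?_
    rw [(ht t).1]
    ring
  · refine coeff_eq_of_hasDerivAt (hz (P 2) (P 0) (P 2)) (c₀ := 0) (c₂ :=
      v.nd (P 1) (v.dn (P 0) (P 2) (P 0) (P 2)) x - v.nd (P 2) (v.dn (P 0) (P 1) (P 0) (P 2)) x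
      + (v.G (P 2) (P 1) (P 3) x + 2 * (v.G (P 1) (P 0) (P 1) x - v.G (P 1) (P 2) (P 3) x))
        * v.dn (P 0) (P 2) (P 0) (P 2) x
      + (-4 * v.G (P 1) (P 0) (P 2) x - (v.G (P 2) (P 0) (P 1) x - v.G (P 2) (P 2) (P 3) x))
        * v.dn (P 0) (P 1) (P 0) (P 2) x
      + 3 * v.G (P 2) (P 0) (P 2) x * v.dn (P 0) (P 2) (P 3) (P 1) x) fun t => ?_
    rw [(ht t).2.1]
    ring

end

/-! ### The Ricci equations -/

namespace TetradData

variable {u v : TetradData I M} {x : M}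

theorem G_rules (h : ∀ a b c, u.metricDefect a b c x = 0) :
    (∀ A B, u.G A B B x = 0) ∧ (∀ A, u.G A 1 0 x = -u.G A 0 1 x) ∧
    (∀ A, u.G A 2 0 x = -u.G A 0 2 x) ∧ (∀ A, u.G A 3 0 x = -u.G A 0 3 x) ∧
    (∀ A, u.G A 2 1 x = -u.G A 1 2 x) ∧ (∀ A, u.G A 3 1 x = -u.G A 1 3 x) ∧
    (∀ A, u.G A 3 2 x = -u.G A 2 3 x) :=
  ⟨fun A B => by linear_combination G_antisymm h A B B / 2, fun A => G_antisymm h A _ _,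
    fun A => G_antisymm h A _ _, fun A => G_antisymm h A _ _, fun A => G_antisymm h A _ _,
    fun A => G_antisymm h A _ _, fun A => G_antisymm h A _ _⟩

theorem hasDerivAt_riemC (hu : ∀ a b c, MDifferentiableAt I 𝓘(ℝ, ℝ) (u.Γ a b c) x)
    (hv : ∀ a b c, MDifferentiableAt I 𝓘(ℝ, ℝ) (v.Γ a b c) x)
    (hu' : ∀ A B C, MDifferentiableAt I 𝓘(ℝ, ℂ) (u.G A B C) x)
    (hv' : ∀ A B C, MDifferentiableAt I 𝓘(ℝ, ℂ) (v.G A B C) x) (A B C D : Fin 4) :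
    HasDerivAt (fun t : ℝ => (u.line v t).riemC A B C D x)
      (u.nd C (v.G D B A) x + v.nd C (u.G D B A) x - u.nd D (v.G C B A) x - v.nd D (u.G C B A) x
      + contr (fun F => u.G D B F x) (fun F => v.G C F A x)
      + contr (fun F => v.G D B F x) (fun F => u.G C F A x)
      - contr (fun F => u.G C B F x) (fun F => v.G D F A x)
      - contr (fun F => v.G C B F x) (fun F => u.G D F A x)
      - contr (fun F => u.S C D F x) (fun F => v.G F B A x)
      - contr (fun F => v.S C D F x) (fun F => u.G F B A x)) 0 := by
  -- Curvature is homogeneous of degree two in frame and connection together, so the coefficient of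
  -- t² is the same expression evaluated on the perturbation.
  refine hasDerivAt_quadratic (c₀ := u.riemC A B C D x) (c₂ := v.riemC A B C D x) fun t => ?_
  have hl : ∀ a b c, MDifferentiableAt I 𝓘(ℝ, ℝ) ((u.line v t).Γ a b c) x := fun a b c =>
    (hu a b c).add (mdifferentiableAt_const.mul (hv a b c))
  have hn : ∀ A B C D, (u.line v t).nd A ((u.line v t).G B C D) x = u.nd A (u.G B C D) x
      + t * (u.nd A (v.G B C D) x + v.nd A (u.G B C D) x) + t ^ 2 * v.nd A (v.G B C D) x := by
    intro A B C D
    rw [show (u.line v t).G B C D = fun y => u.G B C D y + t * v.G B C D y from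
      funext fun y => G_line t B C D]
    exact nd_line_line t A (hu' B C D) (hv' B C D)
  rw [riemC_eq hl, riemC_eq hu, riemC_eq hv, hn, hn]
  simp only [contr, S, G_line]
  ring

section Aligned

variable {U : Set M} [IsManifold I ∞ M]

/-- The linearised Ricci equation for `σ` and `κ` at a background with `σ = κ = 0`. -/
theorem hasDerivAt_riemC_aligned (hU : IsOpen U) (hx : x ∈ U)
    (hu : ∀ a b c, ContMDiffOn I 𝓘(ℝ, ℝ) ∞ (u.Γ a b c) U)
    (hv : ∀ a b c, ContMDiffOn I 𝓘(ℝ, ℝ) ∞ (v.Γ a b c) U)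
    (mu : ∀ y ∈ U, ∀ a b c, u.metricDefect a b c y = 0)
    (mv : ∀ y ∈ U, ∀ a b c, v.metricDefect a b c y = 0)
    (P : Fin 4 → Fin 4) (hP : P = id ∨ P = primeIdx)
    (hκ : ∀ y ∈ U, u.G (P 0) (P 0) (P 2) y = 0) (hσ : ∀ y ∈ U, u.G (P 2) (P 0) (P 2) y = 0) :
    HasDerivAt (fun t : ℝ => (u.line v t).riemC (P 0) (P 2) (P 0) (P 2) x)
      (-u.nd (P 0) (v.G (P 2) (P 0) (P 2)) x + u.nd (P 2) (v.G (P 0) (P 0) (P 2)) x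
      - (u.G (P 3) (P 0) (P 2) x + u.G (P 2) (P 0) (P 3) x + u.G (P 0) (P 0) (P 1) x
        - 2 * u.G (P 0) (P 2) (P 3) x) * v.G (P 2) (P 0) (P 2) x
      + (u.G (P 1) (P 0) (P 2) x + u.G (P 0) (P 1) (P 2) x + 2 * u.G (P 2) (P 0) (P 1) x
        - u.G (P 2) (P 2) (P 3) x) * v.G (P 0) (P 0) (P 2) x) 0 := by
  have hu' : ∀ A B C, MDifferentiableAt I 𝓘(ℝ, ℂ) (u.G A B C) x := fun A B C =>
    mdifferentiableAt_of_contMDiffOn hU (smoothOn_G hu A B C) hx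
  have hv' : ∀ A B C, MDifferentiableAt I 𝓘(ℝ, ℂ) (v.G A B C) x := fun A B C =>
    mdifferentiableAt_of_contMDiffOn hU (smoothOn_G hv A B C) hx
  have h := hasDerivAt_riemC (fun a b c => mdifferentiableAt_of_contMDiffOn hU (hu a b c) hx)
    (fun a b c => mdifferentiableAt_of_contMDiffOn hU (hv a b c) hx) hu' hv'
    (P 0) (P 2) (P 0) (P 2)
  -- The background κ and σ vanish on all of U, so their derivatives along the perturbed frame
  -- vanish as well. Together with κ = σ = 0 in the products this leaves κ' and σ' as the only
  -- perturbed coefficients.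
  have n1 : v.nd (P 0) (u.G (P 2) (P 2) (P 0)) x = 0 := nd_zero_of_eqOn _ hU hx fun y hy => by
    rw [G_antisymm (mu y hy), hσ y hy, neg_zero]
  have n2 : v.nd (P 2) (u.G (P 0) (P 2) (P 0)) x = 0 := nd_zero_of_eqOn _ hU hx fun y hy => by
    rw [G_antisymm (mu y hy), hκ y hy, neg_zero]
  have n3 : ∀ A B, u.nd A (v.G B (P 2) (P 0)) x = -u.nd A (v.G B (P 0) (P 2)) x := fun A B => by
    rw [nd_congr A hU hx fun y hy => G_antisymm (mv y hy) B (P 2) (P 0), nd_neg A (hv' _ _ _)]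
  rw [n1, n2, n3, n3] at h
  convert h using 1
  have k := hκ x hx
  have s := hσ x hx
  have ru := G_rules (mu x hx)
  have rv := G_rules (mv x hx)
  clear h n1 n2 n3 hκ hσ mu mv hu hv hu' hv'
  rcases hP with rfl | rfl <;> simp [primeIdx, contr, S] at k s ⊢
  · simp only [ru, rv, k, s]
    ring
  · simp only [ru, rv, k, s]
    ring

/-- The difference of two curvature components which determines `D β - δ ε`. -/
theorem riemC_sub_riemC_aligned (hU : IsOpen U) (hx : x ∈ U) (hu : IsLeviCivitaOn U u)
    (P : Fin 4 → Fin 4) (hP : P = id ∨ P = primeIdx)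
    (hκ : u.G (P 0) (P 0) (P 2) x = 0) (hσ : u.G (P 2) (P 0) (P 2) x = 0) :
    u.riemC (P 1) (P 0) (P 0) (P 2) x - u.riemC (P 3) (P 2) (P 0) (P 2) x =
      u.nd (P 0) (u.G (P 2) (P 0) (P 1)) x - u.nd (P 0) (u.G (P 2) (P 2) (P 3)) x
      - (u.nd (P 2) (u.G (P 0) (P 0) (P 1)) x - u.nd (P 2) (u.G (P 0) (P 2) (P 3)) x)
      + (u.G (P 2) (P 0) (P 3) x - (u.G (P 0) (P 0) (P 1) x + u.G (P 0) (P 2) (P 3) x) / 2)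
        * (u.G (P 2) (P 0) (P 1) x - u.G (P 2) (P 2) (P 3) x)
      - ((u.G (P 2) (P 0) (P 1) x + u.G (P 2) (P 2) (P 3) x) / 2 + u.G (P 0) (P 1) (P 2) x)
        * (u.G (P 0) (P 0) (P 1) x - u.G (P 0) (P 2) (P 3) x) := by
  have hΓ : ∀ a b c, MDifferentiableAt I 𝓘(ℝ, ℝ) (u.Γ a b c) x := fun a b c =>
    mdifferentiableAt_of_contMDiffOn hU (hu.smooth_Γ a b c) hx
  rw [riemC_eq hΓ, riemC_eq hΓ]
  have ru := G_rules (hu.metric x hx)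
  clear hΓ hu
  rcases hP with rfl | rfl <;> simp [primeIdx, contr, S] at hκ hσ ⊢
  · simp only [ru, hκ, hσ]
    ring
  · simp only [ru, hκ, hσ]
    ring

/-- The commutator of `D` and `δ` where `κ = σ = 0`. -/
theorem nd_comm_aligned (hU : IsOpen U) (hx : x ∈ U) (hu : IsLeviCivitaOn U u)
    (P : Fin 4 → Fin 4) (hP : P = id ∨ P = primeIdx)
    (hκ : u.G (P 0) (P 0) (P 2) x = 0) (hσ : u.G (P 2) (P 0) (P 2) x = 0)
    {f : M → ℂ} (hf : SmoothOn I U f) :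
    u.nd (P 0) (u.nd (P 2) f) x - u.nd (P 2) (u.nd (P 0) f) x =
      (u.G (P 0) (P 1) (P 2) x + u.G (P 2) (P 0) (P 1) x) * u.nd (P 0) f x
      + (u.G (P 0) (P 2) (P 3) x - u.G (P 2) (P 0) (P 3) x) * u.nd (P 2) f x := by
  rw [nd_comm hU hu hx hf]
  have ru := G_rules (hu.metric x hx)
  rcases hP with rfl | rfl <;> simp [primeIdx, contr, S] at hκ hσ ⊢
  · simp only [ru, hκ, hσ]
    ring
  · simp only [ru, hκ, hσ]
    ring

end Aligned

end TetradData

/-! ### The decoupled equations -/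

/-- The two vectors span a totally null plane, so every metric factor multiplying the Schouten
tensor vanishes. -/
theorem TetradData.weylC_eq_riemC (p : TetradData I M) (x : M) (P : Fin 4 → Fin 4)
    (hP : P = id ∨ P = primeIdx) :
    p.weylC (P 0) (P 2) (P 0) (P 2) x = p.riemC (P 0) (P 2) (P 0) (P 2) x := by
  rw [TetradData.weylC_eq]
  rcases hP with rfl | rfl <;> simp [primeIdx, etaC]

section

variable [IsManifold I ∞ M] {U : Set M} {u v : ConformalData I M} {x : M}

theorem IsSolutionOn.weylC_eq (hu : IsSolutionOn U u) (hx : x ∈ U) (A B C D : Fin 4) :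
    u.weylC A B C D x = u.Ξ x * u.dn A B C D x := by
  simp only [TetradData.weylC, ConformalData.dn, contract4, Finset.mul_sum]
  refine Finset.sum_congr rfl fun a _ => Finset.sum_congr rfl fun b _ =>
    Finset.sum_congr rfl fun c _ => Finset.sum_congr rfl fun d _ => ?_
  have h := hu.eqWeyl x hx a b c d
  rw [ConformalData.zeroWeyl, sub_eq_zero] at h
  rw [← h]
  push_cast
  ring

/-- Product rule for Ξd. The term with Ξ' multiplies a background component, so it disappears for
the extreme components in type D. -/
theorem IsLinearisedSolutionOn.hasDerivAt_weylC (hv : IsLinearisedSolutionOn U u v) (hx : x ∈ U)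
    (A B C D : Fin 4) : HasDerivAt (fun t : ℝ => (u.toTetradData.line v.toTetradData t).weylC A B C D x)
      (u.Ξ x * v.dn A B C D x + v.Ξ x * u.dn A B C D x) 0 := by
  have h1 : HasDerivAt (fun t : ℝ => ∑ a, ∑ b, ∑ c, ∑ d,
      (((u.line v t).zeroWeyl a b c d x : ℝ) : ℂ) * nullFrame A a * nullFrame B b * nullFrame C c *
        nullFrame D d) (∑ a : Fin 4, ∑ b : Fin 4, ∑ c : Fin 4, ∑ d : Fin 4,
      ((0 : ℝ) : ℂ) * nullFrame A a * nullFrame B b * nullFrame C c * nullFrame D d) 0 := by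
    refine HasDerivAt.fun_sum fun a _ => HasDerivAt.fun_sum fun b _ =>
      HasDerivAt.fun_sum fun c _ => HasDerivAt.fun_sum fun d _ => ?_
    exact ((((hv.eqWeyl x hx a b c d).ofReal_comp.mul_const _).mul_const _).mul_const _).mul_const _
  have h2 : HasDerivAt (fun t : ℝ => ((u.Ξ x : ℂ) + t * v.Ξ x) *
      (u.dn A B C D x + t * v.dn A B C D x))
      (u.Ξ x * v.dn A B C D x + v.Ξ x * u.dn A B C D x) 0 :=
    hasDerivAt_quadratic (c₀ := u.Ξ x * u.dn A B C D x) (c₂ := v.Ξ x * v.dn A B C D x)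
      fun t => by ring
  refine HasDerivAt.congr_deriv (HasDerivAt.congr_of_eventuallyEq (h2.sub h1)
    (Eventually.of_forall fun t => ?_)) (f' := _) ?_
  · simp only [Pi.sub_apply]
    rw [← ConformalData.dn_line]
    simp only [ConformalData.dn, TetradData.weylC, contract4, Finset.mul_sum,
      ← Finset.sum_sub_distrib]
    refine Finset.sum_congr rfl fun a _ => Finset.sum_congr rfl fun b _ =>
      Finset.sum_congr rfl fun c _ => Finset.sum_congr rfl fun d _ => ?_
    simp only [ConformalData.zeroWeyl, ConformalData.line]
    push_cast
    ring
  · simp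

/-- `D β - δ ε` in type D. -/
theorem IsSolutionOn.nd_sub_nd_typeD (hU : IsOpen U) (hu : IsSolutionOn U u)
    (hD : IsAlignedTypeDOn U u) (hx : x ∈ U) (P : Fin 4 → Fin 4) (hP : P = id ∨ P = primeIdx) :
    u.nd (P 0) (u.G (P 2) (P 0) (P 1)) x - u.nd (P 0) (u.G (P 2) (P 2) (P 3)) x
      - (u.nd (P 2) (u.G (P 0) (P 0) (P 1)) x - u.nd (P 2) (u.G (P 0) (P 2) (P 3)) x)
      + (u.G (P 2) (P 0) (P 3) x - (u.G (P 0) (P 0) (P 1) x + u.G (P 0) (P 2) (P 3) x) / 2)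
        * (u.G (P 2) (P 0) (P 1) x - u.G (P 2) (P 2) (P 3) x)
      - ((u.G (P 2) (P 0) (P 1) x + u.G (P 2) (P 2) (P 3) x) / 2 + u.G (P 0) (P 1) (P 2) x)
        * (u.G (P 0) (P 0) (P 1) x - u.G (P 0) (P 2) (P 3) x) = 0 := by
  obtain ⟨hκ, hσ, -, -⟩ := hu.bianchi_typeD hU hD hx P hP
  obtain ⟨-, -, -, -, d1, d2⟩ := hu.dn_typeD hD hx P hP
  rw [← TetradData.riemC_sub_riemC_aligned hU hx hu.leviCivita P hP hκ hσ]
  have h1 := TetradData.weylC_eq (u := u.toTetradData) (x := x) (P 1) (P 0) (P 0) (P 2)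
  have h2 := TetradData.weylC_eq (u := u.toTetradData) (x := x) (P 3) (P 2) (P 0) (P 2)
  rw [hu.weylC_eq hx, d1] at h1
  rw [hu.weylC_eq hx, d2] at h2
  -- With the Weyl parts gone, the two curvature components are Schouten components with exchanged
  -- indices. Their scalar curvature terms vanish, and Ricci symmetry cancels the rest.
  have hs := TetradData.ricC_symm hU hu.leviCivita hx (P 0) (P 2)
  rcases hP with rfl | rfl <;> simp [primeIdx, etaC, TetradData.schC] at h1 h2 hs ⊢ <;>
    linear_combination h2 - h1 - hs / 2

/-- `D τ - δ ρ` in type D. -/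
theorem IsSolutionOn.nd_sub_nd_typeD' (hU : IsOpen U) (hu : IsSolutionOn U u)
    (hD : IsAlignedTypeDOn U u) (hx : x ∈ U) (P : Fin 4 → Fin 4) (hP : P = id ∨ P = primeIdx) :
    u.nd (P 0) (u.G (P 1) (P 0) (P 2)) x - u.nd (P 2) (u.G (P 3) (P 0) (P 2)) x =
      (u.G (P 0) (P 1) (P 2) x + u.G (P 2) (P 0) (P 1) x) * u.G (P 3) (P 0) (P 2) x
      + (u.G (P 0) (P 2) (P 3) x - u.G (P 2) (P 0) (P 3) x) * u.G (P 1) (P 0) (P 2) x := by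
  obtain ⟨hκ, hσ, b1, b2⟩ := hu.bianchi_typeD hU hD hx P hP
  obtain ⟨-, -, -, hne, -, -⟩ := hu.dn_typeD hD hx P hP
  have sF := ConformalData.smoothOn_dn hu.smooth_d (P 0) (P 2) (P 3) (P 1)
  have hF := mdifferentiableAt_of_contMDiffOn hU sF hx
  have hG : ∀ A B C, MDifferentiableAt I 𝓘(ℝ, ℂ) (u.G A B C) x := fun A B C =>
    mdifferentiableAt_of_contMDiffOn hU (TetradData.smoothOn_G hu.leviCivita.smooth_Γ A B C) hx
  -- The equations for Dφ₂ and δφ₂ are overdetermined; the commutator applied to φ₂ is their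
  -- integrability condition. The products ρτ cancel, and φ₂ ≠ 0 is divided out.
  have hc := TetradData.nd_comm_aligned hU hx hu.leviCivita P hP hκ hσ sF
  have hG' : ∀ A B C, MDifferentiableAt I 𝓘(ℝ, ℂ) (fun y => -3 * u.G A B C y) x := fun A B C =>
    mdifferentiableAt_const.mul (hG A B C)
  rw [TetradData.nd_congr (P 0) hU hx fun y hy => (hu.bianchi_typeD hU hD hy P hP).2.2.2,
    TetradData.nd_congr (P 2) hU hx fun y hy => (hu.bianchi_typeD hU hD hy P hP).2.2.1,
    TetradData.nd_mul _ (hG' _ _ _) hF, TetradData.nd_mul _ (hG' _ _ _) hF,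
    TetradData.nd_const_mul _ _ (hG _ _ _), TetradData.nd_const_mul _ _ (hG _ _ _), b1, b2] at hc
  refine mul_right_cancel₀ hne ?_
  linear_combination -hc / 3

/-- The decoupled equation for the extreme component of the perturbed rescaled Weyl tensor. -/
theorem IsLinearisedSolutionOn.decoupled (hU : IsOpen U) (hu : IsSolutionOn U u)
    (hD : IsAlignedTypeDOn U u) (hv : IsLinearisedSolutionOn U u v) (hx : x ∈ U)
    (P : Fin 4 → Fin 4) (hP : P = id ∨ P = primeIdx) {a A B : M → ℂ}
    (ha : a = v.dn (P 0) (P 2) (P 0) (P 2))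
    (hA : A = fun y => u.nd (P 1) a y
      + (u.G (P 2) (P 1) (P 3) y + 2 * (u.G (P 1) (P 0) (P 1) y - u.G (P 1) (P 2) (P 3) y)) * a y)
    (hB : B = fun y => u.nd (P 3) a y
      + (u.G (P 0) (P 1) (P 3) y + 2 * (u.G (P 3) (P 0) (P 1) y - u.G (P 3) (P 2) (P 3) y)) * a y) :
    u.nd (P 0) A x + (u.G (P 0) (P 0) (P 1) x - 2 * u.G (P 0) (P 2) (P 3) x
        + 4 * u.G (P 3) (P 0) (P 2) x + u.G (P 2) (P 0) (P 3) x) * A x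
      - (u.nd (P 2) B x + (u.G (P 0) (P 1) (P 2) x + 2 * u.G (P 2) (P 0) (P 1) x
        - u.G (P 2) (P 2) (P 3) x + 4 * u.G (P 1) (P 0) (P 2) x) * B x)
      - 3 * u.Ξ x * u.dn (P 0) (P 2) (P 3) (P 1) x * a x = 0 := by
  set c := v.dn (P 0) (P 1) (P 0) (P 2) with hc
  set F := u.dn (P 0) (P 2) (P 3) (P 1) with hF
  have sc : SmoothOn I U c := ConformalData.smoothOn_dn hv.smooth_d _ _ _ _
  have sF : SmoothOn I U F := ConformalData.smoothOn_dn hu.smooth_d _ _ _ _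
  have su : ∀ A B C, SmoothOn I U (u.G A B C) := TetradData.smoothOn_G hu.leviCivita.smooth_Γ
  have sv : ∀ A B C, SmoothOn I U (v.G A B C) := TetradData.smoothOn_G hv.leviCivita.smooth_Γ
  have sn : ∀ A, SmoothOn I U (u.nd A c) := fun A =>
    TetradData.smoothOn_nd hU hu.leviCivita.smooth_e A sc
  have md : ∀ {f : M → ℂ}, SmoothOn I U f → MDifferentiableAt I 𝓘(ℝ, ℂ) f x := fun hf =>
    mdifferentiableAt_of_contMDiffOn hU hf hx
  -- The linearised Bianchi equations trade first-order expressions in φ₀' for ones in φ₁' = `c`,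
  -- plus a term in φ₂σ' here and one in φ₂κ' in `eB`.
  have eA : ∀ y ∈ U, A y = u.nd (P 2) c y + (4 * u.G (P 1) (P 0) (P 2) y
      + (u.G (P 2) (P 0) (P 1) y - u.G (P 2) (P 2) (P 3) y)) * c y
      - 3 * (v.G (P 2) (P 0) (P 2) y * F y) := fun y hy => by
    rw [hA, ha]
    linear_combination (hv.bianchi_typeD hU hu hD hy P hP).2
  have eB : ∀ y ∈ U, B y = u.nd (P 0) c y + (4 * u.G (P 3) (P 0) (P 2) y
      + (u.G (P 0) (P 0) (P 1) y - u.G (P 0) (P 2) (P 3) y)) * c y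
      - 3 * (v.G (P 0) (P 0) (P 2) y * F y) := fun y hy => by
    rw [hB, ha]
    linear_combination (hv.bianchi_typeD hU hu hD hy P hP).1
  have nd_expand : ∀ (K L : Fin 4) {f g h k : M → ℂ}, SmoothOn I U f → SmoothOn I U g →
      SmoothOn I U h → SmoothOn I U k → u.nd K (fun y => u.nd L c y + (4 * f y + (g y - h y)) * c y
        - 3 * (k y * F y)) x = u.nd K (u.nd L c) x + (4 * u.nd K f x + (u.nd K g x - u.nd K h x)) * c x
        + (4 * f x + (g x - h x)) * u.nd K c x - 3 * (u.nd K k x * F x + k x * u.nd K F x) := by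
    intro K L f g h k sf sg sh sk
    have s1 : SmoothOn I U (fun y => 4 * f y + (g y - h y)) := (sf.const_mul 4).add (sg.sub sh)
    have s2 : SmoothOn I U (fun y => (4 * f y + (g y - h y)) * c y) := s1.mul sc
    rw [TetradData.nd_sub K (md ((sn L).add s2)) (md ((sk.mul sF).const_mul 3)),
      TetradData.nd_add K (md (sn L)) (md s2), TetradData.nd_mul K (md s1) (md sc),
      TetradData.nd_add K (md (sf.const_mul 4)) (md (sg.sub sh)),
      TetradData.nd_const_mul K _ (md sf), TetradData.nd_sub K (md sg) (md sh),
      TetradData.nd_const_mul K _ (md (sk.mul sF)), TetradData.nd_mul K (md sk) (md sF)]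
    ring
  rw [eA x hx, eB x hx, TetradData.nd_congr (P 0) hU hx eA, TetradData.nd_congr (P 2) hU hx eB,
    nd_expand _ _ (su _ _ _) (su _ _ _) (su _ _ _) (sv _ _ _),
    nd_expand _ _ (su _ _ _) (su _ _ _) (su _ _ _) (sv _ _ _)]
  obtain ⟨hκ, hσ, b1, b2⟩ := hu.bianchi_typeD hU hD hx P hP
  have h1 := TetradData.nd_comm_aligned hU hx hu.leviCivita P hP hκ hσ sc
  have h2 := hu.nd_sub_nd_typeD hU hD hx P hP
  have h3 := hu.nd_sub_nd_typeD' hU hD hx P hP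
  have hR := TetradData.hasDerivAt_riemC_aligned hU hx hu.leviCivita.smooth_Γ
    hv.leviCivita.smooth_Γ hu.leviCivita.metric
    (fun y hy => hv.leviCivita.metricDefect_eq_zero hy) P hP
    (fun y hy => (hu.bianchi_typeD hU hD hy P hP).1)
    (fun y hy => (hu.bianchi_typeD hU hD hy P hP).2.1)
  have hW := hv.hasDerivAt_weylC hx (P 0) (P 2) (P 0) (P 2)
  simp only [TetradData.weylC_eq_riemC _ _ P hP] at hW
  -- The background value of the extreme component is zero, which removes Ξ' from the source of the
  -- Ricci equation.
  rw [(hu.dn_typeD hD hx P hP).1, mul_zero, add_zero, ← ha] at hW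
  have h4 := hR.unique hW
  rw [← hF] at b1 b2
  rw [b1, b2]
  -- Second derivatives of φ₁' leave a commutator (`h1`). Its zeroth-order coefficient vanishes by
  -- Dβ − δε (`h2`) and four times Dτ − δρ (`h3`), four being the multiplicity of ρ and τ in the
  -- Bianchi equations. The linearised Ricci equation (`h4`) absorbs κ' and σ', with the factor
  -- three of 3φ₂κ' and 3φ₂σ'.
  linear_combination h1 + c x * h2 + 4 * c x * h3 + 3 * F x * h4

end

/-- Pair symmetry followed by both antisymmetries. Hence φ₂ is invariant under the exchange, and
both equations carry the same potential. -/
theorem arrayT_exchange {T : Fin 4 → Fin 4 → Fin 4 → Fin 4 → ℝ} (hT : WeylSymmetries T) :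
    arrayT T 1 3 2 0 = arrayT T 0 2 3 1 := by
  have r := hT.components
  simp only [arrayT, nullFrame_eq]
  simp [Fin.sum_univ_four, r]

/-! ### The two equations in spin coefficients, and the perturbed Weyl scalars -/

section

variable [IsManifold I ∞ M] {U : Set M} {u v : ConformalData I M} {x : M}

theorem IsLinearisedSolutionOn.teukolsky0_eq_zero (hU : IsOpen U) (hu : IsSolutionOn U u)
    (hD : IsAlignedTypeDOn U u) (hv : IsLinearisedSolutionOn U u v) (hx : x ∈ U) :
    teukolsky0 u v.φ0 x = 0 := by
  have h := hv.decoupled hU hu hD hx id (Or.inl rfl) rfl rfl rfl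
  have cG := fun A B C => TetradData.G_conj (u := u.toTetradData) (x := x) A B C
  have r := TetradData.G_rules (hu.leviCivita.metric x hx)
  have hA : (fun y => u.npΔ v.φ0 y + (-4 * u.γ y + u.μ y) * v.φ0 y) = fun y =>
      u.nd 1 (v.dn 0 2 0 2) y + (u.G 2 1 3 y + 2 * (u.G 1 0 1 y - u.G 1 2 3 y))
        * v.dn 0 2 0 2 y := by
    funext y
    change u.nd 1 (v.dn 0 2 0 2) y + (-4 * (-(u.G 1 0 1 y - u.G 1 2 3 y) / 2) + u.G 2 1 3 y)
        * v.dn 0 2 0 2 y = _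
    ring
  have hB : (fun y => u.npδb v.φ0 y + (u.π y - 4 * u.α y) * v.φ0 y) = fun y =>
      u.nd 3 (v.dn 0 2 0 2) y + (u.G 0 1 3 y + 2 * (u.G 3 0 1 y - u.G 3 2 3 y))
        * v.dn 0 2 0 2 y := by
    funext y
    change u.nd 3 (v.dn 0 2 0 2) y + (u.G 0 1 3 y - 4 * (-(u.G 3 0 1 y - u.G 3 2 3 y) / 2))
        * v.dn 0 2 0 2 y = _
    ring
  have c1 : -3 * u.ε x + conj (u.ε x) - 4 * u.ρ x - conj (u.ρ x) =
      u.G 0 0 1 x - 2 * u.G 0 2 3 x + 4 * u.G 3 0 2 x + u.G 2 0 3 x := by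
    change -3 * (-(u.G 0 0 1 x - u.G 0 2 3 x) / 2) + conj (-(u.G 0 0 1 x - u.G 0 2 3 x) / 2)
      - 4 * -u.G 3 0 2 x - conj (-u.G 3 0 2 x) = _
    simp [cG, r, Complex.conj_ofNat]
    ring
  have c2 : conj (u.π x) - conj (u.α x) - 3 * u.β x - 4 * u.τ x =
      u.G 0 1 2 x + 2 * u.G 2 0 1 x - u.G 2 2 3 x + 4 * u.G 1 0 2 x := by
    change conj (u.G 0 1 3 x) - conj (-(u.G 3 0 1 x - u.G 3 2 3 x) / 2)
      - 3 * (-(u.G 2 0 1 x - u.G 2 2 3 x) / 2) - 4 * -u.G 1 0 2 x = _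
    simp [cG, r, Complex.conj_ofNat]
    ring
  simp only [teukolsky0]
  have hA' : u.npΔ v.φ0 x + (-4 * u.γ x + u.μ x) * v.φ0 x = _ := congrFun hA x
  have hB' : u.npδb v.φ0 x + (u.π x - 4 * u.α x) * v.φ0 x = _ := congrFun hB x
  rw [hA, hB, hA', hB', c1, c2]
  exact h

theorem IsLinearisedSolutionOn.teukolsky4_eq_zero (hU : IsOpen U) (hu : IsSolutionOn U u)
    (hD : IsAlignedTypeDOn U u) (hv : IsLinearisedSolutionOn U u v) (hx : x ∈ U) :
    teukolsky4 u v.φ4 x = 0 := by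
  have h := hv.decoupled hU hu hD hx primeIdx (Or.inr rfl) rfl rfl rfl
  have cG := fun A B C => TetradData.G_conj (u := u.toTetradData) (x := x) A B C
  have r := TetradData.G_rules (hu.leviCivita.metric x hx)
  -- After the exchange, coefficients appear with their last two indices swapped. Antisymmetry of
  -- the connection is known only on U, so the inner operators are compared on U and then
  -- differentiated by `nd_congr`.
  have hA : ∀ y ∈ U, u.npD v.φ4 y + (4 * u.ε y - u.ρ y) * v.φ4 y =
      u.nd 0 (v.dn 1 3 1 3) y + (u.G 3 0 2 y + 2 * (u.G 0 1 0 y - u.G 0 3 2 y))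
        * v.dn 1 3 1 3 y := by
    intro y hy
    have r := TetradData.G_rules (hu.leviCivita.metric y hy)
    change u.nd 0 (v.dn 1 3 1 3) y + (4 * (-(u.G 0 0 1 y - u.G 0 2 3 y) / 2) - -u.G 3 0 2 y)
        * v.dn 1 3 1 3 y = _
    simp only [r]
    ring
  have hB : ∀ y ∈ U, u.npδ v.φ4 y + (-u.τ y + 4 * u.β y) * v.φ4 y =
      u.nd 2 (v.dn 1 3 1 3) y + (u.G 1 0 2 y + 2 * (u.G 2 1 0 y - u.G 2 3 2 y))
        * v.dn 1 3 1 3 y := by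
    intro y hy
    have r := TetradData.G_rules (hu.leviCivita.metric y hy)
    change u.nd 2 (v.dn 1 3 1 3) y + (- -u.G 1 0 2 y + 4 * (-(u.G 2 0 1 y - u.G 2 2 3 y) / 2))
        * v.dn 1 3 1 3 y = _
    simp only [r]
    ring
  have c1 : 3 * u.γ x - conj (u.γ x) + 4 * u.μ x + conj (u.μ x) =
      u.G 1 1 0 x - 2 * u.G 1 3 2 x + 4 * u.G 2 1 3 x + u.G 3 1 2 x := by
    change 3 * (-(u.G 1 0 1 x - u.G 1 2 3 x) / 2) - conj (-(u.G 1 0 1 x - u.G 1 2 3 x) / 2)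
      + 4 * u.G 2 1 3 x + conj (u.G 2 1 3 x) = _
    simp [cG, r, Complex.conj_ofNat]
    ring
  have c2 : -conj (u.τ x) + conj (u.β x) + 3 * u.α x + 4 * u.π x =
      u.G 1 0 3 x + 2 * u.G 3 1 0 x - u.G 3 3 2 x + 4 * u.G 0 1 3 x := by
    change -conj (-u.G 1 0 2 x) + conj (-(u.G 2 0 1 x - u.G 2 2 3 x) / 2)
      + 3 * (-(u.G 3 0 1 x - u.G 3 2 3 x) / 2) + 4 * u.G 0 1 3 x = _
    simp [cG, r, Complex.conj_ofNat]
    ring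
  have e : u.dn 1 3 2 0 x = u.φ2 x := arrayT_exchange (hu.weylSymm x hx)
  have nA := TetradData.nd_congr (u := u.toTetradData) 1 hU hx hA
  have nB := TetradData.nd_congr (u := u.toTetradData) 3 hU hx hB
  have nA' : u.npΔ (fun y => u.npD v.φ4 y + (4 * u.ε y - u.ρ y) * v.φ4 y) x = _ := nA
  have nB' : u.npδb (fun y => u.npδ v.φ4 y + (-u.τ y + 4 * u.β y) * v.φ4 y) x = _ := nB
  simp only [teukolsky4]
  rw [nA', nB', hA x hx, hB x hx, c1, c2, ← e]
  exact h

/-- The perturbed extreme Weyl scalars in terms of the rescaled Weyl tensor, in type D. -/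
theorem IsLinearisedSolutionOn.pert_weylC (hu : IsSolutionOn U u) (hD : IsAlignedTypeDOn U u)
    (hv : IsLinearisedSolutionOn U u v) (hx : x ∈ U) (P : Fin 4 → Fin 4)
    (hP : P = id ∨ P = primeIdx) :
    pert (u.toTetradData.line v.toTetradData) (fun p => p.weylC (P 0) (P 2) (P 0) (P 2)) x =
      u.Ξ x * v.dn (P 0) (P 2) (P 0) (P 2) x := by
  have h := (hv.hasDerivAt_weylC hx (P 0) (P 2) (P 0) (P 2)).deriv
  rw [(hu.dn_typeD hD hx P hP).1, mul_zero, add_zero] at h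
  exact h

end

/-! ### Rescaled null frames -/

theorem contr_etaC_left (B : Fin 4) (X : Fin 4 → ℂ) : contr (fun F => etaC B F) X = X B := by
  fin_cases B <;> simp [contr, etaC]

theorem contr_comm (X Y : Fin 4 → ℂ) : contr X Y = contr Y X := by
  simp only [contr]
  ring

theorem contr_etaC_right (B : Fin 4) (X : Fin 4 → ℂ) : contr X (fun F => etaC B F) = X B := by
  rw [contr_comm, contr_etaC_left]

theorem etaC_comm (A B : Fin 4) : etaC A B = etaC B A := by
  fin_cases A <;> fin_cases B <;> rfl

/-- Expansion of a contraction of sums of covectors. -/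
theorem contr_expand (X Y w : Fin 4 → ℂ) (A B C D : Fin 4) (p q r s t k : ℂ) :
    contr (fun F => X F + p * etaC D F - q * w F + r * etaC B F)
        (fun F => Y F + s * w F - t * etaC C F - k * etaC A F) =
      contr X Y + s * contr X w - t * X C - k * X A
        + p * (Y D + s * w D - t * etaC C D - k * etaC A D)
        - q * (contr w Y + s * contr w w - t * w C - k * w A)
        + r * (Y B + s * w B - t * etaC C B - k * etaC A B) := by
  have h : ∀ Z : Fin 4 → ℂ, contr (fun F => X F + p * etaC D F - q * w F + r * etaC B F) Z =
      contr X Z + p * contr (fun F => etaC D F) Z - q * contr w Z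
        + r * contr (fun F => etaC B F) Z := fun Z => by
    simp only [contr]
    ring
  have h' : ∀ Z : Fin 4 → ℂ, contr Z (fun F => Y F + s * w F - t * etaC C F - k * etaC A F) =
      contr Z Y + s * contr Z w - t * contr Z (fun F => etaC C F)
        - k * contr Z (fun F => etaC A F) := fun Z => by
    simp only [contr]
    ring
  simp only [h, h', contr_etaC_left, contr_etaC_right]
  rw [etaC_comm D C, etaC_comm D A, etaC_comm B C, etaC_comm B A]

/-- On `V` the null frame of `u` is `f A` times the null frame of `p`, and the metrics are related
by the factor `Ω ^ 2`. -/
structure IsFrameScaling (V : Set M) (u p : TetradData I M) (Ω : M → ℂ) (f : Fin 4 → M → ℂ) :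
    Prop where
  smooth_Ω : SmoothOn I V Ω
  smooth_f : ∀ A, SmoothOn I V (f A)
  f_mul : ∀ A, ∀ y ∈ V, f A y * f (primeIdx A) y * Ω y ^ 2 = 1
  nd_eq : ∀ (A : Fin 4) (g : M → ℂ), ∀ y ∈ V, u.nd A g y = f A y * p.nd A g y

/-- If `h i = 1`, the logarithmic derivatives of `h` are closed. -/
theorem TetradData.nd_logDeriv [IsManifold I ∞ M] {V : Set M} {p : TetradData I M}
    (hV : IsOpen V) (hp : IsLeviCivitaOn V p) {x : M} (hx : x ∈ V) {h i : M → ℂ}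
    (sh : SmoothOn I V h) (si : SmoothOn I V i) (hi : ∀ y ∈ V, h y * i y = 1) (C D : Fin 4) :
    p.nd C (fun y => p.nd D h y * i y) x - p.nd D (fun y => p.nd C h y * i y) x =
      contr (fun F => p.S C D F x) (fun F => p.nd F h x * i x) := by
  have md : ∀ {f : M → ℂ}, SmoothOn I V f → MDifferentiableAt I 𝓘(ℝ, ℂ) f x := fun hf =>
    mdifferentiableAt_of_contMDiffOn hV hf hx
  have sn : ∀ A, SmoothOn I V (p.nd A h) := fun A => smoothOn_nd hV hp.smooth_e A sh
  have ni : ∀ A, p.nd A i x * h x = -p.nd A h x * i x := fun A => by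
    have := nd_congr (u := p) A hV hx hi
    rw [nd_mul A (md sh) (md si), nd_const] at this
    linear_combination this
  rw [nd_mul C (md (sn D)) (md si), nd_mul D (md (sn C)) (md si)]
  have hc := nd_comm hV hp hx sh C D
  have e : contr (fun F => p.S C D F x) (fun F => p.nd F h x * i x) =
      contr (fun F => p.S C D F x) (fun F => p.nd F h x) * i x := by
    simp only [contr]
    ring
  rw [e, ← hc]
  have h1 := hi x hx
  linear_combination (p.nd C h x * p.nd D i x - p.nd D h x * p.nd C i x) * h1
    + p.nd D h x * i x * ni C - p.nd C h x * i x * ni D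

namespace IsFrameScaling

variable {V : Set M} {u p : TetradData I M} {Ω : M → ℂ} {f : Fin 4 → M → ℂ} {x : M}

theorem f_ne (h : IsFrameScaling V u p Ω f) (hx : x ∈ V) (A : Fin 4) : f A x ≠ 0 := fun h0 => by
  have := h.f_mul A x hx
  rw [h0] at this
  simp at this

theorem Ω_ne (h : IsFrameScaling V u p Ω f) (hx : x ∈ V) : Ω x ≠ 0 := fun h0 => by
  have := h.f_mul 0 x hx
  rw [h0] at this
  simp at this

end IsFrameScaling

/-- Logarithmic derivatives of the scale factors of a rescaled null frame. -/
def scaleLog (p : TetradData I M) (Ω : M → ℂ) (f : Fin 4 → M → ℂ) (A B : Fin 4) (y : M) : ℂ :=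
  p.nd A (f B) y * (f (primeIdx B) y * Ω y ^ 2)

/-- Logarithmic derivatives of the conformal factor. -/
def conformalLog (p : TetradData I M) (Ω : M → ℂ) (f : Fin 4 → M → ℂ) (A : Fin 4) (y : M) : ℂ :=
  p.nd A Ω y * (f 0 y * f 1 y * Ω y)

/-- Null frame components of the transformed connection, up to the overall scale. -/
def scaledG (p : TetradData I M) (Ω : M → ℂ) (f : Fin 4 → M → ℂ) (A B C : Fin 4) (y : M) : ℂ :=
  p.G A B C y + etaC A C * conformalLog p Ω f B y - etaC A B * conformalLog p Ω f C y
    + etaC B C * (scaleLog p Ω f A B y + conformalLog p Ω f A y)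

namespace IsFrameScaling

variable {V : Set M} {u p : TetradData I M} {Ω : M → ℂ} {f : Fin 4 → M → ℂ} {x : M}

/-- By `f_mul` the factor f₀f₁Ω in `conformalLog` is Ω⁻¹; in the same way `scaleLog` contains the
inverse of f_B, so neither definition needs a division. -/
theorem nd_Ω (h : IsFrameScaling V u p Ω f) (hx : x ∈ V) (A : Fin 4) :
    p.nd A Ω x = Ω x * conformalLog p Ω f A x := by
  have := h.f_mul 0 x hx
  simp only [primeIdx, Matrix.cons_val_zero] at this
  rw [conformalLog]
  linear_combination -p.nd A Ω x * this

theorem nd_f (h : IsFrameScaling V u p Ω f) (hx : x ∈ V) (A B : Fin 4) :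
    p.nd A (f B) x = f B x * scaleLog p Ω f A B x := by
  have := h.f_mul B x hx
  rw [scaleLog]
  linear_combination -p.nd A (f B) x * this

variable [IsManifold I ∞ M]

theorem smoothOn_scaleLog (h : IsFrameScaling V u p Ω f) (hV : IsOpen V) (hp : IsLeviCivitaOn V p)
    (A B : Fin 4) : SmoothOn I V (scaleLog p Ω f A B) := by
  have : SmoothOn I V (fun y => p.nd A (f B) y * (f (primeIdx B) y * (Ω y * Ω y))) :=
    (TetradData.smoothOn_nd hV hp.smooth_e A (h.smooth_f B)).mul
      ((h.smooth_f _).mul (h.smooth_Ω.mul h.smooth_Ω))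
  exact this.congr fun y _ => by rw [scaleLog, sq]

theorem smoothOn_conformalLog (h : IsFrameScaling V u p Ω f) (hV : IsOpen V)
    (hp : IsLeviCivitaOn V p) (A : Fin 4) : SmoothOn I V (conformalLog p Ω f A) :=
  (TetradData.smoothOn_nd hV hp.smooth_e A h.smooth_Ω).mul
    (((h.smooth_f 0).mul (h.smooth_f 1)).mul h.smooth_Ω)

theorem scaleLog_add (h : IsFrameScaling V u p Ω f) (hV : IsOpen V) (hx : x ∈ V) (A B : Fin 4) :
    scaleLog p Ω f A B x + scaleLog p Ω f A (primeIdx B) x + 2 * conformalLog p Ω f A x = 0 := by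
  have md : ∀ {f : M → ℂ}, SmoothOn I V f → MDifferentiableAt I 𝓘(ℝ, ℂ) f x := fun hf =>
    mdifferentiableAt_of_contMDiffOn hV hf hx
  have e : ∀ y ∈ V, f B y * f (primeIdx B) y * (Ω y * Ω y) = 1 := fun y hy => by
    rw [← h.f_mul B y hy]
    ring
  have h1 := TetradData.nd_congr (u := p) A hV hx e
  rw [TetradData.nd_mul A (md ((h.smooth_f _).mul (h.smooth_f _))) (md (h.smooth_Ω.mul h.smooth_Ω)),
    TetradData.nd_mul A (md (h.smooth_f _)) (md (h.smooth_f _)),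
    TetradData.nd_mul A (md h.smooth_Ω) (md h.smooth_Ω), TetradData.nd_const, h.nd_f hx, h.nd_f hx,
    h.nd_Ω hx] at h1
  have h2 := e x hx
  linear_combination h1 - (scaleLog p Ω f A B x + scaleLog p Ω f A (primeIdx B) x
    + 2 * conformalLog p Ω f A x) * h2

/-- Once the conformal part is split off, the factors are a boost and a rotation. Paired indices
carry opposite logarithmic derivatives by `f_mul`, and this makes `scaledG` metric. -/
theorem etaC_mul_scaleLog (h : IsFrameScaling V u p Ω f) (hV : IsOpen V) (hx : x ∈ V)
    (A B C : Fin 4) : etaC B C * (scaleLog p Ω f A B x + conformalLog p Ω f A x) =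
      -(etaC B C * (scaleLog p Ω f A C x + conformalLog p Ω f A x)) := by
  have h0 : scaleLog p Ω f A 0 x + scaleLog p Ω f A 1 x + 2 * conformalLog p Ω f A x = 0 :=
    h.scaleLog_add hV hx A 0
  have h2 : scaleLog p Ω f A 2 x + scaleLog p Ω f A 3 x + 2 * conformalLog p Ω f A x = 0 :=
    h.scaleLog_add hV hx A 2
  fin_cases B <;> fin_cases C <;> simp [etaC]
  · linear_combination -h0
  · linear_combination -h0
  · linear_combination h2
  · linear_combination h2

/-- The structure functions of a rescaled frame. -/
theorem S_eq (h : IsFrameScaling V u p Ω f) (hV : IsOpen V) (hu : IsLeviCivitaOn V u)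
    (hp : IsLeviCivitaOn V p) (hx : x ∈ V) (A B C : Fin 4) :
    u.S A B C x = Ω x ^ 2 * f A x * f B x * f C x * (p.S A B C x
      + scaleLog p Ω f A B x * etaC B C - scaleLog p Ω f B A x * etaC A C) := by
  -- Contraction pairs the index C with the derivative along `primeIdx C`, whence this factor. Both
  -- commutators are tested on an arbitrary function and compared.
  have key : u.S A B C x * f (primeIdx C) x - f A x * f B x * (p.S A B C x
      + scaleLog p Ω f A B x * etaC B C - scaleLog p Ω f B A x * etaC A C) = 0 := by
    refine TetradData.eq_zero_of_contr_nd (u := p) (X := fun C =>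
      u.S A B C x * f (primeIdx C) x - f A x * f B x * (p.S A B C x
      + scaleLog p Ω f A B x * etaC B C - scaleLog p Ω f B A x * etaC A C)) (hp.norm x hx) ?_ C
    intro g hg
    set W := V ∩ (chartAt H x).source with hW
    have oW : IsOpen W := hV.inter (chartAt H x).open_source
    have xW : x ∈ W := ⟨hx, mem_chart_source H x⟩
    have sV : W ⊆ V := inter_subset_left
    have sg : SmoothOn I W g := hg.mono inter_subset_right
    have cu := TetradData.nd_comm oW (hu.mono sV) xW sg A B
    have cp := TetradData.nd_comm oW (hp.mono sV) xW sg A B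
    have md : ∀ {f : M → ℂ}, SmoothOn I W f → MDifferentiableAt I 𝓘(ℝ, ℂ) f x := fun hf =>
      mdifferentiableAt_of_contMDiffOn oW hf xW
    have sn : ∀ A, SmoothOn I W (p.nd A g) := fun A =>
      TetradData.smoothOn_nd oW (hp.mono sV).smooth_e A sg
    rw [h.nd_eq A _ x hx, h.nd_eq B _ x hx,
      TetradData.nd_congr A oW xW fun y hy => h.nd_eq B g y (sV hy),
      TetradData.nd_congr B oW xW fun y hy => h.nd_eq A g y (sV hy),
      TetradData.nd_mul A (md ((h.smooth_f B).mono sV)) (md (sn B)),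
      TetradData.nd_mul B (md ((h.smooth_f A).mono sV)) (md (sn A)), h.nd_f hx, h.nd_f hx] at cu
    simp only [h.nd_eq _ g x hx] at cu
    have eB := contr_etaC_left B (fun F => p.nd F g x)
    have eA := contr_etaC_left A (fun F => p.nd F g x)
    simp only [contr, primeIdx, Matrix.cons_val] at cu cp eA eB ⊢
    linear_combination -cu + f A x * f B x * cp - f A x * f B x * scaleLog p Ω f A B x * eB
      + f A x * f B x * scaleLog p Ω f B A x * eA
  have hm := h.f_mul C x hx
  linear_combination (Ω x ^ 2 * f C x) * key - u.S A B C x * hm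

/-- The connection of a rescaled frame. -/
theorem G_eq (h : IsFrameScaling V u p Ω f) (hV : IsOpen V) (hu : IsLeviCivitaOn V u)
    (hp : IsLeviCivitaOn V p) (hx : x ∈ V) (A B C : Fin 4) :
    u.G A B C x = Ω x ^ 2 * f A x * f B x * f C x * scaledG p Ω f A B C x := by
  have hχ := h.etaC_mul_scaleLog hV hx
  -- The difference from the claimed connection is antisymmetric in its last two indices (metricity)
  -- and symmetric in its first two (torsion), hence zero: the uniqueness of the Levi-Civita
  -- connection.
  set K : Fin 4 → Fin 4 → Fin 4 → ℂ := fun A B C =>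
    u.G A B C x - Ω x ^ 2 * f A x * f B x * f C x * scaledG p Ω f A B C x with hK
  have anti : ∀ A B C, K A B C = -K A C B := by
    intro A B C
    have h1 := TetradData.G_antisymm (hu.metric x hx) A B C
    have h2 := TetradData.G_antisymm (hp.metric x hx) A B C
    have h3 := hχ A B C
    simp only [hK, scaledG]
    rw [etaC_comm C B]
    linear_combination h1 - Ω x ^ 2 * f A x * f B x * f C x * (h2 + h3)
  have symm : ∀ A B C, K A B C = K B A C := by
    intro A B C
    have h1 := h.S_eq hV hu hp hx A B C
    simp only [TetradData.S] at h1
    simp only [hK, scaledG]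
    rw [etaC_comm B A]
    linear_combination h1
  have k0 : K A B C = 0 := by
    have e1 := anti A B C
    have e2 := symm A C B
    have e3 := anti C A B
    have e4 := symm C B A
    have e5 := anti B C A
    have e6 := symm B A C
    linear_combination (e1 - e2 - e3 + e4 + e5 - e6) / 2
  exact sub_eq_zero.1 k0

end IsFrameScaling

/-! ### Curvature of a rescaled null frame -/

/-- The algebra behind the transformation of the Riemann tensor under a rescaling of the frame. -/
theorem scaled_curvature_algebra {g E' : Fin 4 → Fin 4 → Fin 4 → ℂ} {w : Fin 4 → ℂ}
    {χ n : Fin 4 → Fin 4 → ℂ} (hg : ∀ A B C, g A B C = -g A C B)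
    (hχ : ∀ A B C, etaC B C * χ A B = -(etaC B C * χ A C))
    (hE : ∀ A B C, E' A B C = g A B C + etaC A C * w B - etaC A B * w C + etaC B C * χ A B)
    (A B C D : Fin 4) :
    (χ C B + χ C A) * E' D B A - (χ D B + χ D A) * E' C B A
      + etaC D A * n C B - etaC D B * n C A - etaC C A * n D B + etaC C B * n D A
      + etaC B A * contr (fun F => g C D F - g D C F) (fun F => χ F B)
      + contr (fun F => E' D B F) (fun F => E' C F A)
      - contr (fun F => E' C B F) (fun F => E' D F A)
      - contr (fun F => g C D F - g D C F) (fun F => E' F B A) =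
    contr (fun F => g D B F) (fun F => g C F A) - contr (fun F => g C B F) (fun F => g D F A)
      - contr (fun F => g C D F - g D C F) (fun F => g F B A)
      + (etaC A C * (-n D B + contr (g D B) w + w B * w D - contr w w * etaC B D / 2)
      - etaC A D * (-n C B + contr (g C B) w + w B * w C - contr w w * etaC B C / 2)
      + etaC B D * (-n C A + contr (g C A) w + w A * w C - contr w w * etaC A C / 2)
      - etaC B C * (-n D A + contr (g D A) w + w A * w D - contr w w * etaC A D / 2)) := by
  -- As covectors in the contracted index, the coefficients split into the old connection, a
  -- multiple of w and multiples of the metric, which `contr_expand` multiplies out.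
  have hl : ∀ D, (fun F => E' D B F) = fun F => g D B F + w B * etaC D F - etaC D B * w F
      + χ D B * etaC B F := fun D => by
    funext F
    rw [hE]
    ring
  have hr : ∀ C, (fun F => E' C F A) = fun F => g C F A + etaC C A * w F - w A * etaC C F
      - χ C A * etaC A F := fun C => by
    funext F
    rw [hE, hχ C F A, etaC_comm F A]
    ring
  have h2 : contr (fun F => g C D F - g D C F) (fun F => E' F B A) =
      contr (fun F => g C D F - g D C F) (fun F => g F B A)
      + w B * (g C D A - g D C A) - w A * (g C D B - g D C B)
      + etaC B A * contr (fun F => g C D F - g D C F) (fun F => χ F B) := by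
    have e1 := contr_etaC_right A (fun F => g C D F - g D C F)
    have e2 := contr_etaC_right B (fun F => g C D F - g D C F)
    have e3 : (fun F => E' F B A) = fun F => g F B A + etaC A F * w B - etaC B F * w A
        + etaC B A * χ F B := by
      funext F
      rw [hE, etaC_comm F A, etaC_comm F B]
    rw [← e1, ← e2, e3]
    simp only [contr]
    ring
  have h3 : ∀ D A, contr w (fun F => g D F A) = -contr (g D A) w := fun D A => by
    simp only [contr, hg D _ A]
    ring
  rw [hl, hl, hr, hr, h2, contr_expand (fun F => g D B F) (fun F => g C F A),
    contr_expand (fun F => g C B F) (fun F => g D F A), h3 C A, h3 D A, hE D B A, hE C B A]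
  rw [hg C D A, hg D C A, hg C D B, hg D C B]
  simp only [etaC_comm D A, etaC_comm D B, etaC_comm C A, etaC_comm C B, etaC_comm D C,
    etaC_comm B A]
  ring

/-- The tensor by which the Schouten tensor changes under a rescaling of the frame. -/
def schoutenShift (p : TetradData I M) (Ω : M → ℂ) (f : Fin 4 → M → ℂ) (B D : Fin 4) (x : M) : ℂ :=
  -p.nd D (conformalLog p Ω f B) x
    + contr (fun F => p.G D B F x) (fun F => conformalLog p Ω f F x)
    + conformalLog p Ω f B x * conformalLog p Ω f D x
    - contr (fun F => conformalLog p Ω f F x) (fun F => conformalLog p Ω f F x) * etaC B D / 2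

namespace IsFrameScaling

variable {V : Set M} {u p : TetradData I M} {Ω : M → ℂ} {f : Fin 4 → M → ℂ} {x : M}

/-- `f_mul` says that the factors of a contracted pair multiply to Ω⁻². -/
theorem contr_scaled (h : IsFrameScaling V u p Ω f) (hx : x ∈ V) (X Y : Fin 4 → ℂ) :
    contr (fun F => f F x * X F) (fun F => f F x * Y F) * Ω x ^ 2 = contr X Y := by
  have h0 : f 0 x * f 1 x * Ω x ^ 2 = 1 := h.f_mul 0 x hx
  have h2 : f 2 x * f 3 x * Ω x ^ 2 = 1 := h.f_mul 2 x hx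
  simp only [contr]
  linear_combination (-(X 0 * Y 1) - X 1 * Y 0) * h0 + (X 2 * Y 3 + X 3 * Y 2) * h2

variable [IsManifold I ∞ M]

theorem nd_scaled (h : IsFrameScaling V u p Ω f) (hV : IsOpen V) (hx : x ∈ V) {k : M → ℂ}
    (sk : SmoothOn I V k) (A B C D : Fin 4) :
    p.nd C (fun y => Ω y ^ 2 * f D y * f B y * f A y * k y) x =
      Ω x ^ 2 * f D x * f B x * f A x * (p.nd C k x + (2 * conformalLog p Ω f C x
        + scaleLog p Ω f C D x + scaleLog p Ω f C B x + scaleLog p Ω f C A x) * k x) := by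
  have md : ∀ {f : M → ℂ}, SmoothOn I V f → MDifferentiableAt I 𝓘(ℝ, ℂ) f x := fun hf =>
    mdifferentiableAt_of_contMDiffOn hV hf hx
  have s1 : SmoothOn I V (fun y => Ω y * Ω y) := h.smooth_Ω.mul h.smooth_Ω
  have s2 : SmoothOn I V (fun y => Ω y * Ω y * f D y) := s1.mul (h.smooth_f D)
  have s3 : SmoothOn I V (fun y => Ω y * Ω y * f D y * f B y) := s2.mul (h.smooth_f B)
  have s4 : SmoothOn I V (fun y => Ω y * Ω y * f D y * f B y * f A y) := s3.mul (h.smooth_f A)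
  simp only [sq]
  rw [TetradData.nd_mul C (md s4) (md sk), TetradData.nd_mul C (md s3) (md (h.smooth_f A)),
    TetradData.nd_mul C (md s2) (md (h.smooth_f B)), TetradData.nd_mul C (md s1) (md (h.smooth_f D)),
    TetradData.nd_mul C (md h.smooth_Ω) (md h.smooth_Ω), h.nd_Ω hx, h.nd_f hx, h.nd_f hx, h.nd_f hx]
  ring

theorem nd_scaledG (h : IsFrameScaling V u p Ω f) (hV : IsOpen V) (hp : IsLeviCivitaOn V p)
    (hx : x ∈ V) (A B C D : Fin 4) :
    p.nd C (scaledG p Ω f D B A) x = p.nd C (p.G D B A) x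
      + etaC D A * p.nd C (conformalLog p Ω f B) x - etaC D B * p.nd C (conformalLog p Ω f A) x
      + etaC B A * (p.nd C (scaleLog p Ω f D B) x + p.nd C (conformalLog p Ω f D) x) := by
  have md : ∀ {f : M → ℂ}, SmoothOn I V f → MDifferentiableAt I 𝓘(ℝ, ℂ) f x := fun hf =>
    mdifferentiableAt_of_contMDiffOn hV hf hx
  have sG := TetradData.smoothOn_G hp.smooth_Γ D B A
  have sω := h.smoothOn_conformalLog hV hp
  have sl := h.smoothOn_scaleLog hV hp
  have s1 := (sω B).const_mul (etaC D A)
  have s2 := (sω A).const_mul (etaC D B)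
  have s3 := ((sl D B).add (sω D)).const_mul (etaC B A)
  have e : scaledG p Ω f D B A = fun y => p.G D B A y + etaC D A * conformalLog p Ω f B y
    - etaC D B * conformalLog p Ω f A y
    + etaC B A * (scaleLog p Ω f D B y + conformalLog p Ω f D y) := rfl
  rw [e, TetradData.nd_add C (md ((sG.add s1).sub s2)) (md s3),
    TetradData.nd_sub C (md (sG.add s1)) (md s2), TetradData.nd_add C (md sG) (md s1),
    TetradData.nd_const_mul C _ (md (sω B)), TetradData.nd_const_mul C _ (md (sω A)),
    TetradData.nd_const_mul C _ (md ((sl D B).add (sω D))),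
    TetradData.nd_add C (md (sl D B)) (md (sω D))]

theorem smoothOn_scaledG (h : IsFrameScaling V u p Ω f) (hV : IsOpen V) (hp : IsLeviCivitaOn V p)
    (A B C : Fin 4) : SmoothOn I V (scaledG p Ω f A B C) := by
  have sω := h.smoothOn_conformalLog hV hp
  exact (((TetradData.smoothOn_G hp.smooth_Γ A B C).add ((sω B).const_mul (etaC A C))).sub
    ((sω C).const_mul (etaC A B))).add
      (((h.smoothOn_scaleLog hV hp A B).add (sω A)).const_mul (etaC B C))

/-- The Riemann tensor in a rescaled frame. -/
theorem riemC_scaled (h : IsFrameScaling V u p Ω f) (hV : IsOpen V) (hu : IsLeviCivitaOn V u)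
    (hp : IsLeviCivitaOn V p) (hx : x ∈ V) (A B C D : Fin 4) :
    u.riemC A B C D x = Ω x ^ 2 * f A x * f B x * f C x * f D x * (p.riemC A B C D x
      + (etaC A C * schoutenShift p Ω f B D x - etaC A D * schoutenShift p Ω f B C x
        + etaC B D * schoutenShift p Ω f A C x - etaC B C * schoutenShift p Ω f A D x)) := by
  have hΓu : ∀ a b c, MDifferentiableAt I 𝓘(ℝ, ℝ) (u.Γ a b c) x := fun a b c =>
    mdifferentiableAt_of_contMDiffOn hV (hu.smooth_Γ a b c) hx
  have hΓp : ∀ a b c, MDifferentiableAt I 𝓘(ℝ, ℝ) (p.Γ a b c) x := fun a b c =>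
    mdifferentiableAt_of_contMDiffOn hV (hp.smooth_Γ a b c) hx
  have hn : ∀ C D, u.nd C (u.G D B A) x = f C x * (Ω x ^ 2 * f D x * f B x * f A x *
      (p.nd C (scaledG p Ω f D B A) x + (2 * conformalLog p Ω f C x + scaleLog p Ω f C D x
        + scaleLog p Ω f C B x + scaleLog p Ω f C A x) * scaledG p Ω f D B A x)) := fun C D => by
    rw [h.nd_eq C _ x hx, TetradData.nd_congr C hV hx fun y hy => h.G_eq hV hu hp hy D B A,
      h.nd_scaled hV hx (h.smoothOn_scaledG hV hp D B A)]
  have hc : ∀ C D, contr (fun F => u.G D B F x) (fun F => u.G C F A x) =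
      Ω x ^ 2 * f A x * f B x * f C x * f D x *
        contr (fun F => scaledG p Ω f D B F x) (fun F => scaledG p Ω f C F A x) := fun C D => by
    rw [← h.contr_scaled hx (fun F => scaledG p Ω f D B F x) (fun F => scaledG p Ω f C F A x)]
    simp only [h.G_eq hV hu hp hx, contr]
    ring
  have hs : contr (fun F => u.S C D F x) (fun F => u.G F B A x) =
      Ω x ^ 2 * f A x * f B x * f C x * f D x *
        (contr (fun F => p.S C D F x) (fun F => scaledG p Ω f F B A x)
          + scaleLog p Ω f C D x * scaledG p Ω f D B A x
          - scaleLog p Ω f D C x * scaledG p Ω f C B A x) := by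
    have e1 := contr_etaC_left C (fun F => scaledG p Ω f F B A x)
    have e2 := contr_etaC_left D (fun F => scaledG p Ω f F B A x)
    have e3 := h.contr_scaled hx (fun F => p.S C D F x + scaleLog p Ω f C D x * etaC D F
      - scaleLog p Ω f D C x * etaC C F) (fun F => scaledG p Ω f F B A x)
    have e4 : contr (fun F => p.S C D F x + scaleLog p Ω f C D x * etaC D F
      - scaleLog p Ω f D C x * etaC C F) (fun F => scaledG p Ω f F B A x) =
      contr (fun F => p.S C D F x) (fun F => scaledG p Ω f F B A x)
          + scaleLog p Ω f C D x * scaledG p Ω f D B A x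
          - scaleLog p Ω f D C x * scaledG p Ω f C B A x := by
      rw [← e1, ← e2]
      simp only [contr]
      ring
    rw [← e4, ← e3]
    simp only [h.G_eq hV hu hp hx, h.S_eq hV hu hp hx, contr]
    ring
  -- Logarithmic differentials are closed. These two relations remove the derivatives of `scaleLog`,
  -- and those of `conformalLog` outside the Schouten shift.
  have hl : p.nd C (scaleLog p Ω f D B) x - p.nd D (scaleLog p Ω f C B) x =
      contr (fun F => p.S C D F x) (fun F => scaleLog p Ω f F B x) :=
    TetradData.nd_logDeriv hV hp hx (h.smooth_f B) (i := fun y => f (primeIdx B) y * Ω y ^ 2)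
      (((h.smooth_f _).mul (h.smooth_Ω.mul h.smooth_Ω)).congr fun y _ => by rw [sq])
      (fun y hy => by rw [← h.f_mul B y hy]; ring) C D
  have hω : p.nd C (conformalLog p Ω f D) x - p.nd D (conformalLog p Ω f C) x =
      contr (fun F => p.S C D F x) (fun F => conformalLog p Ω f F x) :=
    TetradData.nd_logDeriv hV hp hx h.smooth_Ω (i := fun y => f 0 y * f 1 y * Ω y)
      (((h.smooth_f 0).mul (h.smooth_f 1)).mul h.smooth_Ω)
      (fun y hy => by
        have : f 0 y * f 1 y * Ω y ^ 2 = 1 := h.f_mul 0 y hy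
        linear_combination this) C D
  have key := scaled_curvature_algebra (g := fun A B C => p.G A B C x)
    (E' := fun A B C => scaledG p Ω f A B C x) (w := fun A => conformalLog p Ω f A x)
    (χ := fun A B => scaleLog p Ω f A B x + conformalLog p Ω f A x)
    (n := fun A B => p.nd A (conformalLog p Ω f B) x) (TetradData.G_antisymm (hp.metric x hx))
    (h.etaC_mul_scaleLog hV hx) (fun A B C => rfl) A B C D
  have hsum : contr (fun F => p.S C D F x) (fun F => scaleLog p Ω f F B x
      + conformalLog p Ω f F x) = contr (fun F => p.S C D F x) (fun F => scaleLog p Ω f F B x)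
      + contr (fun F => p.S C D F x) (fun F => conformalLog p Ω f F x) := by
    simp only [contr]
    ring
  change _ + etaC B A * contr (fun F => p.S C D F x) (fun F => scaleLog p Ω f F B x
      + conformalLog p Ω f F x) + _ - _ - contr (fun F => p.S C D F x) _ = _ - _ -
      contr (fun F => p.S C D F x) _ + _ at key
  rw [hsum] at key
  rw [TetradData.riemC_eq hΓu, TetradData.riemC_eq hΓp, hn, hn, hc, hc, hs,
    h.nd_scaledG hV hp hx, h.nd_scaledG hV hp hx]
  simp only [schoutenShift]
  linear_combination (Ω x ^ 2 * f A x * f B x * f C x * f D x) * (key + etaC B A * (hl + hω))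

/-- The component `Ψ₂` of the Weyl tensor in a rescaled frame. -/
theorem weylC_scaled (h : IsFrameScaling V u p Ω f) (hV : IsOpen V) (hu : IsLeviCivitaOn V u)
    (hp : IsLeviCivitaOn V p) (hx : x ∈ V) :
    u.weylC 0 2 3 1 x * Ω x ^ 2 = p.weylC 0 2 3 1 x := by
  have h0 : f 0 x * f 1 x * Ω x ^ 2 = 1 := h.f_mul 0 x hx
  have h2 : f 2 x * f 3 x * Ω x ^ 2 = 1 := h.f_mul 2 x hx
  have e1 : f 1 x = (f 0 x * Ω x ^ 2)⁻¹ := eq_inv_of_mul_eq_one_left (by linear_combination h0)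
  have e3 : f 3 x = (f 2 x * Ω x ^ 2)⁻¹ := eq_inv_of_mul_eq_one_left (by linear_combination h2)
  have n0 := h.f_ne hx 0
  have n2 := h.f_ne hx 2
  have nΩ := h.Ω_ne hx
  -- The shift enters the Riemann tensor only in products with the metric, so it changes the
  -- Schouten part alone and cancels from the Weyl tensor. The remaining weight is f₀f₁f₂f₃Ω² = Ω⁻².
  rw [TetradData.weylC_eq, TetradData.weylC_eq]
  simp only [TetradData.schC, TetradData.ricC, h.riemC_scaled hV hu hp hx]
  simp [Fin.sum_univ_four, etaC]
  rw [e1, e3]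
  field_simp
  ring

end IsFrameScaling

/-! ### Perturbed extreme Weyl scalars under a perturbed rescaling -/

/-- The linearisation of the relation between the null frames of `u` and `p` by the factors `f A`,
where `ψ A` are the logarithmic perturbations of these factors. -/
structure IsLinearisedFrameScaling (V : Set M) (v p q : TetradData I M) (f ψ : Fin 4 → M → ℂ) :
    Prop where
  smooth_ψ : ∀ A, SmoothOn I V (ψ A)
  nd_eq : ∀ (A : Fin 4) (g : M → ℂ), ∀ y ∈ V,
    v.nd A g y = f A y * (ψ A y * p.nd A g y + q.nd A g y)

section

variable [IsManifold I ∞ M] {V : Set M} {u v p q : TetradData I M} {Ω : M → ℂ}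
  {f ψ : Fin 4 → M → ℂ} {x : M}

/-- The linearised structure functions of a rescaled frame. -/
theorem IsLinearisedFrameScaling.S_eq (h : IsFrameScaling V u p Ω f)
    (h' : IsLinearisedFrameScaling V v p q f ψ) (hV : IsOpen V) (hu : IsLeviCivitaOn V u)
    (hp : IsLeviCivitaOn V p) (hv : IsLinearisedLeviCivitaOn V u v)
    (hq : IsLinearisedLeviCivitaOn V p q) (hx : x ∈ V) {A B C : Fin 4} (hA : etaC A C = 0)
    (hB : etaC B C = 0) (hS : p.S A B C x = 0) :
    v.S A B C x = Ω x ^ 2 * f A x * f B x * f C x * q.S A B C x := by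
  -- The comparison of commutators is repeated with the linearised ones. Every inhomogeneous term
  -- carries `etaC A C`, `etaC B C` or a background structure function with indices A, B, C, and the
  -- hypotheses make all of these vanish.
  have key : v.S A B C x * f (primeIdx C) x + u.S A B C x * (f (primeIdx C) x * ψ (primeIdx C) x)
      - f A x * f B x * q.S A B C x - f A x * f B x * (ψ A x + ψ B x) * p.S A B C x
      - (f A x * f B x * (scaleLog p Ω f A B x * (ψ A x + ψ B x) + p.nd A (ψ B) x)
        + f A x * q.nd A (f B) x) * etaC B C
      + (f A x * f B x * (scaleLog p Ω f B A x * (ψ A x + ψ B x) + p.nd B (ψ A) x)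
        + f B x * q.nd B (f A) x) * etaC A C = 0 := by
    refine TetradData.eq_zero_of_contr_nd (u := p) (X := fun C =>
      v.S A B C x * f (primeIdx C) x + u.S A B C x * (f (primeIdx C) x * ψ (primeIdx C) x)
      - f A x * f B x * q.S A B C x - f A x * f B x * (ψ A x + ψ B x) * p.S A B C x
      - (f A x * f B x * (scaleLog p Ω f A B x * (ψ A x + ψ B x) + p.nd A (ψ B) x)
        + f A x * q.nd A (f B) x) * etaC B C
      + (f A x * f B x * (scaleLog p Ω f B A x * (ψ A x + ψ B x) + p.nd B (ψ A) x)
        + f B x * q.nd B (f A) x) * etaC A C) (hp.norm x hx) ?_ C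
    intro g hg
    set W := V ∩ (chartAt H x).source with hW
    have oW : IsOpen W := hV.inter (chartAt H x).open_source
    have xW : x ∈ W := ⟨hx, mem_chart_source H x⟩
    have sV : W ⊆ V := inter_subset_left
    have sg : SmoothOn I W g := hg.mono inter_subset_right
    have cu := TetradData.nd_comm_linearised oW (hu.mono sV) (hv.mono sV) xW sg A B
    have cq := TetradData.nd_comm_linearised oW (hp.mono sV) (hq.mono sV) xW sg A B
    have cp := TetradData.nd_comm oW (hp.mono sV) xW sg A B
    have md : ∀ {f : M → ℂ}, SmoothOn I W f → MDifferentiableAt I 𝓘(ℝ, ℂ) f x := fun hf =>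
      mdifferentiableAt_of_contMDiffOn oW hf xW
    have sp : ∀ A, SmoothOn I W (p.nd A g) := fun A =>
      TetradData.smoothOn_nd oW (hp.mono sV).smooth_e A sg
    have sq : ∀ A, SmoothOn I W (q.nd A g) := fun A =>
      TetradData.smoothOn_nd oW (hq.mono sV).smooth_e A sg
    have sf : ∀ A, SmoothOn I W (f A) := fun A => (h.smooth_f A).mono sV
    have sψ : ∀ A, SmoothOn I W (ψ A) := fun A => (h'.smooth_ψ A).mono sV
    have uv : ∀ A B, u.nd A (v.nd B g) x = f A x * (f B x * scaleLog p Ω f A B x *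
        (ψ B x * p.nd B g x + q.nd B g x) + f B x * (p.nd A (ψ B) x * p.nd B g x
          + ψ B x * p.nd A (p.nd B g) x + p.nd A (q.nd B g) x)) := fun A B => by
      rw [h.nd_eq A _ x hx, TetradData.nd_congr A oW xW fun y hy => h'.nd_eq B g y (sV hy),
        TetradData.nd_mul A (md (sf B)) (md (((sψ B).mul (sp B)).add (sq B))),
        TetradData.nd_add A (md ((sψ B).mul (sp B))) (md (sq B)),
        TetradData.nd_mul A (md (sψ B)) (md (sp B)), h.nd_f hx]
    have vu : ∀ A B, v.nd A (u.nd B g) x = f A x * (ψ A x * (f B x * scaleLog p Ω f A B x *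
        p.nd B g x + f B x * p.nd A (p.nd B g) x) + (q.nd A (f B) x * p.nd B g x
          + f B x * q.nd A (p.nd B g) x)) := fun A B => by
      rw [h'.nd_eq A _ x hx, TetradData.nd_congr A oW xW fun y hy => h.nd_eq B g y (sV hy),
        TetradData.nd_congr A oW xW fun y hy => h.nd_eq B g y (sV hy),
        TetradData.nd_mul A (md (sf B)) (md (sp B)), TetradData.nd_mul A (md (sf B)) (md (sp B)),
        h.nd_f hx]
    rw [uv, vu, uv, vu] at cu
    simp only [h.nd_eq _ g x hx, h'.nd_eq _ g x hx] at cu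
    have hSu : contr (fun F => u.S A B F x) (fun F => f F x * q.nd F g x) =
        f A x * f B x * (contr (fun F => p.S A B F x) (fun F => q.nd F g x)
          + scaleLog p Ω f A B x * q.nd B g x - scaleLog p Ω f B A x * q.nd A g x) := by
      have e := h.contr_scaled hx (fun F => p.S A B F x + scaleLog p Ω f A B x * etaC B F
        - scaleLog p Ω f B A x * etaC A F) (fun F => q.nd F g x)
      have eB := contr_etaC_left B (fun F => q.nd F g x)
      have eA := contr_etaC_left A (fun F => q.nd F g x)
      simp only [h.S_eq hV hu hp hx]
      simp only [contr] at e eA eB ⊢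
      linear_combination f A x * f B x * (e + scaleLog p Ω f A B x * eB
        - scaleLog p Ω f B A x * eA)
    have eB := contr_etaC_left B (fun F => p.nd F g x)
    have eA := contr_etaC_left A (fun F => p.nd F g x)
    simp only [contr, primeIdx, Matrix.cons_val] at cu cp cq eA eB hSu ⊢
    linear_combination -cu + f A x * f B x * cq + f A x * f B x * (ψ A x + ψ B x) * cp - hSu
      - (f A x * f B x * (scaleLog p Ω f A B x * (ψ A x + ψ B x) + p.nd A (ψ B) x)
        + f A x * q.nd A (f B) x) * eB
      + (f A x * f B x * (scaleLog p Ω f B A x * (ψ A x + ψ B x) + p.nd B (ψ A) x)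
        + f B x * q.nd B (f A) x) * eA
  have hSu := h.S_eq hV hu hp hx A B C
  rw [hA, hB, hS] at hSu
  rw [hA, hB, hS] at key
  have hm := h.f_mul C x hx
  linear_combination (Ω x ^ 2 * f C x) * key - v.S A B C x * hm
    - Ω x ^ 2 * f C x * f (primeIdx C) x * ψ (primeIdx C) x * hSu

/-- The perturbed extreme Weyl scalars of a rescaled frame, where `κ = σ = 0`. -/
theorem IsLinearisedFrameScaling.pert_weylC (h : IsFrameScaling V u p Ω f)
    (h' : IsLinearisedFrameScaling V v p q f ψ) (hV : IsOpen V) (hu : IsLeviCivitaOn V u)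
    (hp : IsLeviCivitaOn V p) (hv : IsLinearisedLeviCivitaOn V u v)
    (hq : IsLinearisedLeviCivitaOn V p q) (hx : x ∈ V) (P : Fin 4 → Fin 4)
    (hP : P = id ∨ P = primeIdx) (hκ : ∀ y ∈ V, u.G (P 0) (P 0) (P 2) y = 0)
    (hσ : ∀ y ∈ V, u.G (P 2) (P 0) (P 2) y = 0) :
    pert (u.line v) (fun r => r.weylC (P 0) (P 2) (P 0) (P 2)) x =
      Ω x ^ 2 * f (P 0) x ^ 2 * f (P 2) x ^ 2 *
        pert (p.line q) (fun r => r.weylC (P 0) (P 2) (P 0) (P 2)) x := by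
  have E02 : etaC (P 0) (P 2) = 0 := by rcases hP with rfl | rfl <;> rfl
  have E00 : etaC (P 0) (P 0) = 0 := by rcases hP with rfl | rfl <;> rfl
  have E22 : etaC (P 2) (P 2) = 0 := by rcases hP with rfl | rfl <;> rfl
  have E20 : etaC (P 2) (P 0) = 0 := by rcases hP with rfl | rfl <;> rfl
  have mv := fun y hy => hv.metricDefect_eq_zero (x := y) hy
  have mq := fun y hy => hq.metricDefect_eq_zero (x := y) hy
  have nz : ∀ y ∈ V, ∀ A B C, Ω y ^ 2 * f A y * f B y * f C y ≠ 0 := fun y hy A B C =>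
    mul_ne_zero (mul_ne_zero (mul_ne_zero (pow_ne_zero 2 (h.Ω_ne hy)) (h.f_ne hy A)) (h.f_ne hy B))
      (h.f_ne hy C)
  -- κ and σ scale homogeneously, because the inhomogeneous part of `scaledG` multiplies metric
  -- components that are zero for these indices; so they vanish in the physical frame too.
  have kp : ∀ y ∈ V, p.G (P 0) (P 0) (P 2) y = 0 := fun y hy => by
    have := h.G_eq hV hu hp hy (P 0) (P 0) (P 2)
    rw [hκ y hy, scaledG, E02, E00] at this
    simpa using (mul_eq_zero.1 this.symm).resolve_left (nz y hy _ _ _)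
  have sp : ∀ y ∈ V, p.G (P 2) (P 0) (P 2) y = 0 := fun y hy => by
    have := h.G_eq hV hu hp hy (P 2) (P 0) (P 2)
    rw [hσ y hy, scaledG, E22, E20, E02] at this
    simpa using (mul_eq_zero.1 this.symm).resolve_left (nz y hy _ _ _)
  have diag : ∀ {r : TetradData I M} {y : M}, (∀ a b c, r.metricDefect a b c y = 0) → ∀ A B,
      r.G A B B y = 0 := fun hr A B => (TetradData.G_rules hr).1 A B
  -- κ' and σ' are read off structure functions, the other term of each antisymmetrised pair being
  -- zero by metricity.
  have kv : ∀ y ∈ V, v.G (P 0) (P 0) (P 2) y = Ω y ^ 2 * f (P 0) y * f (P 0) y * f (P 2) y *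
      q.G (P 0) (P 0) (P 2) y := fun y hy => by
    have e := h'.S_eq h hV hu hp hv hq hy E00 E20 (by
      rw [TetradData.S, TetradData.G_antisymm (hp.metric y hy), kp y hy, diag (hp.metric y hy)]
      simp)
    rw [TetradData.S, TetradData.S, TetradData.G_antisymm (mv y hy) (P 0),
      TetradData.G_antisymm (mq y hy) (P 0), diag (mv y hy), diag (mq y hy)] at e
    linear_combination -e
  have sv : ∀ y ∈ V, v.G (P 2) (P 0) (P 2) y = Ω y ^ 2 * f (P 0) y * f (P 2) y * f (P 2) y *
      q.G (P 2) (P 0) (P 2) y := fun y hy => by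
    have e := h'.S_eq h hV hu hp hv hq hy E02 E22 (by
      rw [TetradData.S, sp y hy, diag (hp.metric y hy)]
      simp)
    rw [TetradData.S, TetradData.S, diag (mv y hy), diag (mq y hy)] at e
    linear_combination -e
  have du := (TetradData.hasDerivAt_riemC_aligned hV hx hu.smooth_Γ hv.smooth_Γ hu.metric mv P hP
    hκ hσ).deriv
  have dp := (TetradData.hasDerivAt_riemC_aligned hV hx hp.smooth_Γ hq.smooth_Γ hp.metric mq P hP
    kp sp).deriv
  simp only [pert, TetradData.weylC_eq_riemC _ _ P hP]
  -- Both sides are the same first-order expression in κ' and σ'. Derivatives of the weights cancel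
  -- against the inhomogeneous parts of the background coefficients.
  rw [du, dp, h.nd_eq _ _ x hx, h.nd_eq _ _ x hx, TetradData.nd_congr _ hV hx kv,
    TetradData.nd_congr _ hV hx sv, h.nd_scaled hV hx (TetradData.smoothOn_G hq.smooth_Γ _ _ _),
    h.nd_scaled hV hx (TetradData.smoothOn_G hq.smooth_Γ _ _ _), kv x hx, sv x hx]
  simp only [h.G_eq hV hu hp hx]
  clear du dp kv sv kp sp mv mq hκ hσ E02 E00 E22 E20 nz diag
  have h0 : f 0 x * f 1 x * Ω x ^ 2 = 1 := h.f_mul 0 x hx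
  have h2 : f 2 x * f 3 x * Ω x ^ 2 = 1 := h.f_mul 2 x hx
  have e1 : f 1 x = (f 0 x * Ω x ^ 2)⁻¹ := eq_inv_of_mul_eq_one_left (by linear_combination h0)
  have e3 : f 3 x = (f 2 x * Ω x ^ 2)⁻¹ := eq_inv_of_mul_eq_one_left (by linear_combination h2)
  have n0 := h.f_ne hx 0
  have n2 := h.f_ne hx 2
  have nΩ := h.Ω_ne hx
  rcases hP with rfl | rfl
  all_goals
    simp [primeIdx, scaledG, etaC]
    rw [e1, e3]
    field_simp
    ring

end

/-! ### The physical frame -/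

/-- The factors relating the unphysical null frame to the physical one. -/
def physFactor (w : ℝ) (Ξ b θ : M → ℝ) : Fin 4 → M → ℂ :=
  ![fun y => ((Ξ y ^ (-2 - 2 * w) * b y : ℝ) : ℂ), fun y => ((Ξ y ^ (2 * w) * (b y)⁻¹ : ℝ) : ℂ),
    fun y => (((Ξ y)⁻¹ : ℝ) : ℂ) * (((Real.cos (θ y) : ℝ) : ℂ) + Complex.I * (Real.sin (θ y) : ℝ)),
    fun y => (((Ξ y)⁻¹ : ℝ) : ℂ) * (((Real.cos (θ y) : ℝ) : ℂ) - Complex.I * (Real.sin (θ y) : ℝ))]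

/-- The logarithmic perturbations of these factors. -/
def physLog (w : ℝ) (Ξ b Ξ' b' θ' : M → ℝ) : Fin 4 → M → ℂ :=
  ![fun y => (((-2 - 2 * w) * (Ξ' y * (Ξ y)⁻¹) + b' y * (b y)⁻¹ : ℝ) : ℂ),
    fun y => ((2 * w * (Ξ' y * (Ξ y)⁻¹) - b' y * (b y)⁻¹ : ℝ) : ℂ),
    fun y => -((Ξ' y * (Ξ y)⁻¹ : ℝ) : ℂ) + Complex.I * (θ' y : ℂ),
    fun y => -((Ξ' y * (Ξ y)⁻¹ : ℝ) : ℂ) - Complex.I * (θ' y : ℂ)]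

theorem dir_linear_combination {X Y Z : ∀ x : M, TangentSpace I x} {x : M} {α β : ℝ} {g : M → ℂ}
    (h : X x = α • Y x + β • Z x) : dir X g x = α * dir Y g x + β * dir Z g x := by
  unfold dir
  rw [h, map_add, map_smul, map_smul]
  exact congrArg₂ (· + ·) Complex.real_smul Complex.real_smul

theorem dir_linear_combination₄ {X Y Y' Z Z' : ∀ x : M, TangentSpace I x} {x : M}
    {α α' β β' : ℝ} {g : M → ℂ} (h : X x = (α' • Y x + α • Y' x) + (β' • Z x + β • Z' x)) :
    dir X g x = α' * dir Y g x + α * dir Y' g x + (β' * dir Z g x + β * dir Z' g x) := by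
  rw [← dir_linear_combination (X := fun y => α' • Y y + α • Y' y) rfl,
    ← dir_linear_combination (X := fun y => β' • Z y + β • Z' y) rfl]
  unfold dir
  rw [h, map_add]
  rfl

/-- Product rule for the alignment condition, solved for the perturbed vector. Working in `E4`, the
model of every tangent space, keeps these ordinary derivatives in t. -/
theorem eq_of_hasDerivAt_align {X X' Y Y' Z Z' : E4} {α β : ℝ → ℝ} {α' β' : ℝ}
    (hα : HasDerivAt α α' 0) (hβ : HasDerivAt β β' 0)
    (h : HasDerivAt (fun t : ℝ => X + t • X' - (α t • (Y + t • Y') + β t • (Z + t • Z'))) 0 0) :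
    X' = (α' • Y + α 0 • Y') + (β' • Z + β 0 • Z') := by
  have line : ∀ Y Y' : E4, HasDerivAt (fun t : ℝ => Y + t • Y') Y' 0 := fun Y Y' => by
    simpa using ((hasDerivAt_id (0 : ℝ)).smul_const Y').const_add Y
  have h1 := (line X X').sub ((hα.smul (line Y Y')).add (hβ.smul (line Z Z')))
  have h2 := h.unique h1
  simp only [zero_smul, add_zero] at h2
  rw [eq_comm, sub_eq_zero] at h2
  rw [h2]
  abel

theorem ContMDiffOn.comp_real {V : Set M} {k : M → ℝ} (hk : ContMDiffOn I 𝓘(ℝ, ℝ) ∞ k V) {h : ℝ → ℝ}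
    (hh : ∀ y ∈ V, ContDiffAt ℝ ∞ h (k y)) : ContMDiffOn I 𝓘(ℝ, ℝ) ∞ (fun y => h (k y)) V :=
  fun y hy => (hh y hy).comp_contMDiffWithinAt (hk y hy)

section

variable [IsManifold I ∞ M] {V : Set M} {u v : ConformalData I M} {p q : TetradData I M}
  {w : ℝ} {b θ b' θ' : M → ℝ}

/-- The exponents satisfy (−2 − 2w) + 2w + 2 = 0 and the boosts b and b⁻¹ cancel, so the factors of
ℓ and k multiply to Ξ⁻²; for m and m* this is cos² + sin² = 1. -/
theorem IsPhysicalOn.isFrameScaling (h : IsPhysicalOn V w b θ u p)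
    (hΞ : ContMDiffOn I 𝓘(ℝ, ℝ) ∞ u.Ξ V) (hpos : ∀ x ∈ V, 0 < u.Ξ x) :
    IsFrameScaling V u.toTetradData p (fun y => (u.Ξ y : ℂ)) (physFactor w u.Ξ b θ) := by
  have hinv : ContMDiffOn I 𝓘(ℝ, ℝ) ∞ (fun y => (u.Ξ y)⁻¹) V :=
    ContMDiffOn.comp_real hΞ fun y hy => contDiffAt_inv ℝ (hpos y hy).ne'
  have hbinv : ContMDiffOn I 𝓘(ℝ, ℝ) ∞ (fun y => (b y)⁻¹) V :=
    ContMDiffOn.comp_real h.smooth_b fun y hy => contDiffAt_inv ℝ (h.b_ne y hy)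
  have hpow : ∀ r : ℝ, ContMDiffOn I 𝓘(ℝ, ℝ) ∞ (fun y => u.Ξ y ^ r) V := fun r =>
    ContMDiffOn.comp_real (h := fun z => z ^ r) hΞ fun y hy =>
      Real.contDiffAt_rpow_const_of_ne (hpos y hy).ne'
  have hcos : ContMDiffOn I 𝓘(ℝ, ℝ) ∞ (fun y => Real.cos (θ y)) V :=
    ContMDiffOn.comp_real h.smooth_θ fun y _ => Real.contDiff_cos.contDiffAt
  have hsin : ContMDiffOn I 𝓘(ℝ, ℝ) ∞ (fun y => Real.sin (θ y)) V :=
    ContMDiffOn.comp_real h.smooth_θ fun y _ => Real.contDiff_sin.contDiffAt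
  refine ⟨SmoothOn.ofReal hΞ, fun A => ?_, fun A y hy => ?_, fun A g y hy => ?_⟩
  · fin_cases A
    · exact SmoothOn.ofReal ((hpow _).mul h.smooth_b)
    · exact SmoothOn.ofReal ((hpow _).mul hbinv)
    · exact (SmoothOn.ofReal hinv).mul
        ((SmoothOn.ofReal hcos).add ((SmoothOn.ofReal hsin).const_mul _))
    · exact (SmoothOn.ofReal hinv).mul
        ((SmoothOn.ofReal hcos).sub ((SmoothOn.ofReal hsin).const_mul _))
  · have e0 : u.Ξ y ^ (-2 - 2 * w) * b y * (u.Ξ y ^ (2 * w) * (b y)⁻¹) * u.Ξ y ^ 2 = 1 := by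
      have hb := h.b_ne y hy
      have e : u.Ξ y ^ (-2 - 2 * w) * u.Ξ y ^ (2 * w) * u.Ξ y ^ 2 = 1 := by
        rw [← Real.rpow_natCast, ← Real.rpow_add (hpos y hy), ← Real.rpow_add (hpos y hy)]
        norm_num
      have hb' : b y * (b y)⁻¹ = 1 := mul_inv_cancel₀ hb
      linear_combination (b y * (b y)⁻¹) * e + hb'
    have e2 : ((u.Ξ y)⁻¹ : ℂ) * (u.Ξ y) = 1 :=
      inv_mul_cancel₀ (by exact_mod_cast (hpos y hy).ne')
    have e3 : ((Real.cos (θ y) : ℝ) : ℂ) ^ 2 + ((Real.sin (θ y) : ℝ) : ℂ) ^ 2 = 1 := by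
      exact_mod_cast Real.cos_sq_add_sin_sq (θ y)
    have hi := Complex.I_sq
    have e0' : ((u.Ξ y ^ (-2 - 2 * w) * b y : ℝ) : ℂ) * ((u.Ξ y ^ (2 * w) * (b y)⁻¹ : ℝ) : ℂ) *
      (u.Ξ y : ℂ) ^ 2 = 1 := by exact_mod_cast e0
    have e2' : (((u.Ξ y)⁻¹ : ℝ) : ℂ) * (((Real.cos (θ y) : ℝ) : ℂ)
        + Complex.I * (Real.sin (θ y) : ℝ)) * ((((u.Ξ y)⁻¹ : ℝ) : ℂ) * (((Real.cos (θ y) : ℝ) : ℂ)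
        - Complex.I * (Real.sin (θ y) : ℝ))) * (u.Ξ y : ℂ) ^ 2 = 1 := by
      rw [Complex.ofReal_inv]
      linear_combination ((u.Ξ y : ℂ)⁻¹ * u.Ξ y + 1) * e2 + ((u.Ξ y : ℂ)⁻¹ * u.Ξ y) ^ 2 *
        (e3 - ((Real.sin (θ y) : ℝ) : ℂ) ^ 2 * hi)
    fin_cases A
    · exact e0'
    · exact (congrArg (· * (u.Ξ y : ℂ) ^ 2) (mul_comm _ _)).trans e0'
    · exact e2'
    · exact (congrArg (· * (u.Ξ y : ℂ) ^ 2) (mul_comm _ _)).trans e2'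
  · have d0 : dir (u.e 0) g y = ((u.Ξ y ^ (-2 - 2 * w) * b y : ℝ) : ℂ) * dir (p.e 0) g y
        + ((0 : ℝ) : ℂ) * dir (p.e 0) g y := dir_linear_combination (by
      rw [zero_smul, add_zero]
      exact sub_eq_zero.1 (h.align y hy 0))
    have d1 : dir (u.e 1) g y = ((u.Ξ y ^ (2 * w) * (b y)⁻¹ : ℝ) : ℂ) * dir (p.e 1) g y
        + ((0 : ℝ) : ℂ) * dir (p.e 1) g y := dir_linear_combination (by
      rw [zero_smul, add_zero]
      exact sub_eq_zero.1 (h.align y hy 1))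
    have d2 : dir (u.e 2) g y = (((u.Ξ y)⁻¹ * Real.cos (θ y) : ℝ) : ℂ) * dir (p.e 2) g y
        + ((-((u.Ξ y)⁻¹ * Real.sin (θ y)) : ℝ) : ℂ) * dir (p.e 3) g y :=
      dir_linear_combination (by
        refine (sub_eq_zero.1 (h.align y hy 2)).trans ?_
        rw [smul_sub, smul_smul, smul_smul, neg_smul, sub_eq_add_neg])
    have d3 : dir (u.e 3) g y = (((u.Ξ y)⁻¹ * Real.sin (θ y) : ℝ) : ℂ) * dir (p.e 2) g y
        + (((u.Ξ y)⁻¹ * Real.cos (θ y) : ℝ) : ℂ) * dir (p.e 3) g y :=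
      dir_linear_combination (by
        refine (sub_eq_zero.1 (h.align y hy 3)).trans ?_
        rw [smul_add, smul_smul, smul_smul])
    have hi := Complex.I_sq
    simp only [TetradData.nd, TetradData.along, Fin.sum_univ_four, d0, d1, d2, d3, nullFrame_eq]
    generalize (1 / (Real.sqrt 2 : ℂ)) = s
    simp only [Complex.ofReal_mul, Complex.ofReal_neg, Complex.ofReal_zero, physFactor]
    fin_cases A
    · simp
    · simp
    · simp only [Fin.reduceFinMk, Matrix.cons_val, zero_mul, zero_add]
      linear_combination (-(s * ((u.Ξ y)⁻¹ : ℝ) * ((Real.sin (θ y) : ℝ) : ℂ) * dir (p.e 3) g y)) * hi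
    · simp only [Fin.reduceFinMk, Matrix.cons_val, zero_mul, zero_add]
      linear_combination (-(s * ((u.Ξ y)⁻¹ : ℝ) * ((Real.sin (θ y) : ℝ) : ℂ) * dir (p.e 3) g y)) * hi

/-- The perturbation of each factor is the factor times its logarithmic perturbation `physLog`;
first-order alignment then determines the perturbed frame. -/
theorem IsLinearisedPhysicalOn.isLinearisedFrameScaling (h : IsPhysicalOn V w b θ u p)
    (h' : IsLinearisedPhysicalOn V w b θ b' θ' u v p q) (hΞ : ContMDiffOn I 𝓘(ℝ, ℝ) ∞ u.Ξ V)
    (hΞ' : ContMDiffOn I 𝓘(ℝ, ℝ) ∞ v.Ξ V) (hpos : ∀ x ∈ V, 0 < u.Ξ x) :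
    IsLinearisedFrameScaling V v.toTetradData p q (physFactor w u.Ξ b θ)
      (physLog w u.Ξ b v.Ξ b' θ') := by
  have hinv : ContMDiffOn I 𝓘(ℝ, ℝ) ∞ (fun y => (u.Ξ y)⁻¹) V :=
    ContMDiffOn.comp_real hΞ fun y hy => contDiffAt_inv ℝ (hpos y hy).ne'
  have hbinv : ContMDiffOn I 𝓘(ℝ, ℝ) ∞ (fun y => (b y)⁻¹) V :=
    ContMDiffOn.comp_real h.smooth_b fun y hy => contDiffAt_inv ℝ (h.b_ne y hy)
  have hl : ContMDiffOn I 𝓘(ℝ, ℝ) ∞ (fun y => v.Ξ y * (u.Ξ y)⁻¹) V := hΞ'.mul hinv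
  have hb : ContMDiffOn I 𝓘(ℝ, ℝ) ∞ (fun y => b' y * (b y)⁻¹) V := h'.smooth_b.mul hbinv
  refine ⟨fun A => ?_, fun A g y hy => ?_⟩
  · fin_cases A
    · exact SmoothOn.ofReal ((contMDiffOn_const.mul hl).add hb)
    · exact SmoothOn.ofReal ((contMDiffOn_const.mul hl).sub hb)
    · exact (SmoothOn.ofReal hl).neg.add ((SmoothOn.ofReal h'.smooth_θ).const_mul _)
    · exact (SmoothOn.ofReal hl).neg.sub ((SmoothOn.ofReal h'.smooth_θ).const_mul _)
  · have nΞ := (hpos y hy).ne'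
    have nb := h.b_ne y hy
    have lin : ∀ c c' : ℝ, HasDerivAt (fun t : ℝ => c + t * c') c' 0 := fun c c' => by
      simpa using ((hasDerivAt_id (0 : ℝ)).mul_const c').const_add c
    have lΞ := lin (u.Ξ y) (v.Ξ y)
    have lb := lin (b y) (b' y)
    have lθ := lin (θ y) (θ' y)
    have linv : HasDerivAt (fun t : ℝ => (u.Ξ y + t * v.Ξ y)⁻¹)
        (-(v.Ξ y * (u.Ξ y)⁻¹) * (u.Ξ y)⁻¹) 0 :=
      (lΞ.fun_inv (by simpa using nΞ)).congr_deriv (by simp; field_simp)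
    have lbinv : HasDerivAt (fun t : ℝ => (b y + t * b' y)⁻¹)
        (-(b' y * (b y)⁻¹) * (b y)⁻¹) 0 :=
      (lb.fun_inv (by simpa using nb)).congr_deriv (by simp; field_simp)
    have lpow : ∀ r : ℝ, HasDerivAt (fun t : ℝ => (u.Ξ y + t * v.Ξ y) ^ r)
        (r * (v.Ξ y * (u.Ξ y)⁻¹) * u.Ξ y ^ r) 0 := fun r =>
      (lΞ.rpow_const (Or.inl (by simpa using nΞ))).congr_deriv (by
        simp only [zero_mul, add_zero]
        rw [Real.rpow_sub_one nΞ]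
        field_simp)
    have lcos : HasDerivAt (fun t : ℝ => Real.cos (θ y + t * θ' y)) (-Real.sin (θ y) * θ' y) 0 :=
      lθ.cos.congr_deriv (by simp)
    have lsin : HasDerivAt (fun t : ℝ => Real.sin (θ y + t * θ' y)) (Real.cos (θ y) * θ' y) 0 :=
      lθ.sin.congr_deriv (by simp)
    have single : ∀ {X X' Y Y' : E4} {α : ℝ → ℝ} {α' : ℝ}, HasDerivAt α α' 0 →
        HasDerivAt (fun t : ℝ => X + t • X' - α t • (Y + t • Y')) 0 0 →
        X' = α' • Y + α 0 • Y' := fun {X X' Y Y' α α'} hα hX => by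
      have := eq_of_hasDerivAt_align hα (hasDerivAt_const (0 : ℝ) (0 : ℝ)) (Z := 0) (Z' := 0)
        (X := X) (X' := X') (Y := Y) (Y' := Y') (by simpa using hX)
      simpa using this
    have d0 : dir (v.e 0) g y = _ := dir_linear_combination (X := v.e 0) (Y := p.e 0) (Z := q.e 0)
      (single ((lpow (-2 - 2 * w)).mul lb) (h'.align y hy 0))
    have d1 : dir (v.e 1) g y = _ := dir_linear_combination (X := v.e 1) (Y := p.e 1) (Z := q.e 1)
      (single ((lpow (2 * w)).mul lbinv) (h'.align y hy 1))
    have d2 : dir (v.e 2) g y = _ := dir_linear_combination₄ (X := v.e 2) (Y := p.e 2)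
      (Y' := q.e 2) (Z := p.e 3) (Z' := q.e 3)
      (eq_of_hasDerivAt_align (linv.mul lcos) (linv.mul lsin).neg ((h'.align y hy 2).congr_of_eventuallyEq
        (Eventually.of_forall fun t => by
          change _ = u.e 2 y + t • v.e 2 y - (u.Ξ y + t * v.Ξ y)⁻¹ • (Real.cos (θ y + t * θ' y) •
            (p.e 2 y + t • q.e 2 y) - Real.sin (θ y + t * θ' y) • (p.e 3 y + t • q.e 3 y))
          rw [smul_sub, smul_smul, smul_smul, sub_eq_add_neg (_ • _) (_ • _), ← neg_smul]
          rfl)))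
    have d3 : dir (v.e 3) g y = _ := dir_linear_combination₄ (X := v.e 3) (Y := p.e 2)
      (Y' := q.e 2) (Z := p.e 3) (Z' := q.e 3)
      (eq_of_hasDerivAt_align (linv.mul lsin) (linv.mul lcos) ((h'.align y hy 3).congr_of_eventuallyEq
        (Eventually.of_forall fun t => by
          change _ = u.e 3 y + t • v.e 3 y - (u.Ξ y + t * v.Ξ y)⁻¹ • (Real.sin (θ y + t * θ' y) •
            (p.e 2 y + t • q.e 2 y) + Real.cos (θ y + t * θ' y) • (p.e 3 y + t • q.e 3 y))
          rw [smul_add, smul_smul, smul_smul]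
          rfl)))
    have hi := Complex.I_sq
    have hb1 : (b y : ℂ) * ((b y)⁻¹ : ℝ) = 1 := by
      rw [Complex.ofReal_inv]
      exact mul_inv_cancel₀ (by exact_mod_cast nb)
    simp only [Pi.mul_apply, Pi.neg_apply, zero_mul, add_zero, Complex.ofReal_mul,
      Complex.ofReal_neg, Complex.ofReal_add] at d0 d1 d2 d3
    simp only [TetradData.nd, TetradData.along, Fin.sum_univ_four, d0, d1, d2, d3, nullFrame_eq]
    generalize (1 / (Real.sqrt 2 : ℂ)) = s
    simp only [Complex.ofReal_mul, Complex.ofReal_neg, Complex.ofReal_add, Complex.ofReal_sub,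
      physFactor, physLog]
    fin_cases A
    · simp only [Matrix.cons_val, zero_mul, one_mul, add_zero, Fin.zero_eta]
      linear_combination (-((u.Ξ y ^ (-2 - 2 * w) : ℝ) : ℂ) * b' y * dir (p.e 0) g y) * hb1
    · simp only [Matrix.cons_val, zero_mul, zero_add, one_mul, add_zero, Fin.mk_one]
      ring
    · simp only [Fin.reduceFinMk, Matrix.cons_val, zero_mul, zero_add]
      linear_combination (-(((u.Ξ y)⁻¹ : ℝ) : ℂ) * s * (((Real.sin (θ y) : ℝ) : ℂ) * (dir (q.e 3) g y
        - v.Ξ y * ((u.Ξ y)⁻¹ : ℝ) * dir (p.e 3) g y + θ' y * dir (p.e 2) g y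
        + Complex.I * θ' y * dir (p.e 3) g y)
        + ((Real.cos (θ y) : ℝ) : ℂ) * θ' y * dir (p.e 3) g y)) * hi
    · simp only [Fin.reduceFinMk, Matrix.cons_val, zero_mul, zero_add]
      linear_combination (-(((u.Ξ y)⁻¹ : ℝ) : ℂ) * s * (((Real.sin (θ y) : ℝ) : ℂ) * (dir (q.e 3) g y
        - v.Ξ y * ((u.Ξ y)⁻¹ : ℝ) * dir (p.e 3) g y + θ' y * dir (p.e 2) g y
        - Complex.I * θ' y * dir (p.e 3) g y)
        + ((Real.cos (θ y) : ℝ) : ℂ) * θ' y * dir (p.e 3) g y)) * hi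

end

end CEFE

end

/-! ### The proposition: equations, unphysical scalars, physical scalars -/

open CEFE in
theorem proposition2 {H : Type*} [TopologicalSpace H] (I : ModelWithCorners ℝ E4 H)
    {M : Type*} [TopologicalSpace M] [ChartedSpace H M] [IsManifold I ∞ M]
    (U : Set M) (hU : IsOpen U)
    (u : ConformalData I M) (hu : IsSolutionOn U u) (hD : IsAlignedTypeDOn U u)
    (v : ConformalData I M) (hv : IsLinearisedSolutionOn U u v) :
    (∀ x ∈ U, teukolsky0 u v.φ0 x = 0 ∧ teukolsky4 u v.φ4 x = 0) ∧
    (∀ x ∈ U, u.Ξ x ≠ 0 →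
      u.φ2 x = (u.Ξ x : ℂ)⁻¹ * u.Ψ2 x ∧
      v.φ0 x = (u.Ξ x : ℂ)⁻¹ * pert (u.toTetradData.line v.toTetradData) TetradData.Ψ0 x ∧
      v.φ4 x = (u.Ξ x : ℂ)⁻¹ * pert (u.toTetradData.line v.toTetradData) TetradData.Ψ4 x) ∧
    (∀ V ⊆ U, IsOpen V → (∀ x ∈ V, 0 < u.Ξ x) →
      ∀ (w : ℝ) (b θ b' θ' : M → ℝ) (p q : TetradData I M),
        IsPhysicalOn V w b θ u p → IsLinearisedPhysicalOn V w b θ b' θ' u v p q →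
        ∀ x ∈ V,
          u.φ2 x = ((u.Ξ x ^ (-3 : ℝ) : ℝ) : ℂ) * p.Ψ2 x ∧
          v.φ0 x = ((u.Ξ x ^ (-5 - 4 * w) * b x ^ 2 : ℝ) : ℂ) *
            Complex.exp (2 * Complex.I * (θ x : ℂ)) * pert (p.line q) TetradData.Ψ0 x ∧
          v.φ4 x = ((u.Ξ x ^ (-1 + 4 * w) * (b x ^ 2)⁻¹ : ℝ) : ℂ) *
            Complex.exp (-2 * Complex.I * (θ x : ℂ)) * pert (p.line q) TetradData.Ψ4 x) := by
  refine ⟨fun x hx => ⟨hv.teukolsky0_eq_zero hU hu hD hx, hv.teukolsky4_eq_zero hU hu hD hx⟩,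
    fun x hx hΞ => ?_, fun V hVU hV hpos w b θ b' θ' p q hp hq x hx => ?_⟩
  · have hΞ' : (u.Ξ x : ℂ) ≠ 0 := by exact_mod_cast hΞ
    refine ⟨?_, ?_, ?_⟩
    · rw [eq_inv_mul_iff_mul_eq₀ hΞ']
      exact (hu.weylC_eq hx 0 2 3 1).symm
    · rw [eq_inv_mul_iff_mul_eq₀ hΞ']
      exact (hv.pert_weylC hu hD hx id (Or.inl rfl)).symm
    · rw [eq_inv_mul_iff_mul_eq₀ hΞ']
      exact (hv.pert_weylC hu hD hx primeIdx (Or.inr rfl)).symm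
  · have hΞ : (u.Ξ x : ℂ) ≠ 0 := by exact_mod_cast (hpos x hx).ne'
    have s := hp.isFrameScaling (hu.smooth_Ξ.mono hVU) hpos
    have s' := hq.isLinearisedFrameScaling hp (hu.smooth_Ξ.mono hVU) (hv.smooth_Ξ.mono hVU) hpos
    have lu := hu.leviCivita.mono hVU
    have lv := hv.leviCivita.mono hVU
    -- The same perturbed Weyl scalar is computed from the rescaled Weyl tensor and from the
    -- physical frame.
    have key : ∀ P : Fin 4 → Fin 4, P = id ∨ P = primeIdx →
        (u.Ξ x : ℂ) * v.dn (P 0) (P 2) (P 0) (P 2) x = _ := fun P hP =>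
      (hv.pert_weylC hu hD (hVU hx) P hP).symm.trans (s'.pert_weylC s hV lu hp.leviCivita lv
        hq.leviCivita hx P hP (fun y hy => (hu.bianchi_typeD hU hD (hVU hy) P hP).1)
        (fun y hy => (hu.bianchi_typeD hU hD (hVU hy) P hP).2.1))
    -- For r the exponent of Ξ in the factor of ℓ or k, 2r − 1 is the final exponent: the vector
    -- enters the component twice, and Ψ = Ξφ lowers the power by one. The Ξ² of the metric cancels
    -- the Ξ⁻² coming from m or m*.
    have pow_mul : ∀ r : ℝ, (u.Ξ x : ℂ) * ((u.Ξ x ^ (r + r - 1) : ℝ) : ℂ) =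
        ((u.Ξ x ^ r : ℝ) : ℂ) ^ 2 := fun r => by
      have : u.Ξ x * u.Ξ x ^ (r + r - 1) = (u.Ξ x ^ r) ^ 2 := by
        rw [sq, ← Real.rpow_add (hpos x hx), Real.rpow_sub_one (hpos x hx).ne',
          mul_div_cancel₀ _ (hpos x hx).ne']
      exact_mod_cast this
    have inv_mul : (((u.Ξ x)⁻¹ : ℝ) : ℂ) * u.Ξ x = 1 := by
      rw [Complex.ofReal_inv]
      exact inv_mul_cancel₀ hΞ
    have exp_sq : ∀ z : ℝ, Complex.exp (2 * Complex.I * (z : ℂ)) =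
        (((Real.cos z : ℝ) : ℂ) + Complex.I * (Real.sin z : ℝ)) ^ 2 := fun z => by
      rw [show 2 * Complex.I * (z : ℂ) = (z * Complex.I) + (z * Complex.I) by ring,
        Complex.exp_add, Complex.exp_mul_I, ← Complex.ofReal_cos, ← Complex.ofReal_sin]
      ring
    refine ⟨?_, ?_, ?_⟩
    · have h1 := s.weylC_scaled hV lu hp.leviCivita hx
      rw [hu.weylC_eq (hVU hx)] at h1
      have h2 : u.φ2 x * (u.Ξ x : ℂ) ^ 3 = p.Ψ2 x := by
        refine Eq.trans ?_ h1
        change u.dn 0 2 3 1 x * (u.Ξ x : ℂ) ^ 3 = _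
        ring
      have h3 : ((u.Ξ x ^ (-3 : ℝ) : ℝ) : ℂ) * (u.Ξ x : ℂ) ^ 3 = 1 := by
        have : u.Ξ x ^ (-3 : ℝ) * u.Ξ x ^ 3 = 1 := by
          rw [← Real.rpow_natCast, ← Real.rpow_add (hpos x hx)]
          norm_num
        exact_mod_cast this
      rw [← h2]
      linear_combination -u.φ2 x * h3
    · have h1 : (u.Ξ x : ℂ) * v.φ0 x = (u.Ξ x : ℂ) ^ 2 *
          ((u.Ξ x ^ (-2 - 2 * w) * b x : ℝ) : ℂ) ^ 2 * ((((u.Ξ x)⁻¹ : ℝ) : ℂ) *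
            (((Real.cos (θ x) : ℝ) : ℂ) + Complex.I * (Real.sin (θ x) : ℝ))) ^ 2 *
          pert (p.line q) TetradData.Ψ0 x := key id (Or.inl rfl)
      have h2 := pow_mul (-2 - 2 * w)
      rw [show (-2 - 2 * w) + (-2 - 2 * w) - 1 = -5 - 4 * w by ring] at h2
      refine mul_left_cancel₀ hΞ (h1.trans ?_)
      rw [exp_sq]
      simp only [Complex.ofReal_mul, Complex.ofReal_pow]
      linear_combination (b x ^ 2 * (((Real.cos (θ x) : ℝ) : ℂ)
        + Complex.I * (Real.sin (θ x) : ℝ)) ^ 2 * pert (p.line q) TetradData.Ψ0 x) *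
        (((u.Ξ x ^ (-2 - 2 * w) : ℝ) : ℂ) ^ 2 * ((((u.Ξ x)⁻¹ : ℝ) : ℂ) * u.Ξ x + 1) * inv_mul - h2)
    · have h1 : (u.Ξ x : ℂ) * v.φ4 x = (u.Ξ x : ℂ) ^ 2 *
          ((u.Ξ x ^ (2 * w) * (b x)⁻¹ : ℝ) : ℂ) ^ 2 * ((((u.Ξ x)⁻¹ : ℝ) : ℂ) *
            (((Real.cos (θ x) : ℝ) : ℂ) - Complex.I * (Real.sin (θ x) : ℝ))) ^ 2 *
          pert (p.line q) TetradData.Ψ4 x := key primeIdx (Or.inr rfl)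
      have h2 := pow_mul (2 * w)
      rw [show 2 * w + 2 * w - 1 = -1 + 4 * w by ring] at h2
      have h3 : Complex.exp (-2 * Complex.I * (θ x : ℂ)) = (((Real.cos (θ x) : ℝ) : ℂ)
          - Complex.I * (Real.sin (θ x) : ℝ)) ^ 2 := by
        rw [show -2 * Complex.I * (θ x : ℂ) = 2 * Complex.I * ((-θ x : ℝ) : ℂ) by push_cast; ring,
          exp_sq, Real.cos_neg, Real.sin_neg, Complex.ofReal_neg]
        ring
      refine mul_left_cancel₀ hΞ (h1.trans ?_)
      rw [h3, ← inv_pow]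
      simp only [Complex.ofReal_mul, Complex.ofReal_pow]
      linear_combination ((((b x)⁻¹ : ℝ) : ℂ) ^ 2 * (((Real.cos (θ x) : ℝ) : ℂ)
        - Complex.I * (Real.sin (θ x) : ℝ)) ^ 2 * pert (p.line q) TetradData.Ψ4 x) *
        (((u.Ξ x ^ (2 * w) : ℝ) : ℂ) ^ 2 * ((((u.Ξ x)⁻¹ : ℝ) : ℂ) * u.Ξ x + 1) * inv_mul - h2)
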